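/- Let $\Omega\subset\mathbb R^3$ be a bounded domain with Lipschitz boundary, $T>0$, $n\ge 1$. Consider $n$ ideal gases with molar masses $m_i>0$, heat capacity $c_w>0$ and free energy densities $\rho_i\psi_i=\theta\frac{\rho_i}{m_i}(\ln\frac{\rho_i}{m_i}-1)-c_w\rho_i\theta(\ln\theta-1)$, and put $\mu_i=\partial_{\rho_i}(\rho_i\psi_i)$, $\rho_i\eta_i=-\partial_\theta(\rho_i\psi_i)$, $\rho_ie_i=\rho_i\psi_i+\theta\rho_i\eta_i$, $p_i=-\rho_i\psi_i+\rho_i\mu_i$, $\rho=\sum_i\rho_i$, $\rho e=\sum_i\rho_ie_i$, $p=\sum_ip_i$. The Maxwell--Stefan--Fourier system with zero barycentric velocity for the mass densities $\rho_i$ and the temperature $\theta$ is $$\partial_t\rho_i+\operatorname{div}J_i=0,\qquad \nabla p=0,\qquad \partial_t(\rho e)+\operatorname{div}J_e=0\qquad\text{in }\Omega\times(0,T),$$ $$J_i=\rho_iu_i,\qquad J_e=-\kappa\nabla\theta+\sum_i(\rho_ie_i+p_i)u_i,$$ where the diffusional velocities $u_i$ solve, with a fixed $\epsilon>0$, $$-\theta\sum_{j\ne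 i}b_{ij}\rho_i\rho_j(u_i-u_j)=\epsilon d_i,\quad \sum_i\rho_iu_i=0,\quad d_i=-\frac{\rho_i}{\rho}\nabla p+\rho_i\theta\nabla\frac{\mu_i}{\theta}-\theta(\rho_ie_i+p_i)\nabla\frac1\theta ,$$ with the boundary conditions $J_i\cdot\nu=0$, $J_e\cdot\nu=0$ on $\partial\Omega$ and the initial conditions $\rho_i(\cdot,0)=\rho_i^0$, $\theta(\cdot,0)=\theta^0$. The coefficients $b_{ij}=b_{ji}$ ($i\neq j$) are positive functions of $(\rho_i,\rho_j,\theta)\in[0,\infty)^3$, and the thermal conductivity $\kappa=\kappa(\rho_1,\dots,\rho_n,\theta)$ satisfies $c_k(1+\theta^2)\le\kappa\le C_k(1+\theta^2)$ with constants $c_k,C_k>0$, for all $\rho_i\ge0$, $\theta>0$; $b_{ij}$ and $\kappa$ are Lipschitz continuous on bounded sets of densities and temperatures. A weak solution is $U=(\rho_1,\dots,\rho_n,\theta)$ with $\rho_i,\theta,\log\theta\in L^2(0,S;H^1(\Omega))$ and $J_i,J_e\in L^2(\Omega\times(0,S))$ for all $S<T$, such that $\nabla p=0$ and the system for the $u_i$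 hold a.e., the initial conditions hold, and for every $t\in[0,T)$ one has $\rho_i(t),(\rho e)(t)\in L^2(\Omega)$ and, for every $\psi\in H^1(\Omega)$, $\int_\Omega\rho_i(t)\psi=\int_\Omega\rho_i(0)\psi+\int_0^t\!\int_\Omega J_i\cdot\nabla\psi$ and $\int_\Omega(\rho e)(t)\psi=\int_\Omega(\rho e)(0)\psi+\int_0^t\!\int_\Omega J_e\cdot\nabla\psi$. A strong solution is a weak solution for which $\partial_t\rho_i$, $\partial_t\theta$, $\partial_t(\rho e)$, $\operatorname{div}J_i$, $\operatorname{div}J_e$ belong to $L^2(\Omega\times(0,S))$ for all $S<T$ and the balance equations hold a.e. **Theorem.** Let $U=(\rho_1,\dots,\rho_n,\theta)$ be a weak solution and $\bar U=(\bar\rho_1,\dots,\bar\rho_n,\bar\theta)$ a strong solution, with diffusional velocities $u_i$ and $\bar u_i$. Assume that there are $\delta,M>0$ such that a.e. in $\Omega\times(0,T)$ $$0<\rho_i\le M,\quad 0<\theta\le M,\qquad 0\le\bar\rho_i\le M,\quad \delta\le\bar\theta\le M,$$ that $\log\bar\rho_i\in H^1_{\rm loc}(\Omega\times(0,T))$ (in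 particular $\bar\rho_i>0$ a.e.), and that $\bar u_i$ and $\nabla\log\bar\theta$ belong to $L^\infty_{\rm loc}(\overline\Omega\times[0,T))$, i.e. are essentially bounded on $\Omega\times(0,S)$ for every $S<T$. If the initial data of $U$ and $\bar U$ coincide, then for every $t\in[0,T)$ one has $U(x,t)=\bar U(x,t)$ for a.e. $x\in\Omega$. -/

import Mathlib

open Set MeasureTheory
open scoped ENNReal NNReal ContDiff

noncomputable section

namespace MaxwellStefanFourier

/-- Physical space `ℝ³`. -/
abbrev Space3 : Type := EuclideanSpace ℝ (Fin 3)

/-! ### Domains -/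

/-- `Ω` has a Lipschitz boundary: near each boundary point `Ω` is, in the direction of some unit
vector `e`, the strict epigraph of a Lipschitz function `g` of the component orthogonal to `e`. -/
def HasLipschitzBoundary (Ω : Set Space3) : Prop :=
  ∀ x ∈ frontier Ω, ∃ (e : Space3) (g : Space3 → ℝ) (K : ℝ≥0) (V : Set Space3),
    ‖e‖ = 1 ∧ LipschitzWith K g ∧ IsOpen V ∧ x ∈ V ∧
      ∀ y ∈ V, y ∈ Ω ↔ g (y - inner ℝ y e • e) < inner ℝ y e

/-- A bounded domain (open, connected, nonempty) with Lipschitz boundary. -/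
structure IsLipschitzDomain (Ω : Set Space3) : Prop where
  isOpen : IsOpen Ω
  isConnected : IsConnected Ω
  isBounded : Bornology.IsBounded Ω
  lipschitz : HasLipschitzBoundary Ω

/-- The space-time cylinder `(0,T) × Ω`; space-time points are written `(t, x)`. -/
def cyl (Ω : Set Space3) (T : ℝ) : Set (ℝ × Space3) := Ioo 0 T ×ˢ Ω

/-! ### Weak derivatives and Sobolev regularity -/

section Weak

variable {F : Type*} [NormedAddCommGroup F] [NormedSpace ℝ F] [MeasureSpace F]

/-- `g` is the weak derivative of `f` in the direction `v` on the open set `O`. -/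
def HasWeakDeriv (O : Set F) (v : F) (f g : F → ℝ) : Prop :=
  LocallyIntegrableOn f O ∧ LocallyIntegrableOn g O ∧
    ∀ φ : F → ℝ, ContDiff ℝ ∞ φ → HasCompactSupport φ → tsupport φ ⊆ O →
      ∫ z in O, f z * fderiv ℝ φ z v = - ∫ z in O, g z * φ z

/-- `f ∈ L²_loc(O)`: square integrable on every compact subset of `O`. -/
def MemL2Loc (O : Set F) (f : F → ℝ) : Prop :=
  ∀ K : Set F, IsCompact K → K ⊆ O → MemLp f 2 (volume.restrict K)

/-- `f ∈ H¹_loc(O)`. -/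
def MemH1Loc (O : Set F) (f : F → ℝ) : Prop :=
  MemL2Loc O f ∧ ∀ v : F, ∃ g : F → ℝ, MemL2Loc O g ∧ HasWeakDeriv O v f g

end Weak

/-- `G` is the weak gradient of `f` on `Ω`. -/
def HasWeakGrad (Ω : Set Space3) (f : Space3 → ℝ) (G : Space3 → Space3) : Prop :=
  ∀ v : Space3, HasWeakDeriv Ω v f (fun x => inner ℝ (G x) v)

/-- `f ∈ H¹(Ω)` with `∇f = G`. -/
def IsH1 (Ω : Set Space3) (f : Space3 → ℝ) (G : Space3 → Space3) : Prop :=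
  MemLp f 2 (volume.restrict Ω) ∧ MemLp G 2 (volume.restrict Ω) ∧ HasWeakGrad Ω f G

/-- `f ∈ L^p((0,S) × Ω)` for every `S < T`. -/
def MemLpCyl {V : Type*} [NormedAddCommGroup V] (p : ℝ≥0∞) (Ω : Set Space3) (T : ℝ)
    (f : ℝ → Space3 → V) : Prop :=
  ∀ S < T, MemLp (fun z : ℝ × Space3 => f z.1 z.2) p (volume.restrict (cyl Ω S))

/-- `G` is the weak spatial gradient `∇f` of `f` on `(0,T) × Ω`. -/
def HasSpaceGrad (Ω : Set Space3) (T : ℝ) (f : ℝ → Space3 → ℝ) (G : ℝ → Space3 → Space3) :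
    Prop :=
  ∀ᵐ t ∂(volume.restrict (Ioo 0 T)), HasWeakGrad Ω (f t) (G t)

/-- `f ∈ L²(0,S;H¹(Ω))` for every `S < T`, with spatial gradient `G`. -/
def IsL2H1 (Ω : Set Space3) (T : ℝ) (f : ℝ → Space3 → ℝ) (G : ℝ → Space3 → Space3) : Prop :=
  MemLpCyl 2 Ω T f ∧ MemLpCyl 2 Ω T G ∧ HasSpaceGrad Ω T f G

/-- `g` is the weak time derivative `∂ₜf` of `f` on `(0,T) × Ω`. -/
def HasTimeDeriv (Ω : Set Space3) (T : ℝ) (f g : ℝ → Space3 → ℝ) : Prop :=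
  HasWeakDeriv (cyl Ω T) ((1 : ℝ), (0 : Space3)) (fun z => f z.1 z.2) (fun z => g z.1 z.2)

/-- `D` is the weak spatial divergence `div J` of the field `J` on `(0,T) × Ω`. -/
def HasSpaceDiv (Ω : Set Space3) (T : ℝ) (J : ℝ → Space3 → Space3) (D : ℝ → Space3 → ℝ) :
    Prop :=
  ∀ φ : ℝ × Space3 → ℝ, ContDiff ℝ ∞ φ → HasCompactSupport φ → tsupport φ ⊆ cyl Ω T →
    ∫ z in cyl Ω T, fderiv ℝ φ z ((0 : ℝ), J z.1 z.2) = - ∫ z in cyl Ω T, D z.1 z.2 * φ z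

/-! ### Thermodynamics of a simple mixture of ideal gases

Here `m` is a molar mass, `c` the heat capacity, `r` a partial mass density and `s` the absolute
temperature. -/

/-- Partial Helmholtz free energy density `ρᵢψᵢ`. -/
def freeEnergy (m c r s : ℝ) : ℝ :=
  s * (r / m) * (Real.log (r / m) - 1) - c * r * s * (Real.log s - 1)

/-- Chemical potential `μᵢ = ∂(ρᵢψᵢ)/∂ρᵢ`. -/
def chemPot (m c r s : ℝ) : ℝ := deriv (fun r' => freeEnergy m c r' s) r

/-- Partial entropy density `ρᵢηᵢ = -∂(ρᵢψᵢ)/∂θ`. -/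
def entropy (m c r s : ℝ) : ℝ := - deriv (fun s' => freeEnergy m c r s') s

/-- Partial internal energy density `ρᵢeᵢ = ρᵢψᵢ + ρᵢηᵢθ`. -/
def internalEnergy (m c r s : ℝ) : ℝ := freeEnergy m c r s + entropy m c r s * s

/-- Partial pressure `pᵢ = -ρᵢψᵢ + ρᵢμᵢ`. -/
def pressure (m c r s : ℝ) : ℝ := - freeEnergy m c r s + r * chemPot m c r s

/-- The gradient, by the chain rule, of `f(ρᵢ,θ)` at a point where `ρᵢ = r`, `θ = s`,
`∇ρᵢ = gr` and `∇θ = gs`. -/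
def chainGrad (f : ℝ → ℝ → ℝ) (r s : ℝ) (gr gs : Space3) : Space3 :=
  deriv (fun r' => f r' s) r • gr + deriv (fun s' => f r s') s • gs

/-! ### The Maxwell-Stefan-Fourier system with zero barycentric velocity -/

/-- The parameters of the model for `n` components: molar masses `mᵢ`, heat capacity `c_w`,
interaction strength `ε`, binary interaction coefficients `bᵢⱼ(ρᵢ,ρⱼ,θ)` and thermal
conductivity `κ(ρ₁,…,ρₙ,θ)`. -/
structure Model (n : ℕ) where
  m : Fin n → ℝ
  cw : ℝ
  ε : ℝ
  b : Fin n → Fin n → ℝ → ℝ → ℝ → ℝ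
  κ : (Fin n → ℝ) → ℝ → ℝ

/-- Standing assumptions on the parameters. -/
structure Model.IsAdmissible {n : ℕ} (P : Model n) : Prop where
  m_pos : ∀ i, 0 < P.m i
  cw_pos : 0 < P.cw
  ε_pos : 0 < P.ε
  b_pos : ∀ i j, i ≠ j → ∀ r r' s, 0 ≤ r → 0 ≤ r' → 0 ≤ s → 0 < P.b i j r r' s
  b_symm : ∀ i j, i ≠ j → ∀ r r' s, P.b i j r r' s = P.b j i r' r s
  /-- Each `bᵢⱼ` is Lipschitz continuous on bounded sets of densities and temperatures. -/
  b_lipschitz : ∀ i j, i ≠ j → ∀ R : ℝ, ∃ K : ℝ≥0,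
    LipschitzOnWith K (fun z : ℝ × ℝ × ℝ => P.b i j z.1 z.2.1 z.2.2)
      (Icc 0 R ×ˢ Icc 0 R ×ˢ Icc 0 R)
  κ_growth : ∃ ck Ck : ℝ, 0 < ck ∧ 0 < Ck ∧ ∀ (r : Fin n → ℝ) (s : ℝ), (∀ i, 0 ≤ r i) → 0 < s →
    ck * (1 + s ^ 2) ≤ P.κ r s ∧ P.κ r s ≤ Ck * (1 + s ^ 2)
  /-- `κ` is Lipschitz continuous on bounded sets of densities and temperatures. -/
  κ_lipschitz : ∀ R : ℝ, ∃ K : ℝ≥0,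
    LipschitzOnWith K (fun z : (Fin n → ℝ) × ℝ => P.κ z.1 z.2)
      {z | (∀ i, z.1 i ∈ Icc 0 R) ∧ z.2 ∈ Ioc 0 R}

section System

variable {n : ℕ}

/-- Gradient of the total pressure `p = ∑ᵢ pᵢ` (pointwise in the values and gradients of the
densities and the temperature). -/
def Model.pressureGrad (P : Model n) (r : Fin n → ℝ) (s : ℝ) (gr : Fin n → Space3)
    (gs : Space3) : Space3 :=
  ∑ i, chainGrad (pressure (P.m i) P.cw) (r i) s (gr i) gs

/-- Generalized force (without body forces)
`dᵢ = -(ρᵢ/ρ)∇p + ρᵢθ∇(μᵢ/θ) - θ(ρᵢeᵢ + pᵢ)∇(1/θ)`. -/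
def Model.force (P : Model n) (r : Fin n → ℝ) (s : ℝ) (gr : Fin n → Space3) (gs : Space3)
    (i : Fin n) : Space3 :=
  - ((r i / ∑ j, r j) • P.pressureGrad r s gr gs)
    + (r i * s) • chainGrad (fun r' s' => chemPot (P.m i) P.cw r' s' / s') (r i) s (gr i) gs
    - (s * (internalEnergy (P.m i) P.cw (r i) s + pressure (P.m i) P.cw (r i) s)) •
        chainGrad (fun _ s' => 1 / s') (r i) s (gr i) gs

/-- The constrained Maxwell-Stefan system for the diffusional velocities `u`:
`-θ ∑_{j≠i} bᵢⱼ ρᵢ ρⱼ (uᵢ - uⱼ) = ε dᵢ` for all `i`, and `∑ᵢ ρᵢ uᵢ = 0`. -/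
def Model.MaxwellStefan (P : Model n) (r : Fin n → ℝ) (s : ℝ) (gr : Fin n → Space3)
    (gs : Space3) (u : Fin n → Space3) : Prop :=
  (∀ i, - (s • ∑ j ∈ Finset.univ.erase i, (P.b i j (r i) (r j) s * r i * r j) • (u i - u j))
      = P.ε • P.force r s gr gs i) ∧
  ∑ i, r i • u i = 0

/-- Total internal energy density `ρe = ∑ᵢ ρᵢeᵢ`. -/
def Model.energy (P : Model n) (r : Fin n → ℝ) (s : ℝ) : ℝ :=
  ∑ i, internalEnergy (P.m i) P.cw (r i) s

/-- Energy flux `J_e = -κ∇θ + ∑ᵢ (ρᵢeᵢ + pᵢ) uᵢ`. -/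
def Model.energyFlux (P : Model n) (r : Fin n → ℝ) (s : ℝ) (gs : Space3)
    (u : Fin n → Space3) : Space3 :=
  - (P.κ r s • gs) +
    ∑ i, (internalEnergy (P.m i) P.cw (r i) s + pressure (P.m i) P.cw (r i) s) • u i

/-- The balance law `∂ₜw + div J = 0` in `Ω × (0,T)` with `J·ν = 0` on `∂Ω`, in weak form: for
every time `t ∈ [0,T)` and every `ψ ∈ H¹(Ω)`,
`∫_Ω w(t)ψ dx = ∫_Ω w(0)ψ dx + ∫₀ᵗ ∫_Ω J·∇ψ dx ds`.
In particular `w` is the representative that is weakly continuous in time. -/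
def WeakBalance (Ω : Set Space3) (T : ℝ) (w : ℝ → Space3 → ℝ) (J : ℝ → Space3 → Space3) : Prop :=
  (∀ t ∈ Ico 0 T, MemLp (w t) 2 (volume.restrict Ω)) ∧ MemLpCyl 2 Ω T J ∧
  ∀ t ∈ Ico 0 T, ∀ (ψ : Space3 → ℝ) (G : Space3 → Space3), IsH1 Ω ψ G →
    ∫ x in Ω, w t x * ψ x =
      (∫ x in Ω, w 0 x * ψ x) + ∫ z in cyl Ω t, inner ℝ (J z.1 z.2) (G z.2)

/-- `(ρ₁,…,ρₙ,θ)`, with diffusional velocities `u` and spatial gradients `gρ = ∇ρ`, `gθ = ∇θ`,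
solves the system weakly on `[0,T)`, with no mass or heat exchange through the boundary and
initial data `(ρ0, θ0)`. -/
structure IsWeakSolutionWith (P : Model n) (Ω : Set Space3) (T : ℝ)
    (ρ0 : Fin n → Space3 → ℝ) (θ0 : Space3 → ℝ)
    (ρ : Fin n → ℝ → Space3 → ℝ) (θ : ℝ → Space3 → ℝ) (u : Fin n → ℝ → Space3 → Space3)
    (gρ : Fin n → ℝ → Space3 → Space3) (gθ : ℝ → Space3 → Space3) : Prop where
  ρ_reg : ∀ i, IsL2H1 Ω T (ρ i) (gρ i)
  θ_reg : IsL2H1 Ω T θ gθ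
  log_θ_reg : IsL2H1 Ω T (fun t x => Real.log (θ t x)) (fun t x => (θ t x)⁻¹ • gθ t x)
  /-- The diffusional velocities solve the constrained Maxwell-Stefan system. -/
  maxwell_stefan : ∀ᵐ z ∂(volume.restrict (cyl Ω T)),
    P.MaxwellStefan (fun i => ρ i z.1 z.2) (θ z.1 z.2) (fun i => gρ i z.1 z.2) (gθ z.1 z.2)
      (fun i => u i z.1 z.2)
  /-- `∂ₜρᵢ + div(ρᵢuᵢ) = 0`, `ρᵢuᵢ·ν = 0`. -/
  mass : ∀ i, WeakBalance Ω T (ρ i) (fun t x => ρ i t x • u i t x)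
  /-- `∇p = 0`. -/
  momentum : ∀ᵐ z ∂(volume.restrict (cyl Ω T)),
    P.pressureGrad (fun i => ρ i z.1 z.2) (θ z.1 z.2) (fun i => gρ i z.1 z.2) (gθ z.1 z.2) = 0
  /-- `∂ₜ(ρe) + div J_e = 0`, `J_e·ν = 0`. -/
  energy : WeakBalance Ω T (fun t x => P.energy (fun i => ρ i t x) (θ t x))
    (fun t x => P.energyFlux (fun i => ρ i t x) (θ t x) (gθ t x) (fun i => u i t x))
  initial_ρ : ∀ i, ∀ᵐ x ∂(volume.restrict Ω), ρ i 0 x = ρ0 i x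
  initial_θ : ∀ᵐ x ∂(volume.restrict Ω), θ 0 x = θ0 x

/-- Weak solution of the no-flux initial-boundary value problem. -/
def IsWeakSolution (P : Model n) (Ω : Set Space3) (T : ℝ)
    (ρ0 : Fin n → Space3 → ℝ) (θ0 : Space3 → ℝ)
    (ρ : Fin n → ℝ → Space3 → ℝ) (θ : ℝ → Space3 → ℝ)
    (u : Fin n → ℝ → Space3 → Space3) : Prop :=
  ∃ gρ gθ, IsWeakSolutionWith P Ω T ρ0 θ0 ρ θ u gρ gθ

/-- The balance law `∂ₜw + div J = 0` holds almost everywhere, with `∂ₜw` and `div J` square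
integrable on `Ω × (0,S)` for every `S < T`. -/
def StrongBalance (Ω : Set Space3) (T : ℝ) (w : ℝ → Space3 → ℝ) (J : ℝ → Space3 → Space3) :
    Prop :=
  ∃ dw D : ℝ → Space3 → ℝ, MemLpCyl 2 Ω T dw ∧ MemLpCyl 2 Ω T D ∧
    HasTimeDeriv Ω T w dw ∧ HasSpaceDiv Ω T J D ∧
    ∀ᵐ z ∂(volume.restrict (cyl Ω T)), dw z.1 z.2 + D z.1 z.2 = 0

/-- Strong solution of the no-flux initial-boundary value problem: a weak solution with square
integrable `∂ₜρᵢ`, `∂ₜθ` that satisfies the balance equations almost everywhere. -/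
def IsStrongSolution (P : Model n) (Ω : Set Space3) (T : ℝ)
    (ρ0 : Fin n → Space3 → ℝ) (θ0 : Space3 → ℝ)
    (ρ : Fin n → ℝ → Space3 → ℝ) (θ : ℝ → Space3 → ℝ)
    (u : Fin n → ℝ → Space3 → Space3) : Prop :=
  ∃ gρ gθ, IsWeakSolutionWith P Ω T ρ0 θ0 ρ θ u gρ gθ ∧
    (∀ i, StrongBalance Ω T (ρ i) (fun t x => ρ i t x • u i t x)) ∧
    StrongBalance Ω T (fun t x => P.energy (fun i => ρ i t x) (θ t x))
      (fun t x => P.energyFlux (fun i => ρ i t x) (θ t x) (gθ t x) (fun i => u i t x)) ∧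
    ∃ dθ : ℝ → Space3 → ℝ, MemLpCyl 2 Ω T dθ ∧ HasTimeDeriv Ω T θ dθ

/-- `log f ∈ H¹_loc(Ω × (0,T))` for a nonnegative function `f`; this includes that `log f` is
finite, i.e. `f > 0`, almost everywhere. -/
def LogMemH1Loc (Ω : Set Space3) (T : ℝ) (f : ℝ → Space3 → ℝ) : Prop :=
  (∀ᵐ z ∂(volume.restrict (cyl Ω T)), 0 < f z.1 z.2) ∧
    MemH1Loc (cyl Ω T) (fun z : ℝ × Space3 => Real.log (f z.1 z.2))

end System

end MaxwellStefanFourier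

end

/-! The proof is a relative entropy argument. When `∇p = 0` the force `dᵢ` is the gradient of the
partial pressure `ρᵢθ/mᵢ`. Since `∑ ρᵢuᵢ = 0`, the total density `R` does not depend on time, and
the energy is `c_w R θ`. The distance of the solutions is measured by the sum of `mᵢ⁻¹ (ρᵢ
log(ρᵢ/ρ'ᵢ) - ρᵢ + ρ'ᵢ)` over `i` and of `c_w R (θ/θ' - 1 - log(θ/θ'))`, that is, by `massEntropy`
and `heatEntropy`; for bounded states it dominates the squared distance. Its rate of change along
the balance laws is the entropy production. By `Model.StatePair.entropyProduction_zero_eq` this is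
minus a friction form in the velocity differences, minus `κ |∇log θ - ∇log θ'|²`, plus remainders at
most linear in these differences and small with the distance of the states. Completing squares
bounds it by a multiple of the squared distance
(`Model.IsAdmissible.exists_entropyProduction_zero_le`), and a Gronwall argument gives uniqueness.

Three difficulties have to be overcome. The entropy needs `ρ'ᵢ` bounded away from zero. The
Maxwell-Stefan relations with bounded velocities and bounded `∇log θ'` give `|∇ρ'ᵢ| ≤ L ρ'ᵢ`; on a
Lipschitz domain this is a Harnack inequality, and the spatial mean of `ρ'ᵢ` is conserved
(`IsWeakSolutionWith.exists_density_lower_bound`). The weak solution has no such lower bound. Its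
densities and temperature are shifted by `η > 0`; the production is then bounded above, uniformly in
`η`, by the integrable sum of squared fluxes and gradients, which permits `η → 0` by dominated
convergence. Weak solutions have no time derivative. Time differences with step `h` are used
instead: in a Taylor formula for the entropy, the quadratic remainder is a product of the increment
of a balanced quantity with that of an `H¹` function, and divided by `h` it still tends to zero, by
continuity of translations in `L²` (`WeakBalance.tendsto_increment_increment`,
`entropy_inequality`). Gronwall's lemma itself is replaced by the weights `(τ - t)^k` with `k`
large. Equality a.e. in space-time then passes to every time because balanced quantities are weakly
continuous. -/

namespace MaxwellStefanFourier

/-! ### Closed forms for ideal gases -/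

section Thermodynamics

variable {m c r s : ℝ}

lemma hasDerivAt_mul_log_sub_one (x : ℝ) (hx : x ≠ 0) :
    HasDerivAt (fun x => x * (Real.log x - 1)) (Real.log x) x := by
  have := (hasDerivAt_id x).mul ((Real.hasDerivAt_log hx).sub_const 1)
  refine this.congr_deriv ?_
  simp only [id]
  field_simp
  ring

lemma hasDerivAt_freeEnergy_temp (hs : s ≠ 0) :
    HasDerivAt (fun s' => freeEnergy m c r s')
      (r / m * (Real.log (r / m) - 1) - c * r * Real.log s) s := by
  have h1 := ((hasDerivAt_id s).mul_const (r / m * (Real.log (r / m) - 1))).sub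
    ((hasDerivAt_mul_log_sub_one s hs).const_mul (c * r))
  refine (h1.congr_deriv (by ring)).congr_of_eventuallyEq ?_
  exact Filter.Eventually.of_forall fun x => by simp [freeEnergy]; ring

lemma hasDerivAt_freeEnergy_density (hm : m ≠ 0) (hr : r ≠ 0) :
    HasDerivAt (fun r' => freeEnergy m c r' s)
      (s / m * Real.log (r / m) - c * s * (Real.log s - 1)) r := by
  have h0 := (hasDerivAt_mul_log_sub_one (r / m) (div_ne_zero hr hm)).comp r
    ((hasDerivAt_id r).div_const m)
  have h1 := (h0.const_mul s).sub ((hasDerivAt_id r).const_mul (c * s * (Real.log s - 1)))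
  refine (h1.congr_deriv (by ring)).congr_of_eventuallyEq ?_
  exact Filter.Eventually.of_forall fun x => by simp [freeEnergy]; ring

lemma chemPot_of_ne (hm : m ≠ 0) (hr : r ≠ 0) :
    chemPot m c r s = s / m * Real.log (r / m) - c * s * (Real.log s - 1) :=
  (hasDerivAt_freeEnergy_density hm hr).deriv

/-- The logarithms cancel. At `s = 0` the default value of the derivative is multiplied by `s`, so
no sign condition is needed; the same happens for the pressure at `r = 0`. -/
lemma internalEnergy_eq (m c r s : ℝ) : internalEnergy m c r s = c * r * s := by
  rcases eq_or_ne s 0 with rfl | hs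
  · simp [internalEnergy, freeEnergy]
  · rw [internalEnergy, entropy, (hasDerivAt_freeEnergy_temp hs).deriv, freeEnergy]
    ring

lemma pressure_eq (hm : m ≠ 0) (c r s : ℝ) : pressure m c r s = r * s / m := by
  rcases eq_or_ne r 0 with rfl | hr
  · simp [pressure, freeEnergy]
  · rw [pressure, chemPot_of_ne hm hr, freeEnergy]
    field_simp
    ring

lemma chainGrad_chemPot_div (hm : m ≠ 0) (hr : 0 < r) (hs : 0 < s) (gr gs : Space3) :
    chainGrad (fun r' s' => chemPot m c r' s' / s') r s gr gs
      = (1 / (m * r)) • gr - (c / s) • gs := by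
  have h1 : HasDerivAt (fun r' => chemPot m c r' s / s) (1 / (m * r)) r := by
    have h0 := (((Real.hasDerivAt_log (div_ne_zero hr.ne' hm)).comp r
      ((hasDerivAt_id r).div_const m)).const_mul (1 / m)).sub_const (c * (Real.log s - 1))
    refine (h0.congr_deriv ?_).congr_of_eventuallyEq ?_
    · field_simp
    · filter_upwards [lt_mem_nhds hr] with x hx
      rw [chemPot_of_ne hm hx.ne']
      simp only [Function.comp, id]
      field_simp
  have h2 : HasDerivAt (fun s' => chemPot m c r s' / s') (- (c / s)) s := by
    have h0 := (((Real.hasDerivAt_log hs.ne').sub_const 1).const_mul c).const_sub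
      (1 / m * Real.log (r / m))
    refine (h0.congr_deriv ?_).congr_of_eventuallyEq ?_
    · field_simp
    · filter_upwards [lt_mem_nhds hs] with x hx
      rw [chemPot_of_ne hm hr.ne']
      field_simp
  rw [chainGrad, h1.deriv, h2.deriv, neg_smul, sub_eq_add_neg]

lemma chainGrad_one_div (r s : ℝ) (gr gs : Space3) :
    chainGrad (fun _ s' => 1 / s') r s gr gs = -((s ^ 2)⁻¹ • gs) := by
  simp [chainGrad]

end Thermodynamics

/-! ### Forces and fluxes of the mixture -/

section Mixture

variable {n : ℕ} {P : Model n} {r : Fin n → ℝ} {s : ℝ} {gr : Fin n → Space3} {gs : Space3}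
  {u : Fin n → Space3}

lemma Model.energy_eq (P : Model n) (r : Fin n → ℝ) (s : ℝ) :
    P.energy r s = P.cw * (∑ i, r i) * s := by
  simp only [Model.energy, internalEnergy_eq, Finset.mul_sum, Finset.sum_mul]

/-- The heat capacity enters through `∇(μᵢ/θ)` and through `ρᵢeᵢ∇(1/θ)`, and the two contributions
cancel. What remains is the gradient of the partial pressure `ρᵢθ/mᵢ`. -/
lemma Model.force_eq (hP : P.IsAdmissible) (hr : ∀ i, 0 < r i) (hs : 0 < s)
    (hp : P.pressureGrad r s gr gs = 0) (i : Fin n) :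
    P.force r s gr gs i = (s / P.m i) • gr i + (r i / P.m i) • gs := by
  have hm := (hP.m_pos i).ne'
  have hri := (hr i).ne'
  rw [Model.force, hp, chainGrad_chemPot_div hm (hr i) hs, chainGrad_one_div,
    internalEnergy_eq, pressure_eq hm]
  rw [smul_zero, neg_zero, zero_add, smul_sub, smul_neg, sub_neg_eq_add, smul_smul, smul_smul,
    smul_smul, sub_add_eq_add_sub, add_sub_assoc, ← sub_smul]
  congr 2
  · field_simp
  · field_simp; ring

/-- The Maxwell-Stefan relations in terms of the logarithmic gradients. -/
lemma Model.MaxwellStefan.grad_eq (hP : P.IsAdmissible) (hr : ∀ i, 0 < r i) (hs : 0 < s)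
    (hp : P.pressureGrad r s gr gs = 0) (h : P.MaxwellStefan r s gr gs u) (i : Fin n) :
    (P.m i)⁻¹ • gr i = - ((r i / P.m i) • s⁻¹ • gs)
      - P.ε⁻¹ • ∑ j ∈ Finset.univ.erase i, (P.b i j (r i) (r j) s * r i * r j) • (u i - u j) := by
  have h1 := h.1 i
  have hε := hP.ε_pos.ne'
  have hs' := hs.ne'
  rw [Model.force_eq hP hr hs hp] at h1
  set W := ∑ j ∈ Finset.univ.erase i, (P.b i j (r i) (r j) s * r i * r j) • (u i - u j)
  have h2 : W = -((P.ε / s) • ((s / P.m i) • gr i + (r i / P.m i) • gs)) := by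
    have : (s⁻¹ : ℝ) • -(s • W) = s⁻¹ • (P.ε • ((s / P.m i) • gr i + (r i / P.m i) • gs)) := by
      rw [h1]
    rw [smul_neg, smul_smul, inv_mul_cancel₀ hs', one_smul, smul_smul] at this
    rw [neg_eq_iff_eq_neg.mp this]
    congr 2
    ring
  rw [h2, smul_neg, sub_neg_eq_add, smul_smul, smul_add, smul_smul, smul_smul, smul_add, smul_smul,
    smul_smul]
  have e1 : P.ε⁻¹ * (P.ε / s * (s / P.m i)) = (P.m i)⁻¹ := by field_simp
  have e2 : P.ε⁻¹ * (P.ε / s * (r i / P.m i)) = r i / P.m i * s⁻¹ := by field_simp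
  rw [e1, e2]
  abel

/-- The internal energies contribute a multiple of `∑ ρᵢuᵢ = 0`, so only heat conduction and the
partial pressures transport energy. -/
lemma Model.energyFlux_eq (hP : P.IsAdmissible) (hu : ∑ i, r i • u i = 0) :
    P.energyFlux r s gs u = - (P.κ r s • gs) + s • ∑ i, (P.m i)⁻¹ • r i • u i := by
  have h : ∀ i, (internalEnergy (P.m i) P.cw (r i) s + pressure (P.m i) P.cw (r i) s) • u i
      = (P.cw * s) • r i • u i + s • (P.m i)⁻¹ • r i • u i := by
    intro i
    rw [internalEnergy_eq, pressure_eq (hP.m_pos i).ne', smul_smul, smul_smul, smul_smul,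
      ← add_smul]
    congr 1
    ring
  rw [Model.energyFlux, Finset.sum_congr rfl fun i _ => h i, Finset.sum_add_distrib,
    ← Finset.smul_sum, hu, smul_zero, zero_add, ← Finset.smul_sum]

end Mixture

/-! ### Translations and segment averages in `L²` -/

section Translation

open Filter Topology intervalIntegral

variable {F V : Type*} [NormedAddCommGroup F] [NormedSpace ℝ F] [MeasurableSpace F] [BorelSpace F]
  [FiniteDimensional ℝ F] {μ : Measure F} [μ.IsAddHaarMeasure]
  [NormedAddCommGroup V]

/-- Translation of an `L²` function: `(translate v f)(x) = f (v + x)`. -/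
noncomputable def translate (v : F) (f : Lp V 2 μ) : Lp V 2 μ := DomAddAct.mk v +ᵥ f

lemma translate_ae_eq (v : F) (f : Lp V 2 μ) : translate v f =ᵐ[μ] fun x => f (v + x) :=
  DomAddAct.vadd_Lp_ae_eq _ _

lemma translate_toLp (v : F) {f : F → V} (hf : MemLp f 2 μ) :
    translate v (hf.toLp f) =ᵐ[μ] fun x => f (v + x) := by
  refine (translate_ae_eq v _).trans ?_
  exact (measurePreserving_add_left μ v).quasiMeasurePreserving.ae_eq_comp hf.coeFn_toLp

lemma translate_zero (f : Lp V 2 μ) : translate (0 : F) f = f := by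
  refine Lp.ext ((translate_ae_eq 0 f).trans ?_)
  simp

lemma continuous_translate_smul (v : F) (f : Lp V 2 μ) :
    Continuous fun σ : ℝ => translate (σ • v) f := by
  have : Fact ((2 : ℝ≥0∞) ≠ ⊤) := ⟨ENNReal.ofNat_ne_top⟩
  have : Continuous fun w : F => DomAddAct.mk w +ᵥ f :=
    (DomAddAct.continuous_mk).vadd continuous_const
  exact this.comp (continuous_id.smul continuous_const)

variable [InnerProductSpace ℝ V]

/-- Average of the translates of an `L²` function over the segment `[0, h • v]`. -/
noncomputable def segmentAverage [CompleteSpace V] (v : F) (f : Lp V 2 μ) (h : ℝ) : Lp V 2 μ :=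
  h⁻¹ • ∫ σ in (0 : ℝ)..h, translate (σ • v) f

variable [CompleteSpace V]

/-- Translations act continuously on `L²`, so the average is the difference quotient at `0` of the
primitive of a continuous curve. The strong convergence obtained here replaces all mollification
arguments below. -/
lemma tendsto_segmentAverage (v : F) (f : Lp V 2 μ) :
    Tendsto (segmentAverage v f) (𝓝[>] 0) (𝓝 f) := by
  have hc := continuous_translate_smul v f
  have h1 : HasDerivAt (fun h : ℝ => ∫ σ in (0 : ℝ)..h, translate (σ • v) f)
      (translate ((0 : ℝ) • v) f) 0 :=
    integral_hasDerivAt_right (hc.intervalIntegrable 0 0)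
      (hc.stronglyMeasurableAtFilter _ _) hc.continuousAt
  rw [zero_smul, translate_zero] at h1
  have h2 := h1.tendsto_slope_zero_right
  refine h2.congr fun h => ?_
  simp [segmentAverage]

lemma inner_segmentAverage (v : F) (f g : Lp V 2 μ) (h : ℝ) :
    inner ℝ (segmentAverage v f h) g
      = h⁻¹ * ∫ σ in (0 : ℝ)..h, inner ℝ (translate (σ • v) f) g := by
  have hc := continuous_translate_smul v f
  rw [segmentAverage, real_inner_smul_left]
  congr 1
  have := (innerSL ℝ g).intervalIntegral_comp_comm (hc.intervalIntegrable 0 h (μ := volume))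
  simp only [innerSL_apply_apply] at this
  rw [real_inner_comm, ← this]
  simp only [real_inner_comm]

end Translation

/-! ### Weak derivatives along segments and the chain rule -/

section WeakCalculus

open Filter Topology

lemma tsupport_translate (φ : Space3 → ℝ) (w : Space3) :
    tsupport (fun x => φ (x - w)) = (fun x => x - w) ⁻¹' tsupport φ :=
  (tsupport_comp_eq_preimage φ (Homeomorph.subRight w) :)

lemma hasCompactSupport_translate {φ : Space3 → ℝ} (hφ : HasCompactSupport φ) (w : Space3) :
    HasCompactSupport fun x => φ (x - w) :=
  hφ.comp_homeomorph (Homeomorph.subRight w)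

/-- The integral is a convolution of `f` with the reflected test function, so the derivative falls
on the smooth factor. -/
lemma hasDerivAt_integral_mul_translate {f φ : Space3 → ℝ} (hf : LocallyIntegrable f)
    (hφ : ContDiff ℝ ∞ φ) (hc : HasCompactSupport φ) (v : Space3) (σ : ℝ) :
    HasDerivAt (fun σ : ℝ => ∫ x, f x * φ (x - σ • v))
      (-∫ x, f x * fderiv ℝ φ (x - σ • v) v) σ := by
  set φ' : Space3 → ℝ := fun x => φ (-x)
  have hφ' : ContDiff ℝ 1 φ' := (hφ.comp contDiff_neg).of_le (by norm_cast)
  have hc' : HasCompactSupport φ' := hc.comp_homeomorph (Homeomorph.neg Space3)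
  have key := hc'.hasFDerivAt_convolution_right (ContinuousLinearMap.mul ℝ ℝ) hf hφ' (σ • v)
    (μ := volume)
  have hσ : HasDerivAt (fun σ : ℝ => σ • v) v σ := by
    simpa using (hasDerivAt_id σ).smul_const v
  have h2 := key.comp_hasDerivAt σ hσ
  have hfd : ∀ y, fderiv ℝ φ' y v = - fderiv ℝ φ (-y) v := by
    intro y
    have : HasFDerivAt φ' ((fderiv ℝ φ (-y)).comp (-ContinuousLinearMap.id ℝ Space3)) y :=
      ((hφ.differentiable (by simp)).differentiableAt.hasFDerivAt).comp y (hasFDerivAt_id y).neg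
    rw [this.fderiv]
    simp
  have e1 : (fun σ : ℝ => ∫ x, f x * φ (x - σ • v))
      = convolution f φ' (ContinuousLinearMap.mul ℝ ℝ) volume ∘ fun σ : ℝ => σ • v := by
    funext s
    simp [convolution, φ']
  rw [e1]
  refine h2.congr_deriv ?_
  have hex := (hc'.fderiv ℝ).convolutionExists_right
    ((ContinuousLinearMap.mul ℝ ℝ).precompR Space3) hf (hφ'.continuous_fderiv (by simp)) (σ • v)
    (μ := volume)
  unfold convolution
  rw [ContinuousLinearMap.integral_apply hex]
  rw [← integral_neg]
  congr 1
  funext x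
  have : ((ContinuousLinearMap.precompR Space3 (ContinuousLinearMap.mul ℝ ℝ)) (f x)
      (fderiv ℝ φ' (σ • v - x))) v = f x * fderiv ℝ φ' (σ • v - x) v := rfl
  rw [this, hfd]
  simp

variable {Ω : Set Space3} {f g : Space3 → ℝ} {v : Space3}

lemma integral_mul_translate (f φ : Space3 → ℝ) (w : Space3) :
    ∫ x, f (w + x) * φ x = ∫ x, f x * φ (x - w) := by
  rw [← integral_sub_right_eq_self (fun x => f (w + x) * φ x) w]
  simp

lemma memLp_indicator (hΩ : MeasurableSet Ω) (hf : MemLp f 2 (volume.restrict Ω)) :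
    MemLp (Ω.indicator f) 2 volume := (memLp_indicator_iff_restrict hΩ).2 hf

lemma memLp_of_contDiff {φ : Space3 → ℝ} (hφ : ContDiff ℝ ∞ φ) (hc : HasCompactSupport φ) :
    MemLp φ 2 (volume : Measure Space3) := hφ.continuous.memLp_of_hasCompactSupport hc

/-- Weak form of the fundamental theorem of calculus along segments. -/
lemma HasWeakDeriv.integral_sub_translate (hΩ : MeasurableSet Ω)
    (hf : MemLp f 2 (volume.restrict Ω)) (hg : MemLp g 2 (volume.restrict Ω))
    (h : HasWeakDeriv Ω v f g) {φ : Space3 → ℝ} (hφ : ContDiff ℝ ∞ φ) (hc : HasCompactSupport φ)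
    {s : ℝ} (hs : 0 ≤ s) (hsupp : ∀ x ∈ tsupport φ, ∀ σ ∈ Icc 0 s, x + σ • v ∈ Ω) :
    ∫ x, (Ω.indicator f (s • v + x) - Ω.indicator f x) * φ x
      = s * ∫ x, segmentAverage v ((memLp_indicator hΩ hg).toLp _) s x * φ x := by
  have hF := memLp_indicator hΩ hf
  have hG := memLp_indicator hΩ hg
  have hφL := memLp_of_contDiff hφ hc
  set gL := hG.toLp _
  set φL := hφL.toLp _
  -- Moving the test function along `v` differentiates the pairing with `f`. The moved test function
  -- stays supported in `Ω`, so the definition of the weak derivative turns the result into a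
  -- pairing with a translate of `g`.
  have hder : ∀ σ ∈ uIcc 0 s, HasDerivAt (fun σ : ℝ => ∫ x, Ω.indicator f x * φ (x - σ • v))
      (inner ℝ (translate (σ • v) gL) φL) σ := by
    intro σ hσ
    rw [uIcc_of_le hs] at hσ
    refine (hasDerivAt_integral_mul_translate (hF.locallyIntegrable (by norm_num)) hφ hc v
      σ).congr_deriv ?_
    have hsm : ContDiff ℝ ∞ fun x => φ (x - σ • v) := hφ.comp (contDiff_id.sub contDiff_const)
    have hsub : tsupport (fun x => φ (x - σ • v)) ⊆ Ω := by
      rw [tsupport_translate]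
      intro x hx
      have := hsupp _ hx σ hσ
      simpa using this
    have h1 := h.2.2 (fun x => φ (x - σ • v)) hsm (hasCompactSupport_translate hc _) hsub
    have hfd : ∀ x, fderiv ℝ (fun x => φ (x - σ • v)) x v = fderiv ℝ φ (x - σ • v) v := by
      intro x
      rw [fderiv_comp_sub]
    simp only [hfd] at h1
    have e1 : ∀ u w : Space3 → ℝ, ∫ x, Ω.indicator u x * w x = ∫ x in Ω, u x * w x := by
      intro u w
      rw [← integral_indicator hΩ]
      congr 1
      funext x
      by_cases hx : x ∈ Ω <;> simp [hx]
    rw [e1, h1, neg_neg, ← e1, ← integral_mul_translate, L2.inner_def]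
    refine integral_congr_ae ?_
    filter_upwards [translate_toLp (σ • v) hG, hφL.coeFn_toLp] with x hx hx'
    rw [hx, hx']
    simp [mul_comm]
  have hcont : Continuous fun σ : ℝ => inner ℝ (translate (σ • v) gL) φL :=
    (continuous_translate_smul v gL).inner continuous_const
  have hftc := intervalIntegral.integral_eq_sub_of_hasDerivAt hder (hcont.intervalIntegrable 0 s)
  have hI1 : Integrable fun x => Ω.indicator f (s • v + x) * φ x :=
    (hF.comp_measurePreserving (measurePreserving_add_left volume (s • v))).integrable_mul hφL
  have hI2 : Integrable fun x => Ω.indicator f x * φ x := hF.integrable_mul hφL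
  have e2 : ∫ x, (Ω.indicator f (s • v + x) - Ω.indicator f x) * φ x
      = (∫ x, Ω.indicator f x * φ (x - s • v)) - ∫ x, Ω.indicator f x * φ (x - (0 : ℝ) • v) := by
    simp only [sub_mul, zero_smul, sub_zero]
    rw [integral_sub hI1 hI2, integral_mul_translate]
  rw [e2, ← hftc]
  have e3 : ∫ x, segmentAverage v gL s x * φ x = inner ℝ (segmentAverage v gL s) φL := by
    rw [L2.inner_def]
    refine integral_congr_ae ?_
    filter_upwards [hφL.coeFn_toLp] with x hx'
    rw [hx']
    simp [mul_comm]
  rw [e3, inner_segmentAverage]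
  rcases eq_or_ne s 0 with rfl | h0
  · simp
  · rw [mul_inv_cancel_left₀ h0]

lemma HasWeakDeriv.ae_sub_translate (hΩ : MeasurableSet Ω)
    (hf : MemLp f 2 (volume.restrict Ω)) (hg : MemLp g 2 (volume.restrict Ω))
    (h : HasWeakDeriv Ω v f g) {s : ℝ} (hs : 0 ≤ s) {U : Set Space3} (hU : IsOpen U)
    (hUΩ : ∀ x ∈ U, ∀ σ ∈ Icc 0 s, x + σ • v ∈ Ω) :
    ∀ᵐ x, x ∈ U → Ω.indicator f (s • v + x) - Ω.indicator f x
      = s * segmentAverage v ((memLp_indicator hΩ hg).toLp _) s x := by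
  have hF := memLp_indicator hΩ hf
  have hF' := hF.comp_measurePreserving (measurePreserving_add_left volume (s • v))
  set A := segmentAverage v ((memLp_indicator hΩ hg).toLp _) s
  have hA : MemLp A 2 volume := Lp.memLp A
  have hD : MemLp (fun x => Ω.indicator f (s • v + x) - Ω.indicator f x - s * A x) 2 volume :=
    (hF'.sub hF).sub (hA.const_mul s)
  have key := hU.ae_eq_zero_of_integral_contDiff_smul_eq_zero (μ := volume)
    ((hD.locallyIntegrable (by norm_num)).locallyIntegrableOn U) ?_
  · filter_upwards [key] with x hx hxU
    linarith [hx hxU]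
  · intro φ hφ hc hsupp
    have h1 := h.integral_sub_translate hΩ hf hg hφ hc hs fun x hx σ hσ => hUΩ x (hsupp hx) σ hσ
    have hφL := memLp_of_contDiff hφ hc
    have e : ∀ x, φ x • (Ω.indicator f (s • v + x) - Ω.indicator f x - s * A x)
        = (Ω.indicator f (s • v + x) - Ω.indicator f x) * φ x - s * (A x * φ x) := by
      intro x; simp; ring
    simp only [e]
    have i1 : Integrable fun x => (Ω.indicator f (s • v + x) - Ω.indicator f x) * φ x :=
      (hF'.sub hF).integrable_mul hφL
    have i2 : Integrable fun x => s * (A x * φ x) := (hA.integrable_mul hφL).const_mul s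
    rw [integral_sub i1 i2, integral_const_mul, h1, sub_self]

/-- The average is an integral with values in `L²` and has no pointwise formula. The bound is
therefore tested against indicators of sets of finite measure, where the inner product commutes with
the integral. -/
lemma abs_segmentAverage_le (hΩ : MeasurableSet Ω) (hg : MemLp g 2 (volume.restrict Ω)) {L : ℝ}
    (hL : 0 ≤ L) (hgL : ∀ᵐ x ∂(volume.restrict Ω), |g x| ≤ L) {s : ℝ} (hs : 0 < s) :
    ∀ᵐ x, |segmentAverage v ((memLp_indicator hΩ hg).toLp _) s x| ≤ L := by
  have hG := memLp_indicator hΩ hg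
  have hb : ∀ᵐ x, |Ω.indicator g x| ≤ L := by
    rw [ae_restrict_iff' hΩ] at hgL
    filter_upwards [hgL] with x hx
    by_cases h : x ∈ Ω
    · simpa [h] using hx h
    · simpa [h] using hL
  set gL := hG.toLp _
  set A := segmentAverage v gL s
  have hT : ∀ w, ∀ᵐ x, |translate w gL x| ≤ L := by
    intro w
    filter_upwards [translate_toLp w hG,
      (measurePreserving_add_left volume w).quasiMeasurePreserving.ae hb] with x h1 h2
    rwa [h1]
  have hA : MemLp A 2 volume := Lp.memLp A
  have hset : ∀ S, MeasurableSet S → volume S < ⊤ → |∫ x in S, A x| ≤ ∫ x in S, L := by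
    intro S hS hS'
    have e1 : ∀ B : Lp ℝ 2 (volume : Measure Space3),
        inner ℝ B (indicatorConstLp 2 hS hS'.ne (1 : ℝ)) = ∫ x in S, B x := by
      intro B
      rw [real_inner_comm, L2.inner_indicatorConstLp_one]
    rw [← e1, inner_segmentAverage, abs_mul, abs_of_pos (inv_pos.2 hs)]
    have : ‖∫ σ in (0 : ℝ)..s, inner ℝ (translate (σ • v) gL) (indicatorConstLp 2 hS hS'.ne (1 : ℝ))‖
        ≤ (∫ x in S, L) * |s - 0| := by
      refine intervalIntegral.norm_integral_le_of_norm_le_const fun σ _ => ?_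
      rw [e1]
      refine norm_integral_le_of_norm_le (integrableOn_const hS'.ne) ?_
      exact ae_restrict_of_ae (hT _)
    rw [sub_zero, abs_of_pos hs, Real.norm_eq_abs] at this
    calc s⁻¹ * _ ≤ s⁻¹ * ((∫ x in S, L) * s) := by gcongr
      _ = _ := by field_simp
  have hint : ∀ S, MeasurableSet S → volume S < ⊤ → IntegrableOn A S := by
    intro S hS hS'
    have : IsFiniteMeasure (volume.restrict S) := ⟨by simpa using hS'⟩
    exact (hA.restrict S).integrable (by norm_num)
  have hLi : ∀ S : Set Space3, volume S < ⊤ → Integrable (fun _ => L) (volume.restrict S) :=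
    fun S hS' => integrableOn_const hS'.ne
  have h1 : 0 ≤ᵐ[volume] fun x => L - A x := by
    refine ae_nonneg_of_forall_setIntegral_nonneg_of_sigmaFinite
      (fun S hS hS' => (hLi S hS').sub (hint S hS hS')) fun S hS hS' => ?_
    rw [integral_sub (hLi S hS') (hint S hS hS')]
    linarith [(abs_le.1 (hset S hS hS')).2]
  have h2 : 0 ≤ᵐ[volume] fun x => L + A x := by
    refine ae_nonneg_of_forall_setIntegral_nonneg_of_sigmaFinite
      (fun S hS hS' => (hLi S hS').add (hint S hS hS')) fun S hS hS' => ?_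
    rw [integral_add (hLi S hS') (hint S hS hS')]
    linarith [(abs_le.1 (hset S hS hS')).1]
  filter_upwards [h1, h2] with x hx hx'
  simp only [Pi.zero_apply] at hx hx'
  exact abs_le.2 ⟨by linarith, by linarith⟩

/-- A function with bounded weak derivative is Lipschitz along segments. -/
lemma HasWeakDeriv.ae_abs_sub_le (hΩ : MeasurableSet Ω)
    (hf : MemLp f 2 (volume.restrict Ω)) (hg : MemLp g 2 (volume.restrict Ω))
    (h : HasWeakDeriv Ω v f g) {L : ℝ} (hL : 0 ≤ L)
    (hgL : ∀ᵐ x ∂(volume.restrict Ω), |g x| ≤ L) {U : Set Space3} (hU : IsOpen U)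
    (hUΩ : ∀ x ∈ U, ∀ σ ∈ Icc (0 : ℝ) 1, x + σ • v ∈ Ω) :
    ∀ᵐ x, x ∈ U → |f (x + v) - f x| ≤ L := by
  filter_upwards [h.ae_sub_translate hΩ hf hg zero_le_one hU hUΩ,
    abs_segmentAverage_le (v := v) hΩ hg hL hgL one_pos] with x h1 h2 hx
  have h3 := h1 hx
  have hx1 := hUΩ x hx 1 (by simp)
  have hx0 := hUΩ x hx 0 (by simp)
  rw [one_smul] at hx1 h3
  simp only [zero_smul, add_zero] at hx0
  rw [add_comm] at hx1
  rw [indicator_of_mem hx1, indicator_of_mem hx0, one_mul, add_comm v x] at h3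
  rwa [h3]

lemma locallyIntegrableOn_of_memLp (hf : MemLp f 2 (volume.restrict Ω)) :
    LocallyIntegrableOn f Ω :=
  locallyIntegrableOn_of_locallyIntegrable_restrict (hf.locallyIntegrable (by norm_num))

/-- Chain rule for weak derivatives. -/
lemma HasWeakDeriv.comp (hΩ : IsOpen Ω)
    (hf : MemLp f 2 (volume.restrict Ω)) (hg : MemLp g 2 (volume.restrict Ω))
    (h : HasWeakDeriv Ω v f g) {A : Set ℝ} (hA : ∀ᵐ x ∂(volume.restrict Ω), f x ∈ A)
    {Φ Φ' : ℝ → ℝ} {C B : ℝ}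
    (hΦ : ∀ a ∈ A, ∀ b ∈ A, |Φ b - Φ a - Φ' a * (b - a)| ≤ C * (b - a) ^ 2)
    (hB : ∀ a ∈ A, |Φ' a| ≤ B) (hmΦ' : Measurable Φ')
    (hΦf : MemLp (fun x => Φ (f x)) 2 (volume.restrict Ω)) :
    HasWeakDeriv Ω v (fun x => Φ (f x)) (fun x => Φ' (f x) * g x) := by
  have hm := hΩ.measurableSet
  have hΦ'g : MemLp (fun x => Φ' (f x) * g x) 2 (volume.restrict Ω) := by
    refine MemLp.of_le_mul (c := B) hg
      ((hmΦ'.comp_aemeasurable hf.1.aemeasurable).aestronglyMeasurable.mul hg.1) ?_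
    filter_upwards [hA] with x hx
    rw [norm_mul]
    gcongr
    exact hB _ hx
  refine ⟨locallyIntegrableOn_of_memLp hΦf, locallyIntegrableOn_of_memLp hΦ'g, ?_⟩
  intro φ hφ hc hsupp
  have hK : IsCompact (tsupport φ) := hc
  obtain ⟨δ, hδ, hδΩ⟩ := hK.exists_cthickening_subset_open hΩ hsupp
  -- Half of the margin is spent on the neighbourhood `U` of the support, the other half on segments
  -- of length at most `s‖v‖`, so these stay in `Ω`.
  set U := Metric.thickening (δ / 2) (tsupport φ)
  have hUo : IsOpen U := Metric.isOpen_thickening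
  have hφU : ∀ x, x ∉ U → φ x = 0 := fun x hx =>
    image_eq_zero_of_notMem_tsupport fun hx' =>
      hx (Metric.self_subset_thickening (by positivity) _ hx')
  have hev : ∀ᶠ s : ℝ in 𝓝[>] 0, ∀ x ∈ U, ∀ σ ∈ Icc 0 s, x + σ • v ∈ Ω := by
    have h0 : Tendsto (fun s : ℝ => s * ‖v‖) (𝓝[>] 0) (𝓝 0) := by
      have : Continuous fun s : ℝ => s * ‖v‖ := by fun_prop
      simpa using (this.tendsto 0).mono_left nhdsWithin_le_nhds
    filter_upwards [h0.eventually (gt_mem_nhds (half_pos hδ))] with s hs x hx σ hσ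
    refine hδΩ (Metric.thickening_subset_cthickening _ _ ?_)
    rw [Metric.mem_thickening_iff] at hx ⊢
    obtain ⟨z, hz, hxz⟩ := hx
    refine ⟨z, hz, ?_⟩
    calc dist (x + σ • v) z ≤ dist (x + σ • v) x + dist x z := dist_triangle _ _ _
      _ = σ * ‖v‖ + dist x z := by
        rw [dist_eq_norm, add_sub_cancel_left, norm_smul, Real.norm_eq_abs, abs_of_nonneg hσ.1]
      _ ≤ s * ‖v‖ + dist x z := by gcongr; exact hσ.2
      _ < δ / 2 + δ / 2 := by gcongr
      _ = δ := by ring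
  have hG := memLp_indicator hm hg
  set gL := hG.toLp _
  have hΨ := memLp_indicator hm hΦf
  set Ψ := Ω.indicator fun x => Φ (f x)
  have hφL := memLp_of_contDiff hφ hc
  obtain ⟨Mφ, hMφ⟩ := hc.exists_bound_of_continuous hφ.continuous
  have hMφ0 : 0 ≤ Mφ := (norm_nonneg _).trans (hMφ 0)
  -- the test weight
  have hmw : MemLp (Ω.indicator fun x => Φ' (f x) * φ x) 2 volume := by
    refine memLp_indicator hm (MemLp.of_le_mul (c := B) (hφL.restrict Ω)
      ((hmΦ'.comp_aemeasurable hf.1.aemeasurable).aestronglyMeasurable.mul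
        hφL.1.restrict) ?_)
    filter_upwards [hA] with x hx
    rw [norm_mul]
    gcongr
    exact hB _ hx
  set wL := hmw.toLp _
  -- On `U` the increment of `f` is exactly `s` times the segment average `S` of `g`. The Taylor
  -- hypothesis thus compares the difference quotient of `Φ ∘ f` with `Φ'(f) S`, up to `|C| s S²`.
  -- Since `S` converges in `L²`, the error is of order `s` and the two limits agree.
  have lim1 : Tendsto (fun s : ℝ => s⁻¹ * ∫ x, (Ψ (s • v + x) - Ψ x) * φ x) (𝓝[>] 0)
      (𝓝 (-∫ x, Ψ x * fderiv ℝ φ x v)) := by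
    have h1 := (hasDerivAt_integral_mul_translate (hΨ.locallyIntegrable (by norm_num)) hφ hc v
      0).tendsto_slope_zero_right
    simp only [zero_smul, sub_zero, zero_add, smul_eq_mul] at h1
    refine h1.congr fun s => ?_
    have hI1 : Integrable fun x => Ψ (s • v + x) * φ x :=
      (hΨ.comp_measurePreserving (measurePreserving_add_left volume (s • v))).integrable_mul hφL
    have hI2 : Integrable fun x => Ψ x * φ x := hΨ.integrable_mul hφL
    simp only [sub_mul]
    rw [integral_sub hI1 hI2, integral_mul_translate]
  have lim2 : Tendsto (fun s => inner ℝ (segmentAverage v gL s) wL) (𝓝[>] 0)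
      (𝓝 (inner ℝ gL wL)) := (tendsto_segmentAverage v gL).inner tendsto_const_nhds
  have lim3 : Tendsto (fun s => |C| * Mφ * (s * ‖segmentAverage v gL s‖ ^ 2)) (𝓝[>] 0) (𝓝 0) := by
    have : Tendsto (fun s : ℝ => s) (𝓝[>] 0) (𝓝 0) := tendsto_nhdsWithin_of_tendsto_nhds tendsto_id
    have h2 := ((this.mul ((tendsto_segmentAverage v gL).norm.pow 2)).const_mul (|C| * Mφ))
    simpa using h2
  have lim4 : Tendsto (fun s : ℝ => s⁻¹ * (∫ x, (Ψ (s • v + x) - Ψ x) * φ x)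
      - inner ℝ (segmentAverage v gL s) wL) (𝓝[>] 0) (𝓝 0) := by
    refine squeeze_zero_norm' ?_ lim3
    filter_upwards [hev, self_mem_nhdsWithin] with s hs (hs0 : 0 < s)
    set S := segmentAverage v gL s
    have hSm : MemLp S 2 volume := Lp.memLp S
    have e1 : inner ℝ S wL = ∫ x, S x * (Ω.indicator (fun x => Φ' (f x) * φ x) x) := by
      rw [L2.inner_def]
      refine integral_congr_ae ?_
      filter_upwards [hmw.coeFn_toLp] with x hx
      rw [hx]
      simp [mul_comm]
    have hI1 : Integrable fun x => (Ψ (s • v + x) - Ψ x) * φ x :=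
      ((hΨ.comp_measurePreserving (measurePreserving_add_left volume (s • v))).sub
        hΨ).integrable_mul hφL
    have hI2 : Integrable fun x => S x * (Ω.indicator (fun x => Φ' (f x) * φ x) x) :=
      hSm.integrable_mul hmw
    rw [e1, ← integral_const_mul, ← integral_sub (hI1.const_mul _) hI2]
    have e2 : ‖S‖ ^ 2 = ∫ x, S x ^ 2 := by
      rw [← real_inner_self_eq_norm_sq, L2.inner_def]
      simp [pow_two]
    rw [e2, ← integral_const_mul, ← integral_const_mul]
    refine norm_integral_le_of_norm_le ((hSm.integrable_sq.const_mul _).const_mul _) ?_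
    have hA' := (ae_restrict_iff' hm).1 hA
    filter_upwards [h.ae_sub_translate hm hf hg hs0.le hUo hs, hA',
      (measurePreserving_add_left volume (s • v)).quasiMeasurePreserving.ae hA'] with x h1 h2 h3
    by_cases hx : x ∈ U
    · have hx0 : x ∈ Ω := by simpa using hs x hx 0 ⟨le_rfl, hs0.le⟩
      have hxs : s • v + x ∈ Ω := by
        rw [add_comm]; exact hs x hx s ⟨hs0.le, le_rfl⟩
      have h4 := h1 hx
      rw [indicator_of_mem hxs, indicator_of_mem hx0] at h4
      have h5 := hΦ _ (h2 hx0) _ (h3 hxs)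
      simp only [Ψ]
      rw [indicator_of_mem hxs, indicator_of_mem hx0, indicator_of_mem hx0]
      rw [h4] at h5
      change |Φ (f (s • v + x)) - Φ (f x) - Φ' (f x) * (s * S x)| ≤ C * (s * S x) ^ 2 at h5
      have e3 : s⁻¹ * ((Φ (f (s • v + x)) - Φ (f x)) * φ x) - S x * (Φ' (f x) * φ x)
          = s⁻¹ * (Φ (f (s • v + x)) - Φ (f x) - Φ' (f x) * (s * S x)) * φ x := by
        field_simp
      rw [e3, norm_mul, norm_mul, Real.norm_eq_abs, Real.norm_eq_abs, abs_of_pos (inv_pos.2 hs0)]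
      calc s⁻¹ * |Φ (f (s • v + x)) - Φ (f x) - Φ' (f x) * (s * S x)| * ‖φ x‖
          ≤ s⁻¹ * (|C| * (s * S x) ^ 2) * Mφ := by
            gcongr
            · exact h5.trans (by gcongr; exact le_abs_self C)
            · exact hMφ x
        _ = _ := by field_simp
    · rw [hφU x hx]
      have : Ω.indicator (fun x => Φ' (f x) * φ x) x = 0 := by
        by_cases hxΩ : x ∈ Ω
        · rw [indicator_of_mem hxΩ, hφU x hx, mul_zero]
        · exact indicator_of_notMem hxΩ _
      rw [this]
      simp only [mul_zero, sub_zero, norm_zero]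
      positivity
  have lim5 := lim1.sub lim2
  have huniq := tendsto_nhds_unique lim4 lim5
  have e1 : inner ℝ gL wL = ∫ x in Ω, Φ' (f x) * g x * φ x := by
    rw [L2.inner_def, ← integral_indicator hm]
    refine integral_congr_ae ?_
    filter_upwards [hmw.coeFn_toLp, hG.coeFn_toLp] with x hx hx'
    rw [hx, hx']
    by_cases hxΩ : x ∈ Ω
    · simp [hxΩ]; ring
    · simp [hxΩ]
  have e2 : ∫ x, Ψ x * fderiv ℝ φ x v = ∫ x in Ω, Φ (f x) * fderiv ℝ φ x v := by
    rw [← integral_indicator hm]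
    congr 1
    funext x
    by_cases hxΩ : x ∈ Ω <;> simp [Ψ, hxΩ]
  rw [e1, e2] at huniq
  linarith

end WeakCalculus

/-! ### Calculus in `H¹` -/

section SobolevCalculus

open Filter Topology

variable {Ω : Set Space3} {f g : Space3 → ℝ} {v : Space3} {Gf Gg : Space3 → Space3}

lemma memLp_fderiv {φ : Space3 → ℝ} (hφ : ContDiff ℝ ∞ φ) (hc : HasCompactSupport φ)
    (v : Space3) (p : ℝ≥0∞) : MemLp (fun x => fderiv ℝ φ x v) p (volume : Measure Space3) :=
  ((hφ.continuous_fderiv (by simp)).clm_apply continuous_const).memLp_of_hasCompactSupport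
    (hc.fderiv_apply ℝ v)

lemma IsH1.weakDeriv (hf : IsH1 Ω f Gf) (v : Space3) :
    HasWeakDeriv Ω v f (fun x => inner ℝ (Gf x) v) := hf.2.2 v

lemma IsH1.memLp_inner (hf : IsH1 Ω f Gf) (v : Space3) :
    MemLp (fun x => inner ℝ (Gf x) v) 2 (volume.restrict Ω) := hf.2.1.inner_const v

lemma IsH1.add (hf : IsH1 Ω f Gf) (hg : IsH1 Ω g Gg) :
    IsH1 Ω (fun x => f x + g x) (fun x => Gf x + Gg x) := by
  refine ⟨hf.1.add hg.1, hf.2.1.add hg.2.1, fun v => ⟨locallyIntegrableOn_of_memLp (hf.1.add hg.1),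
    locallyIntegrableOn_of_memLp ((hf.2.1.add hg.2.1).inner_const v), ?_⟩⟩
  intro φ hφ hc hs
  have hφ2 := (memLp_of_contDiff hφ hc).restrict Ω
  have hd := (memLp_fderiv hφ hc v 2).restrict Ω
  have i1 : ∀ {k : Space3 → ℝ}, MemLp k 2 (volume.restrict Ω) →
      Integrable (fun x => k x * fderiv ℝ φ x v) (volume.restrict Ω) := fun hk => hk.integrable_mul hd
  have i2 : ∀ {k : Space3 → ℝ}, MemLp k 2 (volume.restrict Ω) →
      Integrable (fun x => k x * φ x) (volume.restrict Ω) := fun hk => hk.integrable_mul hφ2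
  simp only [add_mul, inner_add_left]
  rw [integral_add (i1 hf.1) (i1 hg.1), integral_add (i2 (hf.memLp_inner v)) (i2 (hg.memLp_inner v)),
    (hf.weakDeriv v).2.2 φ hφ hc hs, (hg.weakDeriv v).2.2 φ hφ hc hs]
  ring

lemma IsH1.const_mul (hf : IsH1 Ω f Gf) (c : ℝ) :
    IsH1 Ω (fun x => c * f x) (fun x => c • Gf x) := by
  refine ⟨hf.1.const_mul c, hf.2.1.const_smul c, fun v =>
    ⟨locallyIntegrableOn_of_memLp (hf.1.const_mul c),
    locallyIntegrableOn_of_memLp ((hf.2.1.const_smul c).inner_const v), ?_⟩⟩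
  intro φ hφ hc hs
  simp only [real_inner_smul_left, mul_assoc]
  rw [integral_const_mul, integral_const_mul, (hf.weakDeriv v).2.2 φ hφ hc hs, mul_neg]

lemma IsH1.sub (hf : IsH1 Ω f Gf) (hg : IsH1 Ω g Gg) :
    IsH1 Ω (fun x => f x - g x) (fun x => Gf x - Gg x) := by
  simpa [sub_eq_add_neg] using hf.add (hg.const_mul (-1))

/-- Smooth compactly supported functions are Sobolev functions. -/
lemma isH1_of_contDiff {ψ : Space3 → ℝ} (hψ : ContDiff ℝ ∞ ψ)
    (hc : HasCompactSupport ψ) :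
    IsH1 Ω ψ (fun x => gradient ψ x) := by
  have hgr : Continuous fun x => gradient ψ x :=
    (InnerProductSpace.toDual ℝ Space3).symm.continuous.comp (hψ.continuous_fderiv (by simp))
  have hgc : HasCompactSupport fun x => gradient ψ x :=
    (hc.fderiv ℝ).comp_left (map_zero (InnerProductSpace.toDual ℝ Space3).symm)
  have m1 := (memLp_of_contDiff hψ hc).restrict Ω
  have m2 : MemLp (fun x => gradient ψ x) 2 (volume.restrict Ω) :=
    (hgr.memLp_of_hasCompactSupport hgc).restrict Ω
  refine ⟨m1, m2, fun v => ⟨locallyIntegrableOn_of_memLp m1,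
    locallyIntegrableOn_of_memLp (m2.inner_const v), ?_⟩⟩
  intro φ hφ hcφ hs
  have hin : ∀ x, inner ℝ (gradient ψ x) v = fderiv ℝ ψ x v := fun x => by
    simp [gradient]
  simp only [hin]
  have hφ0 : ∀ x, x ∉ Ω → φ x = 0 := fun x hx =>
    image_eq_zero_of_notMem_tsupport fun h => hx (hs h)
  have hdφ0 : ∀ x, x ∉ Ω → fderiv ℝ φ x = 0 := fun x hx =>
    image_eq_zero_of_notMem_tsupport fun h => hx (hs (tsupport_fderiv_subset ℝ h))
  rw [setIntegral_eq_integral_of_forall_compl_eq_zero fun x hx => by rw [hdφ0 x hx]; simp,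
    setIntegral_eq_integral_of_forall_compl_eq_zero fun x hx => by rw [hφ0 x hx]; simp]
  have h2 := memLp_of_contDiff hψ hc
  have h3 := memLp_of_contDiff hφ hcφ
  exact integral_mul_fderiv_eq_neg_fderiv_mul_of_integrable
    ((memLp_fderiv hψ hc v 2).integrable_mul h3) (h2.integrable_mul (memLp_fderiv hφ hcφ v 2))
    (h2.integrable_mul h3) (fun x _ => hψ.differentiable (by simp) x)
    (fun x _ => hφ.differentiable (by simp) x)

lemma isH1_const (hv : volume Ω ≠ ⊤) (c : ℝ) :
    IsH1 Ω (fun _ => c) (fun _ => 0) := by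
  have : IsFiniteMeasure (volume.restrict Ω) := ⟨by simpa using hv.lt_top⟩
  refine ⟨memLp_const c, MemLp.zero, fun v => ⟨locallyIntegrableOn_of_memLp (memLp_const c),
    locallyIntegrableOn_of_memLp (by simp), ?_⟩⟩
  intro φ hφ hcφ hs
  have hdφ0 : ∀ x, x ∉ Ω → fderiv ℝ φ x = 0 := fun x hx =>
    image_eq_zero_of_notMem_tsupport fun h => hx (hs (tsupport_fderiv_subset ℝ h))
  rw [integral_const_mul,
    setIntegral_eq_integral_of_forall_compl_eq_zero fun x hx => by rw [hdφ0 x hx]; simp]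
  -- The integral of a derivative of a test function vanishes, being the derivative of an integral
  -- that is invariant under translation.
  have h1 := hasDerivAt_integral_mul_translate (locallyIntegrable_const (1 : ℝ)) hφ hcφ v 0
  simp only [one_mul, zero_smul, sub_zero] at h1
  have h2 : (fun σ : ℝ => ∫ x, φ (x - σ • v)) = fun _ => ∫ x, φ x := by
    funext σ
    exact integral_sub_right_eq_self φ (σ • v)
  rw [h2] at h1
  have := h1.unique (hasDerivAt_const 0 _)
  simp only [neg_eq_zero] at this
  rw [this]
  simp

/-- Chain rule in `H¹`. -/
lemma IsH1.comp (hΩ : IsOpen Ω) (hv : volume Ω ≠ ⊤) (hf : IsH1 Ω f Gf) {A : Set ℝ}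
    (hA : ∀ᵐ x ∂(volume.restrict Ω), f x ∈ A) {Φ Φ' : ℝ → ℝ} {C B : ℝ}
    (hΦ : ∀ a ∈ A, ∀ b ∈ A, |Φ b - Φ a - Φ' a * (b - a)| ≤ C * (b - a) ^ 2)
    (hB' : ∀ a ∈ A, |Φ' a| ≤ B) (hB : ∀ a ∈ A, |Φ a| ≤ B) (hmΦ : Measurable Φ)
    (hmΦ' : Measurable Φ') :
    IsH1 Ω (fun x => Φ (f x)) (fun x => Φ' (f x) • Gf x) := by
  have : IsFiniteMeasure (volume.restrict Ω) := ⟨by simpa using hv.lt_top⟩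
  have h1 : MemLp (fun x => Φ (f x)) 2 (volume.restrict Ω) := by
    refine MemLp.of_bound (hmΦ.comp_aemeasurable hf.1.1.aemeasurable).aestronglyMeasurable B ?_
    filter_upwards [hA] with x hx using hB _ hx
  refine ⟨h1, ?_, fun v => ?_⟩
  · refine MemLp.of_le_mul (c := B) hf.2.1
      ((hmΦ'.comp_aemeasurable hf.1.1.aemeasurable).aestronglyMeasurable.smul hf.2.1.1) ?_
    filter_upwards [hA] with x hx
    rw [norm_smul]
    gcongr
    exact hB' _ hx
  · simp only [real_inner_smul_left]
    exact (hf.weakDeriv v).comp hΩ hf.1 (hf.memLp_inner v) hA hΦ hB' hmΦ' h1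

/-- Product rule for bounded Sobolev functions. -/
lemma IsH1.mul (hΩ : IsOpen Ω) (hv : volume Ω ≠ ⊤) (hf : IsH1 Ω f Gf) (hg : IsH1 Ω g Gg) {B : ℝ}
    (hfB : ∀ᵐ x ∂(volume.restrict Ω), |f x| ≤ B) (hgB : ∀ᵐ x ∂(volume.restrict Ω), |g x| ≤ B) :
    IsH1 Ω (fun x => f x * g x) (fun x => f x • Gg x + g x • Gf x) := by
  -- By polarization, `2fg = (f + g)² - f² - g²`, so the chain rule for the square suffices.
  have sq : ∀ {k : Space3 → ℝ} {G : Space3 → Space3}, IsH1 Ω k G → ∀ {D : ℝ},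
      (∀ᵐ x ∂(volume.restrict Ω), |k x| ≤ D) →
      IsH1 Ω (fun x => k x ^ 2) (fun x => (2 * k x) • G x) := by
    intro k G hk D hD
    refine hk.comp hΩ hv (A := {a | |a| ≤ D}) hD (Φ := fun a => a ^ 2) (Φ' := fun a => 2 * a)
      (C := 1) (B := max (2 * D) (D ^ 2)) ?_ ?_ ?_ (by fun_prop) (by fun_prop)
    · intro a _ b _
      rw [show b ^ 2 - a ^ 2 - 2 * a * (b - a) = (b - a) ^ 2 by ring, abs_of_nonneg (sq_nonneg _),
        one_mul]
    · intro a ha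
      rw [abs_mul, abs_two]
      exact le_max_of_le_left (by gcongr; exact ha)
    · intro a ha
      rw [abs_pow]
      exact le_max_of_le_right (by gcongr; exact ha)
  have hs : ∀ᵐ x ∂(volume.restrict Ω), |f x + g x| ≤ B + B := by
    filter_upwards [hfB, hgB] with x h1 h2
    exact (abs_add_le _ _).trans (add_le_add h1 h2)
  have key := ((sq (hf.add hg) hs).sub ((sq hf hfB).add (sq hg hgB))).const_mul (1 / 2)
  convert key using 2 with x x
  · ring
  · simp only [smul_sub, smul_add, smul_smul]
    module

/-- Weak gradients are unique. -/
lemma HasWeakGrad.unique (hΩ : IsOpen Ω) (h1 : HasWeakGrad Ω f Gf) (h2 : HasWeakGrad Ω f Gg) :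
    ∀ᵐ x ∂(volume.restrict Ω), Gf x = Gg x := by
  have key : ∀ v : Space3, ∀ᵐ x, x ∈ Ω → inner ℝ (Gf x) v - inner ℝ (Gg x) v = 0 := by
    intro v
    refine hΩ.ae_eq_zero_of_integral_contDiff_smul_eq_zero ((h1 v).2.1.sub (h2 v).2.1) ?_
    intro φ hφ hc hs
    have i : ∀ {k : Space3 → ℝ}, LocallyIntegrableOn k Ω → Integrable fun x => φ x • k x :=
      fun {k} hk => by
        rw [← integrableOn_iff_integrable_of_support_subset (s := tsupport φ)]
        · exact (hk.integrableOn_compact_subset hs hc).continuousOn_smul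
            hφ.continuous.continuousOn hc
        · intro x hx
          exact subset_tsupport _ fun h0 => hx (by simp [h0])
    simp only [smul_sub]
    rw [integral_sub (i (h1 v).2.1) (i (h2 v).2.1)]
    have e : ∀ k : Space3 → ℝ, ∫ x, φ x • k x = ∫ x in Ω, k x * φ x := by
      intro k
      rw [setIntegral_eq_integral_of_forall_compl_eq_zero]
      · simp [mul_comm]
      · intro x hx
        rw [image_eq_zero_of_notMem_tsupport fun h => hx (hs h), mul_zero]
    rw [e, e]
    have a1 := (h1 v).2.2 φ hφ hc hs
    have a2 := (h2 v).2.2 φ hφ hc hs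
    linarith
  rw [ae_restrict_iff' hΩ.measurableSet]
  have hall : ∀ᵐ x, ∀ i : Fin 3, x ∈ Ω →
      inner ℝ (Gf x) (EuclideanSpace.single i (1 : ℝ))
        - inner ℝ (Gg x) (EuclideanSpace.single i (1 : ℝ)) = 0 :=
    ae_all_iff.2 fun i => key _
  filter_upwards [hall] with x hx hxΩ
  ext i
  have := hx i hxΩ
  simp only [EuclideanSpace.inner_single_right, one_mul] at this
  simpa [sub_eq_zero] using this

end SobolevCalculus

/-! ### Oscillation on Lipschitz domains and the Harnack inequality -/

section Oscillation

open Filter Topology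

variable {Ω U V : Set Space3}

/-- Sobolev functions on `Ω` with gradient bounded by `L` oscillate on `U` by at most `C L`. -/
def OscillationBound (Ω U : Set Space3) : Prop :=
  ∃ C : ℝ, 0 ≤ C ∧ ∀ (F : Space3 → ℝ) (G : Space3 → Space3) (L : ℝ), 0 ≤ L → IsH1 Ω F G →
    (∀ᵐ x ∂(volume.restrict Ω), ‖G x‖ ≤ L) → ∃ a : ℝ, ∀ᵐ x, x ∈ U → |F x - a| ≤ C * L

lemma IsH1.ae_abs_translate_sub_le (hΩ : IsOpen Ω) {F : Space3 → ℝ} {G : Space3 → Space3} {L : ℝ}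
    (hL : 0 ≤ L) (hF : IsH1 Ω F G) (hG : ∀ᵐ x ∂(volume.restrict Ω), ‖G x‖ ≤ L) (hU : IsOpen U)
    {v : Space3} (hUΩ : ∀ x ∈ U, ∀ σ ∈ Icc (0 : ℝ) 1, x + σ • v ∈ Ω) :
    ∀ᵐ x, x ∈ U → |F (x + v) - F x| ≤ L * ‖v‖ := by
  refine (hF.weakDeriv v).ae_abs_sub_le hΩ.measurableSet hF.1 (hF.memLp_inner v) (by positivity) ?_
    hU hUΩ
  filter_upwards [hG] with x hx
  exact (abs_real_inner_le_norm _ _).trans (by gcongr)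

lemma exists_mem_of_ae {p : Space3 → Prop} (h : ∀ᵐ x, p x) (hU : IsOpen U) (hne : U.Nonempty) :
    ∃ x ∈ U, p x := by
  have h1 : volume U ≠ 0 := (hU.measure_pos volume hne).ne'
  have h2 : ∃ᵐ x, x ∈ U := frequently_ae_mem_iff.2 h1
  obtain ⟨x, hx, hx'⟩ := (h2.and_eventually h).exists
  exact ⟨x, hx, hx'⟩

/-- For each displacement `v` the Lipschitz bound holds for a.e. base point, and two points of the
ball differ by at most `2r`. Fubini exchanges the quantifiers and gives a single base point `y` good
for a.e. displacement; its value is the reference constant. A measurable representative of `F` makes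
the exceptional set measurable in the product. -/
lemma oscillationBound_ball (hΩ : IsOpen Ω) {z : Space3} {r : ℝ} (hr : 0 < r)
    (hB : Metric.ball z r ⊆ Ω) : OscillationBound Ω (Metric.ball z r) := by
  refine ⟨2 * r, by positivity, fun F G L hL hF hG => ?_⟩
  set B := Metric.ball z r
  have hBo : IsOpen B := Metric.isOpen_ball
  obtain ⟨F', hF'm, hF'⟩ := hF.1.1
  rw [EventuallyEq, ae_restrict_iff' hΩ.measurableSet] at hF'
  have hFm : Measurable F' := hF'm.measurable
  have hslice : ∀ v : Space3, ∀ᵐ y, y ∈ B → y + v ∈ B → |F' (y + v) - F' y| ≤ 2 * r * L := by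
    intro v
    have hUo : IsOpen (B ∩ (fun y => y + v) ⁻¹' B) :=
      hBo.inter (hBo.preimage (by fun_prop))
    have h1 := hF.ae_abs_translate_sub_le hΩ hL hG hUo (v := v) fun x hx σ hσ => by
      have := (convex_ball z r).add_smul_sub_mem hx.1 hx.2 hσ
      rw [add_sub_cancel_left] at this
      exact hB this
    have h2 : ∀ᵐ y, y + v ∈ Ω → F (y + v) = F' (y + v) :=
      (measurePreserving_add_right volume v).quasiMeasurePreserving.ae hF'
    filter_upwards [h1, hF', h2] with y h1 h3 h4 hy hyv
    rw [← h3 (hB hy), ← h4 (hB hyv)]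
    refine (h1 ⟨hy, hyv⟩).trans ?_
    have : ‖v‖ ≤ 2 * r := by
      have e : v = (y + v - z) - (y - z) := by abel
      rw [e]
      refine (norm_sub_le _ _).trans ?_
      rw [← dist_eq_norm, ← dist_eq_norm, two_mul]
      exact add_le_add (Metric.mem_ball.1 hyv).le (Metric.mem_ball.1 hy).le
    calc L * ‖v‖ ≤ L * (2 * r) := by gcongr
      _ = _ := by ring
  have hms : MeasurableSet {p : Space3 × Space3 |
      p.2 ∈ B → p.2 + p.1 ∈ B → |F' (p.2 + p.1) - F' p.2| ≤ 2 * r * L} := by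
    have m1 : MeasurableSet {p : Space3 × Space3 | p.2 ∈ B} :=
      hBo.measurableSet.preimage measurable_snd
    have m2 : MeasurableSet {p : Space3 × Space3 | p.2 + p.1 ∈ B} :=
      hBo.measurableSet.preimage (measurable_snd.add measurable_fst)
    have m3 : MeasurableSet {p : Space3 × Space3 | |F' (p.2 + p.1) - F' p.2| ≤ 2 * r * L} :=
      measurableSet_le (by fun_prop) measurable_const
    exact m1.imp (m2.imp m3)
  have hprod : ∀ᵐ p : Space3 × Space3 ∂(volume.prod volume),
      p.2 ∈ B → p.2 + p.1 ∈ B → |F' (p.2 + p.1) - F' p.2| ≤ 2 * r * L :=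
    (Measure.ae_prod_iff_ae_ae hms).2 (Eventually.of_forall hslice)
  have hswap : ∀ᵐ y : Space3, ∀ᵐ v : Space3, y ∈ B → y + v ∈ B →
      |F' (y + v) - F' y| ≤ 2 * r * L := by
    have := Measure.ae_ae_of_ae_prod (μ := (volume : Measure Space3)) (ν := volume)
      (p := fun q : Space3 × Space3 => q.1 ∈ B → q.1 + q.2 ∈ B →
        |F' (q.1 + q.2) - F' q.1| ≤ 2 * r * L)
      ((Measure.measurePreserving_swap (μ := volume) (ν := volume)).quasiMeasurePreserving.ae hprod)
    exact this
  obtain ⟨y, hy, hy'⟩ := exists_mem_of_ae hswap hBo ⟨z, Metric.mem_ball_self hr⟩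
  refine ⟨F' y, ?_⟩
  have h3 : ∀ᵐ x, y ∈ B → y + (x - y) ∈ B → |F' (y + (x - y)) - F' y| ≤ 2 * r * L :=
    (measurePreserving_sub_right volume y).quasiMeasurePreserving.ae hy'
  filter_upwards [h3, hF'] with x hx hx' hxB
  rw [hx' (hB hxB)]
  rw [add_sub_cancel] at hx
  exact hx hy hxB

/-- The open overlap has positive measure, so it contains a point at which both bounds hold;
comparing through that point costs `D` twice. -/
lemma OscillationBound.union (hU : OscillationBound Ω U) (hV : OscillationBound Ω V)
    (hUo : IsOpen U) (hVo : IsOpen V) (hne : (U ∩ V).Nonempty) : OscillationBound Ω (U ∪ V) := by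
  obtain ⟨C, hC, h⟩ := hU
  obtain ⟨D, hD, h'⟩ := hV
  refine ⟨C + 2 * D, by positivity, fun F G L hL hF hG => ?_⟩
  obtain ⟨a, ha⟩ := h F G L hL hF hG
  obtain ⟨b, hb⟩ := h' F G L hL hF hG
  obtain ⟨x, hx, hxa, hxb⟩ := exists_mem_of_ae (ha.and hb) (hUo.inter hVo) hne
  have h1 := hxa hx.1
  have h2 := hxb hx.2
  have hCL : 0 ≤ C * L := by positivity
  have hDL : 0 ≤ D * L := by positivity
  refine ⟨a, ?_⟩
  filter_upwards [ha, hb] with y hya hyb hy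
  rcases hy with hy | hy
  · have := hya hy
    linarith
  · have := hyb hy
    rw [abs_le] at *
    constructor <;> linarith [this.1, this.2, h1.1, h1.2, h2.1, h2.2]

/-- Near `z` the domain is an epigraph in the direction `e`. Translation by `τ • e` moves the points
of `Ω` near `z`, along segments inside `Ω`, into a ball contained in `Ω`, where the oscillation is
known; the translation costs at most `τ L`. -/
lemma exists_oscillationBound_of_mem_frontier (hΩ : IsLipschitzDomain Ω) {z : Space3}
    (hz : z ∈ frontier Ω) : ∃ W, IsOpen W ∧ z ∈ W ∧ OscillationBound Ω (W ∩ Ω) := by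
  obtain ⟨e, g, K, V, he, hg, hVo, hzV, hV⟩ := hΩ.lipschitz z hz
  set π : Space3 → Space3 := fun y => y - inner ℝ y e • e
  have hπ : ∀ y (σ : ℝ), π (y + σ • e) = π y := by
    intro y σ
    simp only [π, inner_add_left, real_inner_smul_left, real_inner_self_eq_norm_sq, he]
    module
  have hin : ∀ y (σ : ℝ), inner ℝ (y + σ • e) e = inner ℝ y e + σ := by
    intro y σ
    simp only [inner_add_left, real_inner_smul_left, real_inner_self_eq_norm_sq, he]
    ring
  have hπc : Continuous π := by fun_prop
  -- As `z` lies only in the closure, the epigraph inequality is not strict; moving up by `τ > 0`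
  -- makes it strict.
  have hzle : g (π z) ≤ inner ℝ z e := by
    have hc : z ∈ closure (V ∩ Ω) := by
      have : z ∈ closure Ω := frontier_subset_closure hz
      rw [mem_closure_iff_nhds] at this ⊢
      intro t ht
      obtain ⟨y, hy⟩ := this (t ∩ V) (inter_mem ht (hVo.mem_nhds hzV))
      exact ⟨y, hy.1.1, hy.1.2, hy.2⟩
    have hcl : IsClosed {y : Space3 | g (π y) ≤ inner ℝ y e} :=
      isClosed_le (hg.continuous.comp hπc) (by fun_prop)
    exact hcl.closure_subset_iff.2 (fun y hy => ((hV y hy.1).1 hy.2).le) hc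
  obtain ⟨r, hr, hrV⟩ := Metric.isOpen_iff.1 hVo z hzV
  set τ := r / 2
  have hτ : 0 < τ := half_pos hr
  have hmemV : ∀ y ∈ Metric.ball z τ, ∀ σ ∈ Icc 0 τ, y + σ • e ∈ V := by
    intro y hy σ hσ
    apply hrV
    rw [Metric.mem_ball] at hy ⊢
    calc dist (y + σ • e) z ≤ dist (y + σ • e) y + dist y z := dist_triangle _ _ _
      _ = σ + dist y z := by
        rw [dist_eq_norm, add_sub_cancel_left, norm_smul, he, mul_one, Real.norm_eq_abs,
          abs_of_nonneg hσ.1]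
      _ < τ + τ := add_lt_add_of_le_of_lt hσ.2 hy
      _ = r := by simp [τ]
  have hzτ : z + τ • e ∈ Ω := by
    rw [hV _ (hmemV z (Metric.mem_ball_self hτ) τ ⟨hτ.le, le_rfl⟩)]
    change g (π _) < _
    rw [hπ, hin]
    linarith
  obtain ⟨r', hr', hrΩ⟩ := Metric.isOpen_iff.1 hΩ.isOpen _ hzτ
  obtain ⟨C, hC, hCb⟩ := oscillationBound_ball hΩ.isOpen hr' hrΩ
  refine ⟨Metric.ball z (min τ r'), Metric.isOpen_ball, Metric.mem_ball_self (lt_min hτ hr'),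
    C + τ, by positivity, fun F G L hL hF hG => ?_⟩
  obtain ⟨a, ha⟩ := hCb F G L hL hF hG
  have h1 := hF.ae_abs_translate_sub_le hΩ.isOpen hL hG
    (Metric.isOpen_ball.inter hΩ.isOpen) (U := Metric.ball z (min τ r') ∩ Ω) (v := τ • e) ?_
  · refine ⟨a, ?_⟩
    have h2 : ∀ᵐ x, x + τ • e ∈ Metric.ball (z + τ • e) r' → |F (x + τ • e) - a| ≤ C * L :=
      (measurePreserving_add_right volume (τ • e)).quasiMeasurePreserving.ae ha
    filter_upwards [h1, h2] with x h1 h2 hx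
    have h3 := h1 hx
    have h4 := h2 (by
      rw [Metric.mem_ball, dist_add_right]
      exact (Metric.mem_ball.1 hx.1).trans_le (min_le_right _ _))
    rw [norm_smul, he, mul_one, Real.norm_eq_abs, abs_of_pos hτ] at h3
    rw [abs_le] at *
    constructor <;> linarith [h3.1, h3.2, h4.1, h4.2]
  · intro x hx σ hσ
    rw [smul_smul]
    have hxb : x ∈ Metric.ball z τ := Metric.ball_subset_ball (min_le_left _ _) hx.1
    have hσ' : σ * τ ∈ Icc 0 τ := ⟨by have := hσ.1; positivity, by nlinarith [hσ.2]⟩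
    rw [hV _ (hmemV x hxb _ hσ')]
    have hx0 : g (π x) < inner ℝ x e := by
      have hxV : x ∈ V := by simpa using hmemV x hxb 0 ⟨le_rfl, hτ.le⟩
      exact (hV x hxV).1 hx.2
    change g (π _) < _
    rw [hπ, hin]
    linarith [hσ'.1]

/-- On a Lipschitz domain, functions with bounded gradient have bounded oscillation. -/
lemma IsLipschitzDomain.oscillationBound (hΩ : IsLipschitzDomain Ω) : OscillationBound Ω Ω := by
  obtain ⟨x₀, hx₀⟩ := hΩ.isConnected.nonempty
  obtain ⟨r₀, hr₀, hB₀⟩ := Metric.isOpen_iff.1 hΩ.isOpen x₀ hx₀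
  set Good : Set Space3 → Prop := fun U => IsOpen U ∧ x₀ ∈ U ∧ OscillationBound Ω U
  have hgood₀ : Good (Metric.ball x₀ r₀) :=
    ⟨Metric.isOpen_ball, Metric.mem_ball_self hr₀, oscillationBound_ball hΩ.isOpen hr₀ hB₀⟩
  have hstep : ∀ U V, Good U → IsOpen V → OscillationBound Ω V → (U ∩ V).Nonempty →
      Good (U ∪ V) := fun U V hU hVo hV hne =>
    ⟨hU.1.union hVo, Or.inl hU.2.1, hU.2.2.union hV hU.1 hVo hne⟩
  set S : Set Space3 := {x | ∃ U, Good U ∧ x ∈ U}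
  have hSo : IsOpen S := by
    rw [isOpen_iff_mem_nhds]
    rintro x ⟨U, hU, hxU⟩
    filter_upwards [hU.1.mem_nhds hxU] with y hy using ⟨U, hU, hy⟩
  -- The points reachable from `x₀` by good sets form an open set that is relatively closed in `Ω`,
  -- so connectedness gives all of `Ω`.
  have hΩS : Ω ⊆ S := by
    refine hΩ.isConnected.isPreconnected.subset_of_closure_inter_subset hSo
      ⟨x₀, hx₀, _, hgood₀, Metric.mem_ball_self hr₀⟩ ?_
    rintro x ⟨hxS, hxΩ⟩
    obtain ⟨r, hr, hB⟩ := Metric.isOpen_iff.1 hΩ.isOpen x hxΩ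
    obtain ⟨y, hyB, U, hU, hyU⟩ := mem_closure_iff_nhds.1 hxS _ (Metric.ball_mem_nhds x hr)
    exact ⟨_, hstep U _ hU Metric.isOpen_ball (oscillationBound_ball hΩ.isOpen hr hB)
      ⟨y, hyU, hyB⟩, Or.inr (Metric.mem_ball_self hr)⟩
  have hcover : ∀ z ∈ closure Ω, ∃ W, W ∈ 𝓝 z ∧ IsOpen W ∧ OscillationBound Ω (W ∩ Ω) := by
    intro z hz
    by_cases hzΩ : z ∈ Ω
    · obtain ⟨r, hr, hB⟩ := Metric.isOpen_iff.1 hΩ.isOpen z hzΩ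
      refine ⟨Metric.ball z r, Metric.ball_mem_nhds z hr, Metric.isOpen_ball, ?_⟩
      rw [inter_eq_left.2 hB]
      exact oscillationBound_ball hΩ.isOpen hr hB
    · obtain ⟨W, hW, hzW, h⟩ := exists_oscillationBound_of_mem_frontier hΩ
        (by rw [hΩ.isOpen.frontier_eq]; exact ⟨hz, hzΩ⟩)
      exact ⟨W, hW.mem_nhds hzW, hW, h⟩
  choose! W hWn hWo hWb using hcover
  obtain ⟨t, htΩ, ht⟩ := hΩ.isBounded.isCompact_closure.elim_nhds_subcover W hWn
  -- The pieces of the finite cover of `closure Ω` are attached one at a time. A good set through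
  -- some point of the new piece serves as a bridge, since every good set contains `x₀`.
  have hfin : ∀ s : Finset Space3, (∀ z ∈ s, z ∈ closure Ω) →
      ∃ U, Good U ∧ ∀ z ∈ s, W z ∩ Ω ⊆ U := by
    intro s
    induction s using Finset.induction_on with
    | empty => exact fun _ => ⟨_, hgood₀, by simp⟩
    | insert z s hzs ih =>
      intro hs
      obtain ⟨U, hU, hUs⟩ := ih fun y hy => hs y (Finset.mem_insert_of_mem hy)
      have hzc := hs z (Finset.mem_insert_self _ _)
      obtain ⟨x, hxW, hxΩ⟩ := mem_closure_iff_nhds.1 hzc _ (hWn z hzc)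
      obtain ⟨U', hU', hxU'⟩ := hΩS hxΩ
      have h1 := hstep U U' hU hU'.1 hU'.2.2 ⟨x₀, hU.2.1, hU'.2.1⟩
      have h2 := hstep _ _ h1 ((hWo z hzc).inter hΩ.isOpen) (hWb z hzc)
        ⟨x, Or.inr hxU', hxW, hxΩ⟩
      refine ⟨_, h2, fun y hy => ?_⟩
      rcases Finset.mem_insert.1 hy with rfl | hy
      · exact subset_union_right
      · exact (hUs y hy).trans (subset_union_left.trans subset_union_left)
  obtain ⟨U, ⟨_, _, C, hC, hU⟩, hUt⟩ := hfin t htΩ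
  refine ⟨C, hC, fun F G L hL hF hG => ?_⟩
  obtain ⟨a, ha⟩ := hU F G L hL hF hG
  refine ⟨a, ?_⟩
  filter_upwards [ha] with x hx hxΩ
  obtain ⟨z, hz, hxz⟩ := mem_iUnion₂.1 (ht (subset_closure hxΩ))
  exact hx (hUt z hz ⟨hxz, hxΩ⟩)

/-- The increment of the logarithm lies between `y⁻¹(y - x)` and `x⁻¹(y - x)`, and these differ by
`(y - x)²/(xy)`. -/
lemma abs_log_taylor {l x y : ℝ} (hl : 0 < l) (hx : l ≤ x) (hy : l ≤ y) :
    |Real.log y - Real.log x - x⁻¹ * (y - x)| ≤ (l ^ 2)⁻¹ * (y - x) ^ 2 := by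
  have hx0 := hl.trans_le hx
  have hy0 := hl.trans_le hy
  have h1 : Real.log y - Real.log x ≤ x⁻¹ * (y - x) := by
    rw [← Real.log_div hy0.ne' hx0.ne']
    refine (Real.log_le_sub_one_of_pos (div_pos hy0 hx0)).trans_eq ?_
    field_simp
  have h2 : y⁻¹ * (y - x) ≤ Real.log y - Real.log x := by
    rw [← Real.log_div hy0.ne' hx0.ne']
    refine le_trans (le_of_eq ?_) (Real.one_sub_inv_le_log_of_pos (div_pos hy0 hx0))
    field_simp
  have h3 : x⁻¹ * (y - x) - y⁻¹ * (y - x) = (x * y)⁻¹ * (y - x) ^ 2 := by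
    field_simp
  have h4 : (x * y)⁻¹ * (y - x) ^ 2 ≤ (l ^ 2)⁻¹ * (y - x) ^ 2 := by
    gcongr
    rw [pow_two]
    gcongr
  rw [abs_le]
  have h5 : 0 ≤ (l ^ 2)⁻¹ * (y - x) ^ 2 := by positivity
  constructor <;> linarith

/-- Harnack inequality for functions with bounded logarithmic gradient. -/
lemma IsLipschitzDomain.exists_harnack (hΩ : IsLipschitzDomain Ω) (hv : volume Ω ≠ ⊤) :
    ∃ C : ℝ, 0 ≤ C ∧ ∀ (f : Space3 → ℝ) (G : Space3 → Space3) (L M : ℝ), 0 ≤ L → IsH1 Ω f G →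
      (∀ᵐ x ∂(volume.restrict Ω), 0 < f x ∧ f x ≤ M) →
      (∀ᵐ x ∂(volume.restrict Ω), ‖G x‖ ≤ L * f x) →
      ∀ᵐ x ∂(volume.restrict Ω),
        Real.exp (-(2 * C * L)) * ((∫ y in Ω, f y) / volume.real Ω) ≤ f x := by
  obtain ⟨C, hC, hosc⟩ := hΩ.oscillationBound
  refine ⟨C, hC, fun f G L M hL hf hfM hG => ?_⟩
  have : IsFiniteMeasure (volume.restrict Ω) := ⟨by simpa using hv.lt_top⟩
  have hvpos : 0 < volume.real Ω := by
    rw [measureReal_def]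
    exact ENNReal.toReal_pos (hΩ.isOpen.measure_pos volume hΩ.isConnected.nonempty).ne' hv
  -- Without a lower bound on `f` the function `log f` may be unbounded, so `log (f + η)` is used;
  -- its gradient is still at most `L`. Both the mean of `f` and `f + η` are then within a factor
  -- `exp (C L)` of `exp a`, whence the factor `exp (-2 C L)`.
  have hη : ∀ η : ℝ, 0 < η → ∀ᵐ x ∂(volume.restrict Ω),
      Real.exp (-(2 * C * L)) * ((∫ y in Ω, f y) / volume.real Ω) - η ≤ f x := by
    intro η hη
    have hM0 : ∀ᵐ x ∂(volume.restrict Ω), f x ∈ Ioc 0 M := hfM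
    have h1 : IsH1 Ω (fun x => Real.log (f x + η)) (fun x => (f x + η)⁻¹ • G x) := by
      refine hf.comp hΩ.isOpen hv hM0 (Φ := fun a => Real.log (a + η)) (Φ' := fun a => (a + η)⁻¹)
        (C := (η ^ 2)⁻¹) (B := max η⁻¹ (max |Real.log η| |Real.log (M + η)|)) ?_ ?_ ?_
        (by fun_prop) (by fun_prop)
      · intro a ha b hb
        have := abs_log_taylor hη (by linarith [ha.1] : η ≤ a + η) (by linarith [hb.1] : η ≤ b + η)
        simpa using this
      · intro a ha
        have : 0 < a + η := by linarith [ha.1]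
        rw [abs_of_pos (inv_pos.2 this)]
        exact le_max_of_le_left (inv_anti₀ hη (by linarith [ha.1]))
      · intro a ha
        refine le_max_of_le_right (abs_le_max_abs_abs ?_ ?_)
        · exact Real.log_le_log hη (by linarith [ha.1])
        · exact Real.log_le_log (by linarith [ha.1]) (by linarith [ha.2])
    obtain ⟨a, ha⟩ := hosc _ _ L hL h1 (by
      filter_upwards [hG, hfM] with x hx hx'
      rw [norm_smul, Real.norm_eq_abs, abs_of_pos (inv_pos.2 (by linarith [hx'.1])),
        inv_mul_le_iff₀ (by linarith [hx'.1])]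
      nlinarith [hx'.1])
    have ha' : ∀ᵐ x ∂(volume.restrict Ω), |Real.log (f x + η) - a| ≤ C * L :=
      (ae_restrict_iff' hΩ.isOpen.measurableSet).2 ha
    have hup : ∀ᵐ x ∂(volume.restrict Ω), f x ≤ Real.exp (a + C * L) := by
      filter_upwards [ha', hfM] with x hx hx'
      have hp : 0 < f x + η := by linarith [hx'.1]
      have : f x + η ≤ Real.exp (a + C * L) := by
        rw [← Real.log_le_iff_le_exp hp]
        linarith [(abs_le.1 hx).2]
      linarith
    have hint : ∫ y in Ω, f y ≤ volume.real Ω * Real.exp (a + C * L) := by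
      refine (integral_mono_ae (hf.1.integrable (by norm_num)) (integrable_const _) hup).trans ?_
      rw [integral_const, measureReal_restrict_apply_univ, smul_eq_mul]
    filter_upwards [ha', hfM] with x hx hx'
    have hp : 0 < f x + η := by linarith [hx'.1]
    have h2 : Real.exp (a - C * L) ≤ f x + η := by
      rw [← Real.le_log_iff_exp_le hp]
      linarith [(abs_le.1 hx).1]
    have h3 : (∫ y in Ω, f y) / volume.real Ω ≤ Real.exp (a + C * L) := by
      rw [div_le_iff₀ hvpos, mul_comm]
      exact hint
    have h4 : Real.exp (-(2 * C * L)) * ((∫ y in Ω, f y) / volume.real Ω)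
        ≤ Real.exp (-(2 * C * L)) * Real.exp (a + C * L) := by gcongr
    rw [← Real.exp_add, show -(2 * C * L) + (a + C * L) = a - C * L by ring] at h4
    linarith
  have hall : ∀ᵐ x ∂(volume.restrict Ω), ∀ k : ℕ,
      Real.exp (-(2 * C * L)) * ((∫ y in Ω, f y) / volume.real Ω) - 1 / ((k : ℝ) + 1) ≤ f x :=
    ae_all_iff.2 fun k => hη _ (by positivity)
  filter_upwards [hall] with x hx
  have hlim := (tendsto_one_div_add_atTop_nhds_zero_nat (𝕜 := ℝ)).const_sub
    (Real.exp (-(2 * C * L)) * ((∫ y in Ω, f y) / volume.real Ω))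
  rw [sub_zero] at hlim
  exact le_of_tendsto' hlim hx

end Oscillation

/-! ### Space-time cylinders and shifts in time -/

section SpaceTime

open Filter Topology

instance isAddHaarMeasure_volume_spaceTime : (volume : Measure (ℝ × Space3)).IsAddHaarMeasure :=
  inferInstanceAs ((volume : Measure ℝ).prod (volume : Measure Space3)).IsAddHaarMeasure

variable {Ω : Set Space3} {S T τ h : ℝ}

/-- The unit vector in the direction of time. -/
def timeDir : ℝ × Space3 := (1, 0)

lemma smul_timeDir_add (σ : ℝ) (z : ℝ × Space3) : σ • timeDir + z = (σ + z.1, z.2) := by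
  ext <;> simp [timeDir]

lemma measurePreserving_shift (σ : ℝ) :
    MeasurePreserving (fun z : ℝ × Space3 => (σ + z.1, z.2)) := by
  have := measurePreserving_add_left (volume : Measure (ℝ × Space3)) (σ • timeDir)
  simpa only [smul_timeDir_add] using this

lemma restrict_prod_eq (I : Set ℝ) (Ω : Set Space3) :
    (volume : Measure (ℝ × Space3)).restrict (I ×ˢ Ω)
      = (volume.restrict I).prod (volume.restrict Ω) :=
  (Measure.prod_restrict _ _).symm

lemma restrict_cyl (Ω : Set Space3) (S : ℝ) :
    (volume : Measure (ℝ × Space3)).restrict (cyl Ω S)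
      = (volume.restrict (Ioo 0 S)).prod (volume.restrict Ω) := restrict_prod_eq _ _

lemma measurableSet_cyl (hΩ : MeasurableSet Ω) : MeasurableSet (cyl Ω S) :=
  measurableSet_Ioo.prod hΩ

lemma cyl_mono {S S' : ℝ} (h : S ≤ S') : cyl Ω S ⊆ cyl Ω S' :=
  prod_mono (Ioo_subset_Ioo_right h) subset_rfl

lemma restrict_cyl_mono {S S' : ℝ} (h : S ≤ S') :
    (volume : Measure (ℝ × Space3)).restrict (cyl Ω S) ≤ volume.restrict (cyl Ω S') :=
  Measure.restrict_mono (cyl_mono h) le_rfl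

lemma ae_ae_of_ae_cyl {p : ℝ → Space3 → Prop}
    (h : ∀ᵐ z ∂((volume : Measure (ℝ × Space3)).restrict (cyl Ω S)), p z.1 z.2) :
    ∀ᵐ t ∂(volume.restrict (Ioo 0 S)), ∀ᵐ x ∂(volume.restrict Ω), p t x := by
  rw [restrict_cyl] at h
  exact Measure.ae_ae_of_ae_prod h

lemma memLp_slice {V : Type*} [NormedAddCommGroup V] {f : ℝ → Space3 → V}
    (hf : MemLp (fun z : ℝ × Space3 => f z.1 z.2) 2 (volume.restrict (cyl Ω S))) :
    ∀ᵐ t ∂(volume.restrict (Ioo 0 S)), MemLp (f t) 2 (volume.restrict Ω) := by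
  have hm := hf.1
  rw [restrict_cyl] at hm
  have h1 := hf.integrable_norm_pow (by norm_num)
  rw [restrict_cyl] at h1
  filter_upwards [h1.prod_right_ae, hm.prodMk_left] with t h2 h3
  exact (memLp_two_iff_integrable_sq_norm h3).2 (by simpa using h2)

lemma shift_preimage_subset (hh : 0 < h) (hτ : τ + h ≤ S) :
    cyl Ω τ ⊆ (fun z : ℝ × Space3 => (h + z.1, z.2)) ⁻¹' cyl Ω S := by
  rintro ⟨t, x⟩ ⟨ht, hx⟩
  exact ⟨⟨by simp at ht ⊢; linarith [ht.1], by simp at ht ⊢; linarith [ht.2]⟩, hx⟩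

lemma ae_shift (hΩ : MeasurableSet Ω) (hh : 0 < h) (hτ : τ + h ≤ S) {p : ℝ → Space3 → Prop}
    (hp : ∀ᵐ z ∂((volume : Measure (ℝ × Space3)).restrict (cyl Ω S)), p z.1 z.2) :
    ∀ᵐ z ∂((volume : Measure (ℝ × Space3)).restrict (cyl Ω τ)), p (h + z.1) z.2 := by
  have h1 := ((measurePreserving_shift h).restrict_preimage
    (measurableSet_cyl (S := S) hΩ)).quasiMeasurePreserving.ae hp
  exact ae_restrict_of_ae_restrict_of_subset (shift_preimage_subset hh hτ) h1

lemma memLp_shift {V : Type*} [NormedAddCommGroup V] (hΩ : MeasurableSet Ω) (hh : 0 < h)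
    (hτ : τ + h ≤ S) {f : ℝ → Space3 → V} {p : ℝ≥0∞}
    (hf : MemLp (fun z : ℝ × Space3 => f z.1 z.2) p (volume.restrict (cyl Ω S))) :
    MemLp (fun z : ℝ × Space3 => f (h + z.1) z.2) p (volume.restrict (cyl Ω τ)) :=
  (hf.comp_measurePreserving ((measurePreserving_shift h).restrict_preimage
    (measurableSet_cyl (S := S) hΩ))).mono_measure
      (Measure.restrict_mono (shift_preimage_subset hh hτ) le_rfl)

variable {Jx W : ℝ × Space3 → Space3}

lemma integrable_inner_of_memLp {α : Type*} [MeasurableSpace α] {μ : Measure α} {f g : α → Space3}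
    (hf : MemLp f 2 μ) (hg : MemLp g 2 μ) : Integrable (fun x => inner ℝ (f x) (g x)) μ := by
  have h := (L2.integrable_inner (𝕜 := ℝ) (hf.toLp f) (hg.toLp g))
  refine h.congr ?_
  filter_upwards [hf.coeFn_toLp, hg.coeFn_toLp] with x h1 h2
  rw [h1, h2]

/-- Integrability needed for Fubini in `integral_inner_translate`. The shear in time preserves the
product measure, which gives measurability, and each slice in `σ` has `L¹` norm at most `∫ ‖Jx‖² + ∫
‖W‖²`. -/
lemma integrable_shear_inner (hJ : MemLp Jx 2 volume) (hW : MemLp W 2 volume) (h : ℝ) :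
    Integrable (fun p : ℝ × (ℝ × Space3) => inner ℝ (Jx (p.1 + p.2.1, p.2.2)) (W p.2))
      ((volume.restrict (Ioc 0 h)).prod volume) := by
  have hmp : MeasurePreserving (fun p : ℝ × (ℝ × Space3) => (p.1, (p.1 + p.2.1, p.2.2)))
      ((volume.restrict (Ioc 0 h)).prod volume) ((volume.restrict (Ioc 0 h)).prod volume) := by
    refine (MeasurePreserving.id _).skew_product (g := fun (σ : ℝ) (z : ℝ × Space3) => (σ + z.1, z.2))
      (by fun_prop) (Eventually.of_forall fun σ => ?_)
    exact (measurePreserving_shift σ).map_eq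
  have hJm : AEStronglyMeasurable (fun p : ℝ × (ℝ × Space3) => Jx (p.1 + p.2.1, p.2.2))
      ((volume.restrict (Ioc 0 h)).prod volume) :=
    (hJ.1.comp_quasiMeasurePreserving
      (Measure.quasiMeasurePreserving_snd.comp hmp.quasiMeasurePreserving) :)
  have hm := hJm.inner (𝕜 := ℝ) (hW.1.comp_snd (μ := volume.restrict (Ioc 0 h)))
  rw [integrable_prod_iff hm]
  have hsl : ∀ σ : ℝ, MemLp (fun z : ℝ × Space3 => Jx (σ + z.1, z.2)) 2 volume := fun σ =>
    hJ.comp_measurePreserving (measurePreserving_shift σ)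
  refine ⟨Eventually.of_forall fun σ => integrable_inner_of_memLp (hsl σ) hW, ?_⟩
  have : IsFiniteMeasure ((volume : Measure ℝ).restrict (Ioc 0 h)) := ⟨by simp⟩
  refine Integrable.of_bound (C := (∫ z, ‖Jx z‖ ^ 2) + ∫ z, ‖W z‖ ^ 2)
    hm.norm.integral_prod_right' (Eventually.of_forall fun σ => ?_)
  have i1 : Integrable fun z : ℝ × Space3 => ‖Jx (σ + z.1, z.2)‖ ^ 2 := by
    simpa using (hsl σ).integrable_norm_pow (by norm_num)
  have i2 : Integrable fun z : ℝ × Space3 => ‖W z‖ ^ 2 := by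
    simpa using hW.integrable_norm_pow (by norm_num)
  have e : ∫ z, ‖Jx z‖ ^ 2 = ∫ z : ℝ × Space3, ‖Jx (σ + z.1, z.2)‖ ^ 2 := by
    have := integral_add_left_eq_self (μ := (volume : Measure (ℝ × Space3)))
      (fun z => ‖Jx z‖ ^ 2) (σ • timeDir)
    simp only [smul_timeDir_add] at this
    exact this.symm
  rw [e, ← integral_add i1 i2, Real.norm_eq_abs, abs_of_nonneg (integral_nonneg fun _ => norm_nonneg _)]
  refine integral_mono (integrable_inner_of_memLp (hsl σ) hW).norm (i1.add i2) fun z => ?_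
  simp only [Real.norm_eq_abs]
  refine (abs_real_inner_le_norm _ _).trans ?_
  nlinarith [sq_nonneg (‖Jx (σ + z.1, z.2)‖ - ‖W z‖), sq_nonneg (‖Jx (σ + z.1, z.2)‖),
    sq_nonneg ‖W z‖]

/-- This identifies pairings in `L²` of space-time with what the weak balance produces at a fixed
`t`, where the average over `σ` is innermost. -/
lemma integral_inner_translate (hJ : MemLp Jx 2 volume) (hW : MemLp W 2 volume) (hh : 0 ≤ h) :
    ∫ σ in (0 : ℝ)..h, inner ℝ (translate (σ • timeDir) (hJ.toLp Jx)) (hW.toLp W)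
      = ∫ t : ℝ, ∫ x : Space3, ∫ σ in (0 : ℝ)..h, inner ℝ (Jx (σ + t, x)) (W (t, x)) := by
  have hint := integrable_shear_inner hJ hW h
  have e1 : ∀ σ : ℝ, inner ℝ (translate (σ • timeDir) (hJ.toLp Jx)) (hW.toLp W)
      = ∫ z : ℝ × Space3, inner ℝ (Jx (σ + z.1, z.2)) (W z) := by
    intro σ
    rw [L2.inner_def]
    refine integral_congr_ae ?_
    filter_upwards [translate_toLp (σ • timeDir) hJ, hW.coeFn_toLp] with z h1 h2
    rw [h1, h2, smul_timeDir_add]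
  simp only [e1]
  simp only [intervalIntegral.integral_of_le hh]
  rw [integral_integral_swap hint]
  exact integral_prod _ hint.integral_prod_right

end SpaceTime

/-! ### Increments of balanced quantities -/

section Balance

open Filter Topology

variable {Ω : Set Space3} {S T τ h : ℝ} {a : ℝ → Space3 → ℝ} {J : ℝ → Space3 → Space3}

lemma setIntegral_cyl_of_integrable {F : ℝ × Space3 → ℝ} (hb : h ≤ S) (h0 : 0 ≤ h)
    (hF : Integrable F (volume.restrict (cyl Ω S))) :
    ∫ z in cyl Ω h, F z = ∫ x in Ω, ∫ s in (0 : ℝ)..h, F (s, x) := by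
  have h1 : Integrable F (volume.restrict (cyl Ω h)) := hF.mono_measure (restrict_cyl_mono hb)
  rw [restrict_cyl] at h1 ⊢
  rw [integral_prod_symm _ h1]
  simp only [intervalIntegral.integral_of_le h0, integral_Ioc_eq_integral_Ioo]

lemma WeakBalance.integral_sub_mul (hb : WeakBalance Ω T a J) (hST : S < T) (hh : 0 ≤ h) {t : ℝ}
    (ht : 0 ≤ t) (hth : h + t ≤ S) {ψ : Space3 → ℝ} {G : Space3 → Space3} (hψ : IsH1 Ω ψ G) :
    ∫ x in Ω, (a (h + t) x - a t x) * ψ x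
      = ∫ x in Ω, ∫ σ in (0 : ℝ)..h, inner ℝ (J (σ + t) x) (G x) := by
  have ht' : t ∈ Ico 0 T := ⟨ht, by linarith⟩
  have hth' : h + t ∈ Ico 0 T := ⟨by linarith, by linarith⟩
  have hF : Integrable (fun z : ℝ × Space3 => inner ℝ (J z.1 z.2) (G z.2))
      (volume.restrict (cyl Ω S)) := by
    refine integrable_inner_of_memLp (hb.2.1 S hST) ?_
    rw [restrict_cyl]
    have : IsFiniteMeasure ((volume : Measure ℝ).restrict (Ioo 0 S)) := ⟨by simp⟩
    exact hψ.2.1.comp_snd _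
  have hF' := hF
  rw [restrict_cyl] at hF'
  have hi : ∀ᵐ x ∂(volume.restrict Ω), ∀ b c : ℝ, 0 ≤ b → b ≤ S → 0 ≤ c → c ≤ S →
      IntervalIntegrable (fun s => inner ℝ (J s x) (G x)) volume b c := by
    filter_upwards [hF'.prod_left_ae] with x hx b c hb hbS hc hcS
    have h0 : IntervalIntegrable (fun s => inner ℝ (J s x) (G x)) volume 0 S := by
      rw [intervalIntegrable_iff_integrableOn_Ioc_of_le (hb.trans hbS),
        integrableOn_Ioc_iff_integrableOn_Ioo]
      exact hx
    refine h0.mono_set ?_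
    rw [uIcc_of_le (hb.trans hbS)]
    exact uIcc_subset_Icc ⟨hb, hbS⟩ ⟨hc, hcS⟩
  have i1 : Integrable (fun x => a (h + t) x * ψ x) (volume.restrict Ω) :=
    (hb.1 _ hth').integrable_mul hψ.1
  have i2 : Integrable (fun x => a t x * ψ x) (volume.restrict Ω) :=
    (hb.1 _ ht').integrable_mul hψ.1
  simp only [sub_mul]
  rw [integral_sub i1 i2, hb.2.2 _ hth' ψ G hψ, hb.2.2 _ ht' ψ G hψ,
    setIntegral_cyl_of_integrable hth (by linarith) hF,
    setIntegral_cyl_of_integrable (by linarith) ht hF, add_sub_add_left_eq_sub]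
  have j : ∀ b, 0 ≤ b → b ≤ S →
      Integrable (fun x => ∫ s in (0 : ℝ)..b, inner ℝ (J s x) (G x)) (volume.restrict Ω) := by
    intro b hb0 hbS
    have h1 : Integrable (fun z : ℝ × Space3 => inner ℝ (J z.1 z.2) (G z.2))
      (volume.restrict (cyl Ω b)) := hF.mono_measure (restrict_cyl_mono hbS)
    rw [restrict_cyl] at h1
    simpa only [intervalIntegral.integral_of_le hb0, integral_Ioc_eq_integral_Ioo]
      using h1.integral_prod_right
  rw [← integral_sub (j _ (by linarith) hth) (j _ ht (by linarith))]
  refine integral_congr_ae ?_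
  filter_upwards [hi] with x hx
  rw [intervalIntegral.integral_interval_sub_left (hx _ _ le_rfl (by linarith) (by linarith) hth)
    (hx _ _ le_rfl (by linarith) ht (by linarith))]
  have := intervalIntegral.integral_comp_add_right (a := 0) (b := h)
    (fun s => inner ℝ (J s x) (G x)) t
  rw [this, zero_add]

lemma memLp_indicator_cyl {V : Type*} [NormedAddCommGroup V] (hΩ : MeasurableSet Ω)
    {f : ℝ → Space3 → V} {p : ℝ≥0∞}
    (hf : MemLp (fun z : ℝ × Space3 => f z.1 z.2) p (volume.restrict (cyl Ω S))) :
    MemLp ((cyl Ω S).indicator fun z => f z.1 z.2) p volume :=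
  (memLp_indicator_iff_restrict (measurableSet_cyl hΩ)).2 hf

/-- Increments of a balanced quantity, tested with a time dependent function. -/
lemma WeakBalance.integral_increment (hb : WeakBalance Ω T a J) (hΩ : MeasurableSet Ω)
    (hST : S < T) (hh : 0 < h) (hτ : τ + h ≤ S)
    (ha : MemLp (fun z : ℝ × Space3 => a z.1 z.2) 2 (volume.restrict (cyl Ω S)))
    {ψ : ℝ → Space3 → ℝ} {G : ℝ → Space3 → Space3}
    (hψ : ∀ᵐ t ∂(volume.restrict (Ioo 0 τ)), IsH1 Ω (ψ t) (G t))
    {χ : ℝ → ℝ} 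
    (hψm : MemLp (fun z : ℝ × Space3 => χ z.1 * ψ z.1 z.2) 2 (volume.restrict (cyl Ω τ)))
    (hGm : MemLp (fun z : ℝ × Space3 => χ z.1 • G z.1 z.2) 2 (volume.restrict (cyl Ω τ))) :
    ∫ z in cyl Ω τ, (a (h + z.1) z.2 - a z.1 z.2) * (χ z.1 * ψ z.1 z.2)
      = ∫ σ in (0 : ℝ)..h, inner ℝ
        (translate (σ • timeDir) ((memLp_indicator_cyl hΩ (hb.2.1 S hST)).toLp _))
        ((memLp_indicator_cyl (f := fun t x => χ t • G t x) hΩ hGm).toLp _) := by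
  rw [integral_inner_translate _ _ hh.le]
  have hi : Integrable (fun z : ℝ × Space3 =>
      (a (h + z.1) z.2 - a z.1 z.2) * (χ z.1 * ψ z.1 z.2)) (volume.restrict (cyl Ω τ)) :=
    ((memLp_shift hΩ hh hτ ha).sub (ha.mono_measure
      (restrict_cyl_mono (by linarith)))).integrable_mul hψm
  rw [restrict_cyl] at hi ⊢
  rw [integral_prod _ hi, ← integral_indicator measurableSet_Ioo]
  refine integral_congr_ae ?_
  filter_upwards [(ae_restrict_iff' measurableSet_Ioo).1 hψ] with t ht
  by_cases htτ : t ∈ Ioo 0 τ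
  · rw [indicator_of_mem htτ]
    -- For fixed `t` the function `χ(t) ψ(t)` is an admissible test function in space, so its
    -- dependence on time needs no regularity.
    have hψt := (ht htτ).const_mul (χ t)
    have := hb.integral_sub_mul hST hh.le htτ.1.le (by linarith [htτ.2]) hψt
    rw [this, ← integral_indicator hΩ]
    congr 1
    funext x
    by_cases hx : x ∈ Ω
    · rw [indicator_of_mem hx]
      refine intervalIntegral.integral_congr fun σ hσ => ?_
      rw [uIcc_of_le hh.le] at hσ
      rw [indicator_of_mem (show (t, x) ∈ cyl Ω τ from ⟨htτ, hx⟩),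
        indicator_of_mem (show (σ + t, x) ∈ cyl Ω S from
          ⟨⟨by simp; linarith [htτ.1, hσ.1], by simp; linarith [htτ.2, hσ.2]⟩, hx⟩)]
    · rw [indicator_of_notMem hx]
      have : (t, x) ∉ cyl Ω τ := fun h => hx h.2
      simp [indicator_of_notMem this]
  · rw [indicator_of_notMem htτ]
    have : ∀ x, (t, x) ∉ cyl Ω τ := fun x h => htτ h.1
    simp [indicator_of_notMem (this _)]

end Balance

/-! ### Limits of time difference quotients -/

section EntropyInequality

open Filter Topology

variable {Ω : Set Space3} {S T τ h : ℝ} {a a' q q' ψ ψ' Y : ℝ → Space3 → ℝ}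
  {J J' Q Q' G G' : ℝ → Space3 → Space3}

/-- `f ∈ L²(0,S;H¹(Ω))` with spatial gradient `G`. -/
structure MemL2H1 (Ω : Set Space3) (S : ℝ) (f : ℝ → Space3 → ℝ) (G : ℝ → Space3 → Space3) :
    Prop where
  memLp : MemLp (fun z : ℝ × Space3 => f z.1 z.2) 2 (volume.restrict (cyl Ω S))
  memLp_grad : MemLp (fun z : ℝ × Space3 => G z.1 z.2) 2 (volume.restrict (cyl Ω S))
  isH1 : ∀ᵐ t ∂(volume.restrict (Ioo 0 S)), IsH1 Ω (f t) (G t)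

lemma IsL2H1.memL2H1 (h : IsL2H1 Ω T q Q) (hS : S < T) : MemL2H1 Ω S q Q := by
  refine ⟨h.1 S hS, h.2.1 S hS, ?_⟩
  filter_upwards [memLp_slice (h.1 S hS), memLp_slice (h.2.1 S hS),
    ae_restrict_of_ae_restrict_of_subset (Ioo_subset_Ioo_right hS.le) h.2.2] with t h1 h2 h3
  exact ⟨h1, h2, h3⟩

lemma MemL2H1.mono {S' : ℝ} (hq : MemL2H1 Ω S q Q) (h : S' ≤ S) : MemL2H1 Ω S' q Q :=
  ⟨hq.memLp.mono_measure (restrict_cyl_mono h), hq.memLp_grad.mono_measure (restrict_cyl_mono h),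
    ae_restrict_of_ae_restrict_of_subset (Ioo_subset_Ioo_right h) hq.isH1⟩

lemma MemL2H1.sub (hq : MemL2H1 Ω S q Q) (hq' : MemL2H1 Ω S q' Q') :
    MemL2H1 Ω S (fun t x => q t x - q' t x) (fun t x => Q t x - Q' t x) := by
  refine ⟨hq.memLp.sub hq'.memLp, hq.memLp_grad.sub hq'.memLp_grad, ?_⟩
  filter_upwards [hq.isH1, hq'.isH1] with t h1 h2
  exact h1.sub h2

lemma ae_shift_time (hh : 0 < h) (hτ : τ + h ≤ S) {p : ℝ → Prop}
    (hp : ∀ᵐ t ∂(volume.restrict (Ioo 0 S)), p t) :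
    ∀ᵐ t ∂(volume.restrict (Ioo 0 τ)), p (h + t) := by
  rw [ae_restrict_iff' measurableSet_Ioo] at hp ⊢
  filter_upwards [(measurePreserving_add_left volume h).quasiMeasurePreserving.ae hp] with t ht ht'
  exact ht ⟨by linarith [ht'.1], by linarith [ht'.2]⟩

lemma MemL2H1.shift (hΩ : MeasurableSet Ω) (hh : 0 < h) (hτ : τ + h ≤ S) (hq : MemL2H1 Ω S q Q) :
    MemL2H1 Ω τ (fun t => q (h + t)) (fun t => Q (h + t)) :=
  ⟨memLp_shift hΩ hh hτ hq.memLp, memLp_shift hΩ hh hτ hq.memLp_grad,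
    ae_shift_time hh hτ hq.isH1⟩

lemma memLp_bounded_smul {V : Type*} [NormedAddCommGroup V] [NormedSpace ℝ V]
    (hΩ : MeasurableSet Ω) {f : ℝ → Space3 → V} {χ : ℝ → ℝ}
    (hχ : Measurable χ) {X : ℝ} (hX : ∀ t ∈ Ioo 0 τ, |χ t| ≤ X) {p : ℝ≥0∞}
    (hf : MemLp (fun z : ℝ × Space3 => f z.1 z.2) p (volume.restrict (cyl Ω τ))) :
    MemLp (fun z : ℝ × Space3 => χ z.1 • f z.1 z.2) p (volume.restrict (cyl Ω τ)) := by
  refine MemLp.of_le_mul (c := X) hf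
    ((hχ.comp measurable_fst).aestronglyMeasurable.smul hf.1) ?_
  filter_upwards [ae_restrict_mem (measurableSet_cyl hΩ)] with z hz
  rw [norm_smul]
  gcongr
  exact hX _ hz.1

/-- By the increment formula the quotient is exactly the pairing of a time average of `J` with `χ
∇ψ`, and the averages converge strongly in `L²`. -/
lemma WeakBalance.tendsto_increment (hb : WeakBalance Ω T a J) (hΩ : MeasurableSet Ω)
    (hST : S < T) (hτ : τ < S)
    (ha : MemLp (fun z : ℝ × Space3 => a z.1 z.2) 2 (volume.restrict (cyl Ω S)))
    (hψ : MemL2H1 Ω S ψ G) {χ : ℝ → ℝ} (hχ : Measurable χ) {X : ℝ}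
    (hX : ∀ t ∈ Ioo 0 τ, |χ t| ≤ X) :
    Tendsto (fun h : ℝ => h⁻¹ * ∫ z in cyl Ω τ,
        (a (h + z.1) z.2 - a z.1 z.2) * (χ z.1 * ψ z.1 z.2)) (𝓝[>] 0)
      (𝓝 (∫ z in cyl Ω τ, χ z.1 * inner ℝ (J z.1 z.2) (G z.1 z.2))) := by
  have hψτ := hψ.mono hτ.le
  have hψm := memLp_bounded_smul hΩ hχ hX hψτ.memLp
  have hGm := memLp_bounded_smul hΩ hχ hX hψτ.memLp_grad
  set jL := (memLp_indicator_cyl hΩ (hb.2.1 S hST)).toLp _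
  set wL := (memLp_indicator_cyl (f := fun t x => χ t • G t x) hΩ hGm).toLp _ with hwL
  have hlim : Tendsto (fun h => inner ℝ (segmentAverage timeDir jL h) wL) (𝓝[>] 0)
      (𝓝 (inner ℝ jL wL)) := (tendsto_segmentAverage timeDir jL).inner tendsto_const_nhds
  have e : inner ℝ jL wL = ∫ z in cyl Ω τ, χ z.1 * inner ℝ (J z.1 z.2) (G z.1 z.2) := by
    rw [L2.inner_def, ← integral_indicator (measurableSet_cyl hΩ)]
    refine integral_congr_ae ?_
    filter_upwards [(memLp_indicator_cyl hΩ (hb.2.1 S hST)).coeFn_toLp,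
      (memLp_indicator_cyl (f := fun t x => χ t • G t x) hΩ hGm).coeFn_toLp] with z h1 h2
    rw [h1, h2]
    by_cases hz : z ∈ cyl Ω τ
    · rw [indicator_of_mem hz, indicator_of_mem hz, indicator_of_mem (cyl_mono hτ.le hz),
        real_inner_smul_right]
    · rw [indicator_of_notMem hz, indicator_of_notMem hz, inner_zero_right]
  rw [e] at hlim
  refine hlim.congr' ?_
  have hev : ∀ᶠ h : ℝ in 𝓝[>] 0, τ + h < S := by
    have : Tendsto (fun h : ℝ => τ + h) (𝓝[>] 0) (𝓝 τ) := by
      have : Continuous fun h : ℝ => τ + h := by fun_prop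
      simpa using (this.tendsto 0).mono_left nhdsWithin_le_nhds
    exact this.eventually (gt_mem_nhds hτ)
  filter_upwards [hev, self_mem_nhdsWithin] with h hhS (hh : 0 < h)
  rw [inner_segmentAverage, hb.integral_increment hΩ hST hh hhS.le ha hψτ.isH1 hψm hGm]

/-- Tested with the increment of `q`, the averages of `J` are paired with `χ (∇q(t + h) - ∇q(t))`,
which tends to zero in `L²`. This removes the quadratic Taylor remainders although neither `a` nor
`q` need have a time derivative. -/
lemma WeakBalance.tendsto_increment_increment (hb : WeakBalance Ω T a J) (hΩ : MeasurableSet Ω)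
    (hST : S < T) (hτ : τ < S)
    (ha : MemLp (fun z : ℝ × Space3 => a z.1 z.2) 2 (volume.restrict (cyl Ω S)))
    (hq : MemL2H1 Ω S q Q) {χ : ℝ → ℝ} (hχ : Measurable χ) {X : ℝ} (hX0 : 0 ≤ X)
    (hX : ∀ t ∈ Ioo 0 τ, |χ t| ≤ X) :
    Tendsto (fun h : ℝ => h⁻¹ * ∫ z in cyl Ω τ,
        (a (h + z.1) z.2 - a z.1 z.2) * (χ z.1 * (q (h + z.1) z.2 - q z.1 z.2))) (𝓝[>] 0)
      (𝓝 0) := by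
  set jL := (memLp_indicator_cyl hΩ (hb.2.1 S hST)).toLp _
  set qL := (memLp_indicator_cyl hΩ hq.memLp_grad).toLp _
  have hlim : Tendsto (fun h : ℝ => ‖segmentAverage timeDir jL h‖ *
      (X * ‖translate (h • timeDir) qL - qL‖)) (𝓝[>] 0) (𝓝 0) := by
    have h1 : Tendsto (fun h : ℝ => translate (h • timeDir) qL) (𝓝[>] 0) (𝓝 qL) := by
      have := ((continuous_translate_smul timeDir qL).tendsto 0).mono_left
        (nhdsWithin_le_nhds (s := Ioi 0))
      simpa [translate_zero] using this
    have h2 := (h1.sub_const qL).norm.const_mul X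
    rw [sub_self, norm_zero, mul_zero] at h2
    simpa using (tendsto_segmentAverage timeDir jL).norm.mul h2
  refine squeeze_zero_norm' ?_ hlim
  have hev : ∀ᶠ h : ℝ in 𝓝[>] 0, τ + h < S := by
    have : Tendsto (fun h : ℝ => τ + h) (𝓝[>] 0) (𝓝 τ) := by
      have : Continuous fun h : ℝ => τ + h := by fun_prop
      simpa using (this.tendsto 0).mono_left nhdsWithin_le_nhds
    exact this.eventually (gt_mem_nhds hτ)
  filter_upwards [hev, self_mem_nhdsWithin] with h hhS (hh : 0 < h)
  have hd := (hq.shift hΩ hh hhS.le).sub (hq.mono hτ.le)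
  have hψm := memLp_bounded_smul (f := fun t x => q (h + t) x - q t x) hΩ hχ hX hd.memLp
  have hGm := memLp_bounded_smul (f := fun t x => Q (h + t) x - Q t x) hΩ hχ hX hd.memLp_grad
  have key := hb.integral_increment hΩ hST hh hhS.le ha hd.isH1 (χ := χ) hψm hGm
  rw [key, ← inner_segmentAverage]
  refine (abs_real_inner_le_norm _ _).trans ?_
  gcongr
  refine Lp.norm_le_mul_norm_of_ae_le_mul ?_
  have hQm := memLp_indicator_cyl hΩ hq.memLp_grad
  filter_upwards [(memLp_indicator_cyl (f := fun t x => χ t • (Q (h + t) x - Q t x)) hΩ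
    hGm).coeFn_toLp, translate_toLp (h • timeDir) hQm, hQm.coeFn_toLp,
    Lp.coeFn_sub (translate (h • timeDir) qL) qL] with z h1 h2 h3 h4
  rw [h1, h4, Pi.sub_apply, h2, h3, smul_timeDir_add]
  by_cases hz : z ∈ cyl Ω τ
  · rw [indicator_of_mem hz, indicator_of_mem (cyl_mono hτ.le hz),
      indicator_of_mem (show (h + z.1, z.2) ∈ cyl Ω S from shift_preimage_subset hh hhS.le hz),
      norm_smul]
    gcongr
    exact hX _ hz.1
  · rw [indicator_of_notMem hz, norm_zero]
    positivity

lemma WeakBalance.sub (hb : WeakBalance Ω T a J) (hb' : WeakBalance Ω T a' J') :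
    WeakBalance Ω T (fun t x => a t x - a' t x) (fun t x => J t x - J' t x) := by
  refine ⟨fun t ht => (hb.1 t ht).sub (hb'.1 t ht), fun S hS => (hb.2.1 S hS).sub (hb'.2.1 S hS),
    fun t ht ψ G hψ => ?_⟩
  have h0 : (0 : ℝ) ∈ Ico 0 T := ⟨le_rfl, ht.1.trans_lt ht.2⟩
  have i1 : ∀ {s}, s ∈ Ico 0 T → Integrable (fun x => a s x * ψ x) (volume.restrict Ω) :=
    fun hs => (hb.1 _ hs).integrable_mul hψ.1
  have i2 : ∀ {s}, s ∈ Ico 0 T → Integrable (fun x => a' s x * ψ x) (volume.restrict Ω) :=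
    fun hs => (hb'.1 _ hs).integrable_mul hψ.1
  have hGt : MemLp (fun z : ℝ × Space3 => G z.2) 2 (volume.restrict (cyl Ω t)) := by
    rw [restrict_cyl]
    have : IsFiniteMeasure ((volume : Measure ℝ).restrict (Ioo 0 t)) := ⟨by simp⟩
    exact hψ.2.1.comp_snd _
  simp only [sub_mul, inner_sub_left]
  rw [integral_sub (i1 ht) (i2 ht), integral_sub (i1 h0) (i2 h0),
    integral_sub (integrable_inner_of_memLp (hb.2.1 t ht.2) hGt)
      (integrable_inner_of_memLp (hb'.2.1 t ht.2) hGt), hb.2.2 t ht ψ G hψ, hb'.2.2 t ht ψ G hψ]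
  ring

lemma tendsto_setIntegral_cyl_zero {F : ℝ × Space3 → ℝ} (hS : 0 < S)
    (hF : Integrable F (volume.restrict (cyl Ω S))) :
    Tendsto (fun h : ℝ => ∫ z in cyl Ω h, F z) (𝓝[>] 0) (𝓝 0) := by
  have hF' := hF
  rw [restrict_cyl] at hF'
  have h1 := hF'.integral_prod_left
  have h2 : IntegrableOn (fun t => ∫ x in Ω, F (t, x)) (Icc 0 S) := by
    rw [integrableOn_Icc_iff_integrableOn_Ioo]; exact h1
  have h3 := intervalIntegral.continuousOn_primitive (μ := volume) h2
  have h4 : Tendsto (fun h : ℝ => ∫ t in Ioc 0 h, ∫ x in Ω, F (t, x)) (𝓝[>] 0) (𝓝 0) := by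
    have := (h3 0 ⟨le_rfl, hS.le⟩).mono_left (nhdsWithin_le_of_mem
      (Icc_mem_nhdsGT hS))
    simpa using this
  refine h4.congr' ?_
  filter_upwards [Ioc_mem_nhdsGT hS] with h hh
  have h5 : Integrable F (volume.restrict (cyl Ω h)) := hF.mono_measure (restrict_cyl_mono hh.2)
  rw [restrict_cyl] at h5 ⊢
  rw [integral_prod _ h5, integral_Ioc_eq_integral_Ioo]

/-- The initial value vanishes, so the balance tested with `q(t)` equals a flux integral over
`(0,t)`, bounded by the sum of squares `∫ ‖J‖² + h ∫ ‖Q(t)‖²`. Integrating over `t` gains the factor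
`h` that compensates `h⁻¹` in the initial layer. -/
lemma WeakBalance.setIntegral_cyl_le (hb : WeakBalance Ω T a J)
    (hh : 0 < h) (hhT : h < T) (h0 : ∀ᵐ x ∂(volume.restrict Ω), a 0 x = 0)
    (ha : MemLp (fun z : ℝ × Space3 => a z.1 z.2) 2 (volume.restrict (cyl Ω h)))
    (hq : MemL2H1 Ω h q Q) :
    ∫ z in cyl Ω h, a z.1 z.2 * q z.1 z.2
      ≤ h * ∫ z in cyl Ω h, (‖J z.1 z.2‖ ^ 2 + ‖Q z.1 z.2‖ ^ 2) := by
  have : IsFiniteMeasure ((volume : Measure ℝ).restrict (Ioo 0 h)) := ⟨by simp⟩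
  have hi : Integrable (fun z : ℝ × Space3 => a z.1 z.2 * q z.1 z.2) (volume.restrict (cyl Ω h)) :=
    ha.integrable_mul hq.memLp
  have hJi : Integrable (fun z : ℝ × Space3 => ‖J z.1 z.2‖ ^ 2) (volume.restrict (cyl Ω h)) := by
    simpa using (hb.2.1 h hhT).integrable_norm_pow (by norm_num)
  have hQi : Integrable (fun z : ℝ × Space3 => ‖Q z.1 z.2‖ ^ 2) (volume.restrict (cyl Ω h)) := by
    simpa using hq.memLp_grad.integrable_norm_pow (by norm_num)
  have hQi' := hQi
  rw [restrict_cyl] at hQi'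
  have hi' := hi
  rw [restrict_cyl] at hi'
  set j := ∫ z in cyl Ω h, ‖J z.1 z.2‖ ^ 2
  have e1 : ∫ z in cyl Ω h, a z.1 z.2 * q z.1 z.2
      = ∫ t in Ioo 0 h, ∫ x in Ω, a t x * q t x := by
    rw [restrict_cyl, integral_prod _ hi']
  have e2 : ∫ z in cyl Ω h, ‖Q z.1 z.2‖ ^ 2 = ∫ t in Ioo 0 h, ∫ x in Ω, ‖Q t x‖ ^ 2 := by
    rw [restrict_cyl, integral_prod _ hQi']
  have hbound : ∀ᵐ t ∂(volume.restrict (Ioo 0 h)),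
      ∫ x in Ω, a t x * q t x ≤ j + h * ∫ x in Ω, ‖Q t x‖ ^ 2 := by
    filter_upwards [hq.isH1, ae_restrict_mem measurableSet_Ioo] with t ht htm
    rw [hb.2.2 t ⟨htm.1.le, htm.2.trans hhT⟩ _ _ ht]
    have z0 : ∫ x in Ω, a 0 x * q t x = 0 := by
      refine integral_eq_zero_of_ae ?_
      filter_upwards [h0] with x hx
      rw [hx, zero_mul, Pi.zero_apply]
    rw [z0, zero_add]
    have hQt : MemLp (fun z : ℝ × Space3 => Q t z.2) 2 (volume.restrict (cyl Ω h)) := by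
      rw [restrict_cyl]
      exact ht.2.1.comp_snd _
    have hQti : Integrable (fun z : ℝ × Space3 => ‖Q t z.2‖ ^ 2) (volume.restrict (cyl Ω h)) := by
      simpa using hQt.integrable_norm_pow (by norm_num)
    have e3 : ∫ z in cyl Ω h, ‖Q t z.2‖ ^ 2 = h * ∫ x in Ω, ‖Q t x‖ ^ 2 := by
      have h6 := hQti
      rw [restrict_cyl] at h6 ⊢
      rw [integral_prod _ h6]
      simp [hh.le]
    have hsum : Integrable (fun z : ℝ × Space3 => ‖J z.1 z.2‖ ^ 2 + ‖Q t z.2‖ ^ 2)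
      (volume.restrict (cyl Ω h)) := hJi.add hQti
    rw [← e3, ← integral_add hJi hQti]
    refine le_trans (integral_mono_ae ((integrable_inner_of_memLp
      (hb.2.1 h hhT) hQt).mono_measure (restrict_cyl_mono htm.2.le))
      (hsum.mono_measure (restrict_cyl_mono htm.2.le)) (Eventually.of_forall fun z => ?_))
      (setIntegral_mono_set hsum (Eventually.of_forall fun z => by positivity)
        (cyl_mono htm.2.le).eventuallyLE)
    refine (real_inner_le_norm _ _).trans ?_
    nlinarith [sq_nonneg (‖J z.1 z.2‖ - ‖Q t z.2‖), sq_nonneg (‖J z.1 z.2‖), sq_nonneg ‖Q t z.2‖]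
  rw [e1, integral_add hJi hQi, e2]
  refine (integral_mono_ae hi'.integral_prod_left ((integrable_const j).add
    (hQi'.integral_prod_left.const_mul h)) hbound).trans ?_
  have e4 : ∫ t in Ioo 0 h, (j + h * ∫ x in Ω, ‖Q t x‖ ^ 2)
      = h * j + h * ∫ t in Ioo 0 h, ∫ x in Ω, ‖Q t x‖ ^ 2 := by
    rw [integral_add (integrable_const j) (hQi'.integral_prod_left.const_mul h),
      integral_const_mul]
    simp [hh.le]
  rw [mul_add, ← e4]
  exact le_rfl

end EntropyInequality

/-! ### The integrated entropy inequality -/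

section EntropyInequality

open Filter Topology

variable {Ω : Set Space3} {S T τ h : ℝ} {a a' q q' ψ ψ' Y : ℝ → Space3 → ℝ}
  {J J' Q Q' G G' : ℝ → Space3 → Space3}

/-- Tangent line of a convex power; it replaces the derivative of the weight in the discrete
integration by parts. -/
lemma add_pow_ge {x h : ℝ} (hx : 0 ≤ x) (hh : 0 ≤ h) (k : ℕ) :
    x ^ (k + 1) + h * ((k + 1) * x ^ k) ≤ (x + h) ^ (k + 1) := by
  induction k with
  | zero => simp
  | succ k ih =>
    have h1 : (x ^ (k + 1) + h * ((k + 1) * x ^ k)) * (x + h) ≤ (x + h) ^ (k + 1) * (x + h) := by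
      gcongr
    have h2 : 0 ≤ h * ((k + 1) * x ^ k) * h := by positivity
    push_cast
    calc _ = (x ^ (k + 1) + h * ((k + 1) * x ^ k)) * (x + h) - h * ((k + 1) * x ^ k) * h := by ring
      _ ≤ (x + h) ^ (k + 1) * (x + h) := by linarith
      _ = _ := by ring

lemma restrict_Ioc_prod (h : ℝ) :
    (volume : Measure (ℝ × Space3)).restrict (Ioc 0 h ×ˢ Ω) = volume.restrict (cyl Ω h) := by
  rw [restrict_cyl, restrict_prod_eq, restrict_Ioo_eq_restrict_Ioc]

lemma setIntegral_cyl_split {F : ℝ × Space3 → ℝ} (hΩ : MeasurableSet Ω) (hh : 0 < h) (hτ : h < τ)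
    (hF : Integrable F (volume.restrict (cyl Ω τ))) :
    ∫ z in cyl Ω τ, F z = (∫ z in cyl Ω h, F z) + ∫ z in Ioo h τ ×ˢ Ω, F z := by
  have e : cyl Ω τ = (Ioc 0 h ×ˢ Ω) ∪ (Ioo h τ ×ˢ Ω) := by
    rw [← union_prod, Ioc_union_Ioo_eq_Ioo hh.le hτ]
    rfl
  have hd : Disjoint (Ioc 0 h ×ˢ Ω) (Ioo h τ ×ˢ Ω) := by
    rw [Set.disjoint_prod]
    exact Or.inl (Set.disjoint_left.2 fun x hx hx' => hx'.1.not_ge hx.2)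
  have hFi : IntegrableOn F (cyl Ω τ) := hF
  rw [e] at hFi ⊢
  rw [setIntegral_union hd (measurableSet_Ioo.prod hΩ) hFi.left_of_union hFi.right_of_union,
    restrict_Ioc_prod]

lemma integrable_bounded_mul (hΩ : MeasurableSet Ω) {F : ℝ → Space3 → ℝ} {χ : ℝ → ℝ}
    (hχ : Measurable χ) {X : ℝ} (hX : ∀ t ∈ Ioo 0 τ, |χ t| ≤ X)
    (hF : Integrable (fun z : ℝ × Space3 => F z.1 z.2) (volume.restrict (cyl Ω τ))) :
    Integrable (fun z : ℝ × Space3 => χ z.1 * F z.1 z.2) (volume.restrict (cyl Ω τ)) := by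
  have := memLp_bounded_smul hΩ hχ hX (memLp_one_iff_integrable.2 hF)
  exact memLp_one_iff_integrable.1 this

/-- Discrete integration by parts in time: shifting by `h` moves the difference onto the weight,
where convexity bounds it below by `h (k + 1)(τ - t)^k`. Since `Y ≥ 0`, the values of `Y` beyond
time `τ` may be dropped; the layer `(0,h)`, not reached by the shift, leaves the last two terms. -/
lemma setIntegral_convex_weight_le (hΩ : MeasurableSet Ω) (hh : 0 < h) (hhτ : h < τ)
    (hτ : τ + h ≤ S) (k : ℕ)
    (hY : Integrable (fun z : ℝ × Space3 => Y z.1 z.2) (volume.restrict (cyl Ω S)))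
    (hY0 : ∀ᵐ z ∂((volume : Measure (ℝ × Space3)).restrict (cyl Ω S)), 0 ≤ Y z.1 z.2) :
    h * (∫ z in cyl Ω τ, ((k + 1) * (τ - z.1) ^ k) * Y z.1 z.2)
      ≤ (∫ z in cyl Ω τ, (τ - z.1) ^ (k + 1) * (Y (h + z.1) z.2 - Y z.1 z.2))
        + (∫ z in cyl Ω h, (τ - z.1) ^ (k + 1) * Y z.1 z.2)
        + h * ∫ z in cyl Ω h, ((k + 1) * (τ - z.1) ^ k) * Y z.1 z.2 := by
  have hτ0 : 0 < τ := hh.trans hhτ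
  have hτS : τ ≤ S := by linarith
  have bX : ∀ m : ℕ, ∀ t ∈ Ioo 0 τ, |(τ - t) ^ m| ≤ τ ^ m := by
    intro m t ht
    rw [abs_pow, abs_of_pos (by linarith [ht.2])]
    exact pow_le_pow_left₀ (by linarith [ht.2]) (by linarith [ht.1]) m
  have hYτ := hY.mono_measure (restrict_cyl_mono (Ω := Ω) hτS)
  have hYs : Integrable (fun z : ℝ × Space3 => Y (h + z.1) z.2) (volume.restrict (cyl Ω τ)) :=
    memLp_one_iff_integrable.1 (memLp_shift hΩ hh hτ (memLp_one_iff_integrable.2 hY))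
  have mm : ∀ m : ℕ, Measurable fun t : ℝ => (τ - t) ^ m := fun m => by fun_prop
  have iA := integrable_bounded_mul hΩ (mm (k + 1)) (bX (k + 1)) hYτ
  have iAs := integrable_bounded_mul (F := fun t x => Y (h + t) x) hΩ (mm (k + 1)) (bX (k + 1)) hYs
  have iB : Integrable (fun z : ℝ × Space3 => ((k + 1) * (τ - z.1) ^ k) * Y z.1 z.2)
      (volume.restrict (cyl Ω τ)) := by
    simpa [mul_assoc] using (integrable_bounded_mul hΩ (mm k) (bX k) hYτ).const_mul ((k : ℝ) + 1)
  have hsub : Ioo h τ ×ˢ Ω ⊆ cyl Ω τ := prod_mono (Ioo_subset_Ioo_left hh.le) subset_rfl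
  -- shift of the positive part
  have hshift : ∫ z in Ioo h τ ×ˢ Ω, (τ - (z.1 - h)) ^ (k + 1) * Y z.1 z.2
      ≤ ∫ z in cyl Ω τ, (τ - z.1) ^ (k + 1) * Y (h + z.1) z.2 := by
    have hemb : MeasurableEmbedding (fun z : ℝ × Space3 => (h + z.1, z.2)) := by
      have := measurableEmbedding_addLeft (h • timeDir)
      simpa only [smul_timeDir_add] using this
    have e1 := (measurePreserving_shift h).setIntegral_preimage_emb hemb
      (fun z => (τ - (z.1 - h)) ^ (k + 1) * Y z.1 z.2) (Ioo h τ ×ˢ Ω)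
    rw [← e1]
    simp only [add_sub_cancel_left]
    refine setIntegral_mono_set iAs ?_ ?_
    · filter_upwards [ae_shift (p := fun t x => 0 ≤ Y t x) hΩ hh hτ hY0,
        ae_restrict_mem (measurableSet_cyl hΩ)] with z hz hzm
      have : 0 ≤ τ - z.1 := by linarith [hzm.1.2]
      simp only [Pi.zero_apply]
      positivity
    · have hpre : (fun z : ℝ × Space3 => (h + z.1, z.2)) ⁻¹' (Ioo h τ ×ˢ Ω) ⊆ cyl Ω τ := by
        rintro ⟨t, x⟩ ⟨ht, hx⟩
        simp only [mem_Ioo] at ht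
        exact ⟨⟨by linarith [ht.1], by linarith [ht.2]⟩, hx⟩
      exact hpre.eventuallyLE
  have hconv : (∫ z in Ioo h τ ×ˢ Ω, (τ - z.1) ^ (k + 1) * Y z.1 z.2)
      + h * (∫ z in Ioo h τ ×ˢ Ω, ((k + 1) * (τ - z.1) ^ k) * Y z.1 z.2)
      ≤ ∫ z in Ioo h τ ×ˢ Ω, (τ - (z.1 - h)) ^ (k + 1) * Y z.1 z.2 := by
    have j1 := iA.mono_measure (Measure.restrict_mono hsub le_rfl)
    have j2 := iB.mono_measure (Measure.restrict_mono hsub le_rfl)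
    rw [← integral_const_mul, ← integral_add j1 (j2.const_mul h)]
    refine integral_mono_ae (j1.add (j2.const_mul h)) ?_ ?_
    · have b2 : ∀ t ∈ Ioo 0 τ, |(τ - (t - h)) ^ (k + 1)| ≤ (τ + h) ^ (k + 1) := by
        intro t ht
        rw [abs_pow, abs_of_pos (by linarith [ht.2])]
        exact pow_le_pow_left₀ (by linarith [ht.2]) (by linarith [ht.1]) _
      exact (integrable_bounded_mul hΩ (by fun_prop) b2 hYτ).mono_measure
        (Measure.restrict_mono hsub le_rfl)
    · filter_upwards [ae_restrict_of_ae_restrict_of_subset (hsub.trans (cyl_mono hτS)) hY0,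
        ae_restrict_mem (measurableSet_Ioo.prod hΩ)] with z hz hzm
      have h1 := add_pow_ge (x := τ - z.1) (by linarith [hzm.1.2]) hh.le k
      have h2 : (τ - z.1 + h) = τ - (z.1 - h) := by ring
      rw [h2] at h1
      calc _ = ((τ - z.1) ^ (k + 1) + h * ((k + 1) * (τ - z.1) ^ k)) * Y z.1 z.2 := by
            ring
        _ ≤ _ := by gcongr
  have e2 := setIntegral_cyl_split hΩ hh hhτ iA
  have e3 := setIntegral_cyl_split hΩ hh hhτ iB
  have e4 : ∫ z in cyl Ω τ, (τ - z.1) ^ (k + 1) * (Y (h + z.1) z.2 - Y z.1 z.2)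
      = (∫ z in cyl Ω τ, (τ - z.1) ^ (k + 1) * Y (h + z.1) z.2)
        - ∫ z in cyl Ω τ, (τ - z.1) ^ (k + 1) * Y z.1 z.2 := by
    rw [← integral_sub iAs iA]
    simp only [mul_sub]
  rw [e4, e3, e2, mul_add]
  linarith

/-- Entropy inequality: a nonnegative function `Y` of two balanced quantities whose increments are
controlled by a first order Taylor formula satisfies the integrated entropy balance. -/
theorem entropy_inequality (hΩ : MeasurableSet Ω) (hv : volume Ω ≠ ⊤) (hτ0 : 0 < τ) (hτS : τ < S)
    (hST : S < T) (k : ℕ)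
    (hb : WeakBalance Ω T a J) (hb' : WeakBalance Ω T a' J')
    (ha : MemLp (fun z : ℝ × Space3 => a z.1 z.2) 2 (volume.restrict (cyl Ω S)))
    (ha' : MemLp (fun z : ℝ × Space3 => a' z.1 z.2) 2 (volume.restrict (cyl Ω S)))
    (hq : MemL2H1 Ω S q Q) (hq' : MemL2H1 Ω S q' Q')
    (hψ : MemL2H1 Ω S ψ G) (hψ' : MemL2H1 Ω S ψ' G')
    (hY : Integrable (fun z : ℝ × Space3 => Y z.1 z.2) (volume.restrict (cyl Ω S)))
    (hY0 : ∀ᵐ z ∂((volume : Measure (ℝ × Space3)).restrict (cyl Ω S)), 0 ≤ Y z.1 z.2)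
    (h0 : ∀ᵐ x ∂(volume.restrict Ω), a 0 x = a' 0 x) {κ₀ L C : ℝ} (hL : 0 ≤ L)
    (hinit : ∀ᵐ z ∂((volume : Measure (ℝ × Space3)).restrict (cyl Ω S)), Y z.1 z.2
      ≤ κ₀ + L * ((a z.1 z.2 - a' z.1 z.2) * (q z.1 z.2 - q' z.1 z.2)))
    (htaylor : ∀ h > 0, τ + h ≤ S → ∀ᵐ z ∂((volume : Measure (ℝ × Space3)).restrict (cyl Ω τ)),
      Y (h + z.1) z.2 - Y z.1 z.2
        ≤ (a (h + z.1) z.2 - a z.1 z.2) * ψ z.1 z.2 + (a' (h + z.1) z.2 - a' z.1 z.2) * ψ' z.1 z.2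
          + C * ((a (h + z.1) z.2 - a z.1 z.2) * (q (h + z.1) z.2 - q z.1 z.2)
            + (a' (h + z.1) z.2 - a' z.1 z.2) * (q' (h + z.1) z.2 - q' z.1 z.2))) :
    ∫ z in cyl Ω τ, ((k + 1) * (τ - z.1) ^ k) * Y z.1 z.2
      ≤ τ ^ (k + 1) * (κ₀ * volume.real Ω) + ∫ z in cyl Ω τ, (τ - z.1) ^ (k + 1) *
        (inner ℝ (J z.1 z.2) (G z.1 z.2) + inner ℝ (J' z.1 z.2) (G' z.1 z.2)) := by
  have bX : ∀ t ∈ Ioo 0 τ, |(τ - t) ^ (k + 1)| ≤ τ ^ (k + 1) := by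
    intro t ht
    rw [abs_pow, abs_of_pos (by linarith [ht.2])]
    exact pow_le_pow_left₀ (by linarith [ht.2]) (by linarith [ht.1]) _
  have mm : ∀ m : ℕ, Measurable fun t : ℝ => (τ - t) ^ m := fun m => by fun_prop
  have hX0 : 0 ≤ τ ^ (k + 1) := by positivity
  set χ : ℝ → ℝ := fun t => (τ - t) ^ (k + 1) with hχ
  have l1 := hb.tendsto_increment hΩ hST hτS ha hψ (mm (k + 1)) bX
  have l2 := hb'.tendsto_increment hΩ hST hτS ha' hψ' (mm (k + 1)) bX
  have l3 := hb.tendsto_increment_increment hΩ hST hτS ha hq (mm (k + 1)) hX0 bX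
  have l4 := hb'.tendsto_increment_increment hΩ hST hτS ha' hq' (mm (k + 1)) hX0 bX
  have hS : 0 < S := hτ0.trans hτS
  have hdJ := hb.sub hb'
  have hdq := hq.sub hq'
  have hE : Integrable (fun z : ℝ × Space3 => ‖J z.1 z.2 - J' z.1 z.2‖ ^ 2
      + ‖Q z.1 z.2 - Q' z.1 z.2‖ ^ 2) (volume.restrict (cyl Ω S)) := by
    refine Integrable.add ?_ ?_
    · simpa using (hdJ.2.1 S hST).integrable_norm_pow (by norm_num)
    · simpa using hdq.memLp_grad.integrable_norm_pow (by norm_num)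
  have l5 := tendsto_setIntegral_cyl_zero hS hE
  have hBi : Integrable (fun z : ℝ × Space3 => ((k + 1) * (τ - z.1) ^ k) * Y z.1 z.2)
      (volume.restrict (cyl Ω τ)) := by
    have bX' : ∀ t ∈ Ioo 0 τ, |(τ - t) ^ k| ≤ τ ^ k := by
      intro t ht
      rw [abs_pow, abs_of_pos (by linarith [ht.2])]
      exact pow_le_pow_left₀ (by linarith [ht.2]) (by linarith [ht.1]) _
    simpa [mul_assoc] using (integrable_bounded_mul hΩ (mm k) bX'
      (hY.mono_measure (restrict_cyl_mono hτS.le))).const_mul ((k : ℝ) + 1)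
  have l6 := tendsto_setIntegral_cyl_zero hτ0 hBi
  -- Both `C` and `L` multiply quantities that vanish with `h`, so they may blow up in the
  -- regularization parameter; only `κ₀` survives from the initial layer.
  have hlim := ((l1.add l2).add ((l3.add l4).const_mul C)).add
    (((l5.const_mul L).const_add (κ₀ * volume.real Ω)).const_mul (τ ^ (k + 1)) |>.add l6)
  have hGi : ∀ {j g : ℝ → Space3 → Space3},
      MemLp (fun z : ℝ × Space3 => j z.1 z.2) 2 (volume.restrict (cyl Ω S)) →
      MemLp (fun z : ℝ × Space3 => g z.1 z.2) 2 (volume.restrict (cyl Ω S)) →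
      Integrable (fun z : ℝ × Space3 => χ z.1 * inner ℝ (j z.1 z.2) (g z.1 z.2))
        (volume.restrict (cyl Ω τ)) := fun {j g} hj hg =>
    integrable_bounded_mul (F := fun t x => inner ℝ (j t x) (g t x)) hΩ (mm (k + 1)) bX
      ((integrable_inner_of_memLp hj hg).mono_measure (restrict_cyl_mono hτS.le))
  have elim : (∫ z in cyl Ω τ, χ z.1 * inner ℝ (J z.1 z.2) (G z.1 z.2))
      + (∫ z in cyl Ω τ, χ z.1 * inner ℝ (J' z.1 z.2) (G' z.1 z.2)) + C * (0 + 0)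
      + (τ ^ (k + 1) * (κ₀ * volume.real Ω + L * 0) + 0)
      = τ ^ (k + 1) * (κ₀ * volume.real Ω) + ∫ z in cyl Ω τ, (τ - z.1) ^ (k + 1) *
        (inner ℝ (J z.1 z.2) (G z.1 z.2) + inner ℝ (J' z.1 z.2) (G' z.1 z.2)) := by
    simp only [mul_add (_ ^ _)]
    rw [integral_add (hGi (hb.2.1 S hST) hψ.memLp_grad) (hGi (hb'.2.1 S hST) hψ'.memLp_grad)]
    ring
  rw [← elim]
  refine ge_of_tendsto hlim ?_
  have hev : ∀ᶠ h : ℝ in 𝓝[>] 0, h < τ ∧ τ + h < S := by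
    have h1 : ∀ᶠ h : ℝ in 𝓝[>] 0, h < min τ (S - τ) :=
      (nhdsWithin_le_nhds) (gt_mem_nhds (lt_min hτ0 (by linarith)))
    filter_upwards [h1] with h hh
    have a1 := hh.trans_le (min_le_left _ _)
    have a2 := hh.trans_le (min_le_right _ _)
    exact ⟨a1, by linarith⟩
  filter_upwards [hev, self_mem_nhdsWithin] with h ⟨hhτ, hhS⟩ (hh : 0 < h)
  have hconv := setIntegral_convex_weight_le hΩ hh hhτ hhS.le k hY hY0
  -- the initial layer
  have hlayer : ∫ z in cyl Ω h, (τ - z.1) ^ (k + 1) * Y z.1 z.2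
      ≤ h * (τ ^ (k + 1) * (κ₀ * volume.real Ω + L * ∫ z in cyl Ω h,
        (‖J z.1 z.2 - J' z.1 z.2‖ ^ 2 + ‖Q z.1 z.2 - Q' z.1 z.2‖ ^ 2))) := by
    have hhS' : h ≤ S := by linarith
    have hda : MemLp (fun z : ℝ × Space3 => a z.1 z.2 - a' z.1 z.2) 2 (volume.restrict (cyl Ω h)) :=
      (ha.sub ha').mono_measure (restrict_cyl_mono hhS')
    have hle := hdJ.setIntegral_cyl_le hh (by linarith)
      (by filter_upwards [h0] with x hx; rw [hx, sub_self]) hda (hdq.mono hhS')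
    have hfin : IsFiniteMeasure ((volume : Measure (ℝ × Space3)).restrict (cyl Ω h)) := by
      rw [restrict_cyl]
      have : IsFiniteMeasure ((volume : Measure ℝ).restrict (Ioo 0 h)) := ⟨by simp⟩
      have : IsFiniteMeasure (volume.restrict Ω) := ⟨by simpa using hv.lt_top⟩
      infer_instance
    have hvol : ((volume : Measure (ℝ × Space3)).restrict (cyl Ω h)).real univ
        = h * volume.real Ω := by
      rw [restrict_cyl, ← univ_prod_univ, measureReal_prod_prod]
      simp [hh.le]
    have ip : Integrable (fun z : ℝ × Space3 => (a z.1 z.2 - a' z.1 z.2) * (q z.1 z.2 - q' z.1 z.2))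
        (volume.restrict (cyl Ω h)) :=
      hda.integrable_mul (hdq.mono hhS').memLp
    calc _ ≤ ∫ z in cyl Ω h, τ ^ (k + 1) *
          (κ₀ + L * ((a z.1 z.2 - a' z.1 z.2) * (q z.1 z.2 - q' z.1 z.2))) := by
          refine integral_mono_ae ?_ (((integrable_const _).add (ip.const_mul L)).const_mul _) ?_
          · exact (integrable_bounded_mul hΩ (mm (k + 1)) bX (hY.mono_measure
              (restrict_cyl_mono hτS.le))).mono_measure (restrict_cyl_mono hhτ.le)
          · filter_upwards [ae_restrict_of_ae_restrict_of_subset (cyl_mono hhS') hY0,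
              ae_restrict_of_ae_restrict_of_subset (cyl_mono hhS') hinit,
              ae_restrict_mem (measurableSet_cyl hΩ)] with z h1 h2 h3
            have h4 : 0 ≤ τ - z.1 := by linarith [h3.1.2]
            have h5 := (le_abs_self _).trans (bX z.1 ⟨h3.1.1, h3.1.2.trans hhτ⟩)
            exact mul_le_mul h5 h2 h1 hX0
      _ = τ ^ (k + 1) * (κ₀ * (h * volume.real Ω) + L * ∫ z in cyl Ω h,
          (a z.1 z.2 - a' z.1 z.2) * (q z.1 z.2 - q' z.1 z.2)) := by
          rw [integral_const_mul, integral_add (integrable_const _) (ip.const_mul L),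
            integral_const, integral_const_mul, hvol, smul_eq_mul]
          ring
      _ ≤ τ ^ (k + 1) * (κ₀ * (h * volume.real Ω) + L * (h * ∫ z in cyl Ω h,
          (‖J z.1 z.2 - J' z.1 z.2‖ ^ 2 + ‖Q z.1 z.2 - Q' z.1 z.2‖ ^ 2))) := by
          gcongr
      _ = _ := by ring
  -- the increments
  have hsτ : ∀ {f : ℝ → Space3 → ℝ},
      MemLp (fun z : ℝ × Space3 => f z.1 z.2) 2 (volume.restrict (cyl Ω S)) →
      MemLp (fun z : ℝ × Space3 => f (h + z.1) z.2 - f z.1 z.2) 2 (volume.restrict (cyl Ω τ)) :=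
    fun hf => (memLp_shift hΩ hh hhS.le hf).sub (hf.mono_measure (restrict_cyl_mono hτS.le))
  have hprod : ∀ {f g : ℝ → Space3 → ℝ},
      MemLp (fun z : ℝ × Space3 => f z.1 z.2) 2 (volume.restrict (cyl Ω τ)) →
      MemLp (fun z : ℝ × Space3 => g z.1 z.2) 2 (volume.restrict (cyl Ω τ)) →
      Integrable (fun z : ℝ × Space3 => f z.1 z.2 * (χ z.1 * g z.1 z.2))
        (volume.restrict (cyl Ω τ)) := fun hf hg =>
    hf.integrable_mul (memLp_bounded_smul hΩ (mm (k + 1)) bX hg)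
  have p1 := hprod (f := fun t x => a (h + t) x - a t x) (hsτ ha) (hψ.mono hτS.le).memLp
  have p2 := hprod (f := fun t x => a' (h + t) x - a' t x) (hsτ ha') (hψ'.mono hτS.le).memLp
  have p3 := hprod (f := fun t x => a (h + t) x - a t x) (g := fun t x => q (h + t) x - q t x)
    (hsτ ha) (hsτ hq.memLp)
  have p4 := hprod (f := fun t x => a' (h + t) x - a' t x) (g := fun t x => q' (h + t) x - q' t x)
    (hsτ ha') (hsτ hq'.memLp)
  have hinc : ∫ z in cyl Ω τ, (τ - z.1) ^ (k + 1) * (Y (h + z.1) z.2 - Y z.1 z.2)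
      ≤ (∫ z in cyl Ω τ, (a (h + z.1) z.2 - a z.1 z.2) * (χ z.1 * ψ z.1 z.2))
        + (∫ z in cyl Ω τ, (a' (h + z.1) z.2 - a' z.1 z.2) * (χ z.1 * ψ' z.1 z.2))
        + C * ((∫ z in cyl Ω τ,
            (a (h + z.1) z.2 - a z.1 z.2) * (χ z.1 * (q (h + z.1) z.2 - q z.1 z.2)))
          + ∫ z in cyl Ω τ,
            (a' (h + z.1) z.2 - a' z.1 z.2) * (χ z.1 * (q' (h + z.1) z.2 - q' z.1 z.2))) := by
    have p12 : Integrable (fun z : ℝ × Space3 =>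
        (a (h + z.1) z.2 - a z.1 z.2) * (χ z.1 * ψ z.1 z.2)
          + (a' (h + z.1) z.2 - a' z.1 z.2) * (χ z.1 * ψ' z.1 z.2))
        (volume.restrict (cyl Ω τ)) := p1.add p2
    have p34 : Integrable (fun z : ℝ × Space3 =>
        C * ((a (h + z.1) z.2 - a z.1 z.2) * (χ z.1 * (q (h + z.1) z.2 - q z.1 z.2))
          + (a' (h + z.1) z.2 - a' z.1 z.2) * (χ z.1 * (q' (h + z.1) z.2 - q' z.1 z.2))))
        (volume.restrict (cyl Ω τ)) := (p3.add p4).const_mul C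
    rw [← integral_add p1 p2, ← integral_add p3 p4, ← integral_const_mul, ← integral_add p12 p34]
    refine integral_mono_ae ?_ (p12.add p34) ?_
    · refine integrable_bounded_mul (F := fun t x => Y (h + t) x - Y t x) hΩ (mm (k + 1)) bX ?_
      exact (memLp_one_iff_integrable.1 (memLp_shift hΩ hh hhS.le
        (memLp_one_iff_integrable.2 hY))).sub (hY.mono_measure (restrict_cyl_mono hτS.le))
    · filter_upwards [htaylor h hh hhS.le, ae_restrict_mem (measurableSet_cyl hΩ)] with z hz hzm
      have h4 : 0 ≤ (τ - z.1) ^ (k + 1) := pow_nonneg (by linarith [hzm.1.2]) _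
      refine (mul_le_mul_of_nonneg_left hz h4).trans_eq ?_
      simp only [χ]
      ring
  have hinv : h⁻¹ * h = 1 := inv_mul_cancel₀ hh.ne'
  have hfinal := mul_le_mul_of_nonneg_left (hconv.trans (add_le_add (add_le_add hinc hlayer) le_rfl))
    (inv_nonneg.2 hh.le)
  rw [inv_mul_cancel_left₀ hh.ne'] at hfinal
  refine hfinal.trans_eq ?_
  rw [mul_add, mul_add, inv_mul_cancel_left₀ hh.ne', inv_mul_cancel_left₀ hh.ne']
  ring

end EntropyInequality

/-! ### Common constants for finite families -/

section Bounds

variable {ι : Type*} [Fintype ι]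

lemma exists_pos_forall_le {f : ι → ℝ} (hf : ∀ i, 0 < f i) : ∃ c > 0, ∀ i, c ≤ f i := by
  have h0 : ∀ i, 0 < (f i)⁻¹ := fun i => inv_pos.2 (hf i)
  have hs : 0 ≤ ∑ i, (f i)⁻¹ := Finset.sum_nonneg fun i _ => (h0 i).le
  refine ⟨(∑ i, (f i)⁻¹ + 1)⁻¹, by positivity, fun i => ?_⟩
  rw [inv_le_comm₀ (by positivity) (hf i)]
  have := Finset.single_le_sum (f := fun i => (f i)⁻¹) (fun j _ => (h0 j).le) (Finset.mem_univ i)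
  linarith

lemma exists_pos_forall_ge (f : ι → ℝ) : ∃ C > 0, ∀ i, f i ≤ C := by
  refine ⟨∑ i, |f i| + 1, by positivity, fun i => ?_⟩
  have := Finset.single_le_sum (f := fun i => |f i|) (fun j _ => abs_nonneg _) (Finset.mem_univ i)
  linarith [le_abs_self (f i)]

end Bounds

/-! ### Bounds of the coefficients on bounded sets -/

section Coefficients

variable {n : ℕ} {P : Model n}

/-- Bounds of the interaction coefficients for densities and temperatures in `[0,M]`. -/
structure Model.InteractionBounds (P : Model n) (M b₀ B₀ K : ℝ) : Prop where
  pos : 0 < b₀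
  upper_pos : 0 < B₀
  lip_pos : 0 < K
  lower : ∀ i j, i ≠ j → ∀ r ∈ Icc 0 M, ∀ r' ∈ Icc 0 M, ∀ s ∈ Icc 0 M, b₀ ≤ P.b i j r r' s
  upper : ∀ i j, i ≠ j → ∀ r ∈ Icc 0 M, ∀ r' ∈ Icc 0 M, ∀ s ∈ Icc 0 M, P.b i j r r' s ≤ B₀
  lip : ∀ i j, i ≠ j → ∀ r ∈ Icc 0 M, ∀ r' ∈ Icc 0 M, ∀ s ∈ Icc 0 M,
    ∀ q ∈ Icc 0 M, ∀ q' ∈ Icc 0 M, ∀ p ∈ Icc 0 M,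
      |P.b i j r r' s - P.b i j q q' p| ≤ K * (|r - q| + |r' - q'| + |s - p|)

lemma Model.IsAdmissible.exists_interactionBounds (hP : P.IsAdmissible) {M : ℝ} (hM : 0 ≤ M) :
    ∃ b₀ B₀ K, P.InteractionBounds M b₀ B₀ K := by
  have key : ∀ ij : Fin n × Fin n, ∃ b₀ B₀ K : ℝ, 0 < b₀ ∧ (ij.1 ≠ ij.2 →
      ∀ r ∈ Icc 0 M, ∀ r' ∈ Icc 0 M, ∀ s ∈ Icc 0 M, b₀ ≤ P.b ij.1 ij.2 r r' s
        ∧ P.b ij.1 ij.2 r r' s ≤ B₀ ∧ ∀ q ∈ Icc 0 M, ∀ q' ∈ Icc 0 M, ∀ p ∈ Icc 0 M,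
      |P.b ij.1 ij.2 r r' s - P.b ij.1 ij.2 q q' p| ≤ K * (|r - q| + |r' - q'| + |s - p|)) := by
    rintro ⟨i, j⟩
    by_cases hij : i = j
    -- Nothing is known about the diagonal coefficients; they receive dummy constants so that one
    -- choice covers all pairs.
    · exact ⟨1, 1, 1, one_pos, fun h => absurd hij h⟩
    obtain ⟨K, hK⟩ := hP.b_lipschitz i j hij M
    have hc : IsCompact (Icc 0 M ×ˢ Icc 0 M ×ˢ Icc 0 M : Set (ℝ × ℝ × ℝ)) :=
      isCompact_Icc.prod (isCompact_Icc.prod isCompact_Icc)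
    have hne : (Icc 0 M ×ˢ Icc 0 M ×ˢ Icc 0 M : Set (ℝ × ℝ × ℝ)).Nonempty :=
      ⟨(0, 0, 0), by simp [hM]⟩
    obtain ⟨z0, hz0, hmin⟩ := hc.exists_isMinOn hne hK.continuousOn
    obtain ⟨z1, hz1, hmax⟩ := hc.exists_isMaxOn hne hK.continuousOn
    refine ⟨P.b i j z0.1 z0.2.1 z0.2.2, P.b i j z1.1 z1.2.1 z1.2.2, K,
      hP.b_pos i j hij _ _ _ hz0.1.1 hz0.2.1.1 hz0.2.2.1, fun _ r hr r' hr' s hs => ?_⟩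
    have hz : ((r, r', s) : ℝ × ℝ × ℝ) ∈ (Icc 0 M ×ˢ Icc 0 M ×ˢ Icc 0 M : Set (ℝ × ℝ × ℝ)) :=
      ⟨hr, hr', hs⟩
    refine ⟨hmin hz, hmax hz, fun q hq q' hq' p hp => ?_⟩
    have h := hK.dist_le_mul _ hz ((q, q', p) : ℝ × ℝ × ℝ) ⟨hq, hq', hp⟩
    rw [Real.dist_eq] at h
    refine h.trans ?_
    gcongr
    rw [Prod.dist_eq, Prod.dist_eq, Real.dist_eq, Real.dist_eq, Real.dist_eq]
    refine max_le ?_ (max_le ?_ ?_) <;>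
      linarith [abs_nonneg (r - q), abs_nonneg (r' - q'), abs_nonneg (s - p)]
  choose b₀ B₀ K h0 h using key
  obtain ⟨c, hc, hcl⟩ := exists_pos_forall_le h0
  obtain ⟨B, hB, hBl⟩ := exists_pos_forall_ge B₀
  obtain ⟨L, hL, hLl⟩ := exists_pos_forall_ge K
  refine ⟨c, B, L, hc, hB, hL, fun i j hij r hr r' hr' s hs => ?_,
    fun i j hij r hr r' hr' s hs => ?_, fun i j hij r hr r' hr' s hs q hq q' hq' p hp => ?_⟩
  · exact (hcl (i, j)).trans (h (i, j) hij r hr r' hr' s hs).1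
  · exact (h (i, j) hij r hr r' hr' s hs).2.1.trans (hBl (i, j))
  · refine ((h (i, j) hij r hr r' hr' s hs).2.2 q hq q' hq' p hp).trans ?_
    gcongr
    exact hLl (i, j)

lemma Model.IsAdmissible.exists_conductivity_lipschitz (hP : P.IsAdmissible) (M : ℝ) :
    ∃ K > 0, ∀ (r q : Fin n → ℝ) (s p : ℝ), (∀ i, r i ∈ Icc 0 M) → (∀ i, q i ∈ Icc 0 M) →
      s ∈ Ioc 0 M → p ∈ Ioc 0 M → |P.κ r s - P.κ q p| ≤ K * (∑ i, |r i - q i| + |s - p|) := by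
  obtain ⟨K, hK⟩ := hP.κ_lipschitz M
  refine ⟨K + 1, by positivity, fun r q s p hr hq hs hp => ?_⟩
  have h := hK.dist_le_mul (r, s) ⟨hr, hs⟩ (q, p) ⟨hq, hp⟩
  rw [Real.dist_eq] at h
  refine h.trans ?_
  have hsum : 0 ≤ ∑ i, |r i - q i| := Finset.sum_nonneg fun i _ => abs_nonneg _
  have h1 : dist ((r, s) : (Fin n → ℝ) × ℝ) (q, p) ≤ ∑ i, |r i - q i| + |s - p| := by
    rw [Prod.dist_eq]
    refine max_le ?_ ?_
    · refine (dist_pi_le_iff (by positivity)).2 fun i => ?_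
      have := Finset.single_le_sum (f := fun i => |r i - q i|) (fun j _ => abs_nonneg _)
        (Finset.mem_univ i)
      rw [Real.dist_eq]
      linarith [abs_nonneg (s - p)]
    · rw [Real.dist_eq]
      linarith
  exact mul_le_mul (by linarith) h1 dist_nonneg (by positivity)

end Coefficients

/-! ### Lower bound for the densities -/

section LowerBound

variable {Ω : Set Space3} {S T : ℝ}

/-- The exceptional set need not be measurable in the product, so the iterated statement is
converted through the vanishing of `∫ ‖f - g‖`. -/
lemma ae_eq_cyl_of_ae_ae_eq {V : Type*} [NormedAddCommGroup V] {f g : ℝ → Space3 → V}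
    (hf : AEStronglyMeasurable (fun z : ℝ × Space3 => f z.1 z.2) (volume.restrict (cyl Ω S)))
    (hg : AEStronglyMeasurable (fun z : ℝ × Space3 => g z.1 z.2) (volume.restrict (cyl Ω S)))
    (h : ∀ᵐ t ∂(volume.restrict (Ioo 0 S)), ∀ᵐ x ∂(volume.restrict Ω), f t x = g t x) :
    ∀ᵐ z ∂((volume : Measure (ℝ × Space3)).restrict (cyl Ω S)), f z.1 z.2 = g z.1 z.2 := by
  have hd := (hf.sub hg).enorm
  rw [restrict_cyl] at hd ⊢
  have hz := lintegral_prod _ hd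
  have hz' : ∫⁻ t in Ioo 0 S, ∫⁻ x in Ω, ‖f t x - g t x‖ₑ = 0 := by
    rw [lintegral_congr_ae (g := fun _ => 0), lintegral_zero]
    filter_upwards [h] with t ht
    rw [lintegral_congr_ae (g := fun _ => 0), lintegral_zero]
    filter_upwards [ht] with x hx
    rw [hx, sub_self, enorm_zero]
  have h0 := (lintegral_eq_zero_iff' hd).1 (hz.trans hz')
  filter_upwards [h0] with z hz
  simpa [sub_eq_zero] using hz

lemma ae_cyl_of_ae_ae_le {f : ℝ → Space3 → ℝ} {c : ℝ}
    (hf : AEStronglyMeasurable (fun z : ℝ × Space3 => f z.1 z.2) (volume.restrict (cyl Ω S)))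
    (h : ∀ᵐ t ∂(volume.restrict (Ioo 0 S)), ∀ᵐ x ∂(volume.restrict Ω), c ≤ f t x) :
    ∀ᵐ z ∂((volume : Measure (ℝ × Space3)).restrict (cyl Ω S)), c ≤ f z.1 z.2 := by
  have := ae_eq_cyl_of_ae_ae_eq (f := fun t x => c ⊓ f t x) (g := fun _ _ => c)
    (aestronglyMeasurable_const.inf hf) aestronglyMeasurable_const (by
      filter_upwards [h] with t ht
      filter_upwards [ht] with x hx
      exact inf_eq_left.2 hx)
  filter_upwards [this] with z hz
  exact inf_eq_left.1 hz

lemma MemLpCyl.exists_bound {V : Type*} [NormedAddCommGroup V] {f : ℝ → Space3 → V}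
    (hf : MemLpCyl ⊤ Ω T f) (hS : S < T) : ∃ L : ℝ, 0 ≤ L ∧
      ∀ᵐ z ∂((volume : Measure (ℝ × Space3)).restrict (cyl Ω S)), ‖f z.1 z.2‖ ≤ L := by
  have h := hf S hS
  refine ⟨(eLpNorm (fun z : ℝ × Space3 => f z.1 z.2) ⊤ (volume.restrict (cyl Ω S))).toReal,
    ENNReal.toReal_nonneg, ?_⟩
  filter_upwards [enorm_ae_le_eLpNormEssSup (fun z : ℝ × Space3 => f z.1 z.2)
    (volume.restrict (cyl Ω S))] with z hz
  rw [← eLpNorm_exponent_top] at hz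
  rw [← toReal_enorm]
  exact ENNReal.toReal_mono h.2.ne hz

variable {n : ℕ} {P : Model n} {ρ0 : Fin n → Space3 → ℝ} {θ0 : Space3 → ℝ}
  {ρ : Fin n → ℝ → Space3 → ℝ} {θ : ℝ → Space3 → ℝ} {u : Fin n → ℝ → Space3 → Space3}
  {gρ : Fin n → ℝ → Space3 → Space3} {gθ : ℝ → Space3 → Space3}

/-- The bounded gradient of `log θ` and `θ⁻¹∇θ` are both weak gradients at a.e. time; uniqueness
transfers the bound. -/
lemma IsWeakSolutionWith.exists_logGrad_bound (hΩ : IsOpen Ω)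
    (h : IsWeakSolutionWith P Ω T ρ0 θ0 ρ θ u gρ gθ)
    (hlog : ∃ G : ℝ → Space3 → Space3,
      HasSpaceGrad Ω T (fun t x => Real.log (θ t x)) G ∧ MemLpCyl ⊤ Ω T G) (hS : S < T) :
    ∃ L : ℝ, 0 ≤ L ∧ ∀ᵐ z ∂((volume : Measure (ℝ × Space3)).restrict (cyl Ω S)),
      ‖(θ z.1 z.2)⁻¹ • gθ z.1 z.2‖ ≤ L := by
  obtain ⟨G, hG, hGb⟩ := hlog
  obtain ⟨L, hL, hLb⟩ := hGb.exists_bound hS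
  refine ⟨L, hL, ?_⟩
  have he := ae_eq_cyl_of_ae_ae_eq (S := S) (f := G) (g := fun t x => (θ t x)⁻¹ • gθ t x)
    (hGb S hS).1 (h.log_θ_reg.2.1 S hS).1 (by
      filter_upwards [ae_restrict_of_ae_restrict_of_subset (Ioo_subset_Ioo_right hS.le) hG,
        ae_restrict_of_ae_restrict_of_subset (Ioo_subset_Ioo_right hS.le) h.log_θ_reg.2.2]
        with t h1 h2
      exact h1.unique hΩ h2)
  filter_upwards [he, hLb] with z h1 h2
  rw [← h1]
  exact h2

/-- Every term of the Maxwell-Stefan relation solved for `∇ρᵢ` carries the factor `ρᵢ`: the thermal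
one directly, the friction ones through `bᵢⱼρᵢρⱼ`. This is the hypothesis of the Harnack inequality.
-/
lemma Model.MaxwellStefan.norm_grad_le (hP : P.IsAdmissible) {M b₀ B₀ K L V : ℝ}
    (hb : P.InteractionBounds M b₀ B₀ K) {r : Fin n → ℝ} {s : ℝ} {gr : Fin n → Space3}
    {gs : Space3} {v : Fin n → Space3} (hr : ∀ i, 0 < r i ∧ r i ≤ M) (hs : 0 < s ∧ s ≤ M)
    (hp : P.pressureGrad r s gr gs = 0) (h : P.MaxwellStefan r s gr gs v)
    (hv : ∀ i, ‖v i‖ ≤ V) (hL : ‖s⁻¹ • gs‖ ≤ L) (i : Fin n) :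
    ‖gr i‖ ≤ (L + P.m i * P.ε⁻¹ * (n * (B₀ * M * (2 * V)))) * r i := by
  have hm := hP.m_pos i
  have hε := hP.ε_pos
  have hM : 0 < M := (hr i).1.trans_le (hr i).2
  have e := h.grad_eq hP (fun i => (hr i).1) hs.1 hp i
  have hsum : ‖∑ j ∈ Finset.univ.erase i, (P.b i j (r i) (r j) s * r i * r j) • (v i - v j)‖
      ≤ n * (B₀ * M * (2 * V)) * r i := by
    have hV : 0 ≤ V := (norm_nonneg _).trans (hv i)
    have hB := hb.upper_pos
    calc _ ≤ ∑ j ∈ Finset.univ.erase i,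
          ‖(P.b i j (r i) (r j) s * r i * r j) • (v i - v j)‖ := norm_sum_le _ _
      _ ≤ ∑ j ∈ Finset.univ.erase i, B₀ * r i * M * (2 * V) := by
          refine Finset.sum_le_sum fun j hj => ?_
          have hij : i ≠ j := (Finset.ne_of_mem_erase hj).symm
          have hri := (hr i).1
          have hrj := (hr j).1
          have hbp := hP.b_pos i j hij (r i) (r j) s hri.le hrj.le hs.1.le
          rw [norm_smul, Real.norm_of_nonneg (by positivity)]
          have h1 := hb.upper i j hij (r i) ⟨hri.le, (hr i).2⟩ (r j) ⟨hrj.le, (hr j).2⟩ s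
            ⟨hs.1.le, hs.2⟩
          have h2 : ‖v i - v j‖ ≤ 2 * V := (norm_sub_le _ _).trans (by linarith [hv i, hv j])
          gcongr
          exact (hr j).2
      _ ≤ ∑ j : Fin n, B₀ * r i * M * (2 * V) :=
          Finset.sum_le_sum_of_subset_of_nonneg (Finset.erase_subset _ _) fun j _ _ => by
            have hri := (hr i).1
            positivity
      _ = _ := by simp; ring
  have e2 : gr i = P.m i • ((P.m i)⁻¹ • gr i) := by rw [smul_inv_smul₀ hm.ne']
  rw [e2, e, norm_smul, Real.norm_of_nonneg hm.le]
  have hri := (hr i).1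
  have h1 : ‖(r i / P.m i) • s⁻¹ • gs‖ ≤ r i / P.m i * L := by
    rw [norm_smul, Real.norm_of_nonneg (by positivity)]
    gcongr
  have h2 : ‖P.ε⁻¹ • ∑ j ∈ Finset.univ.erase i,
      (P.b i j (r i) (r j) s * r i * r j) • (v i - v j)‖
      ≤ P.ε⁻¹ * (n * (B₀ * M * (2 * V)) * r i) := by
    rw [norm_smul, Real.norm_of_nonneg (by positivity)]
    gcongr
  calc _ ≤ P.m i * (r i / P.m i * L + P.ε⁻¹ * (n * (B₀ * M * (2 * V)) * r i)) := by
        gcongr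
        refine (norm_sub_le _ _).trans ?_
        rw [norm_neg]
        exact add_le_add h1 h2
    _ = _ := by field_simp

/-- The densities of a solution with bounded velocities and bounded `∇ log θ` are bounded below. -/
theorem IsWeakSolutionWith.exists_density_lower_bound (hP : P.IsAdmissible)
    (hΩ : IsLipschitzDomain Ω) (hS0 : 0 < S) (hST : S < T)
    (h : IsWeakSolutionWith P Ω T ρ0 θ0 ρ θ u gρ gθ) {δ M : ℝ} (hδ : 0 < δ) (hM : 0 < M)
    (hρ : ∀ i, ∀ᵐ z ∂(volume.restrict (cyl Ω T)), 0 < ρ i z.1 z.2 ∧ ρ i z.1 z.2 ≤ M)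
    (hθ : ∀ᵐ z ∂(volume.restrict (cyl Ω T)), δ ≤ θ z.1 z.2 ∧ θ z.1 z.2 ≤ M)
    (hu : ∀ i, MemLpCyl ⊤ Ω T (u i))
    (hlog : ∃ G : ℝ → Space3 → Space3,
      HasSpaceGrad Ω T (fun t x => Real.log (θ t x)) G ∧ MemLpCyl ⊤ Ω T G) :
    ∃ c > 0, ∀ i, ∀ᵐ z ∂(volume.restrict (cyl Ω S)), c ≤ ρ i z.1 z.2 := by
  have hv : volume Ω ≠ ⊤ := hΩ.isBounded.measure_lt_top.ne
  have hv0 : 0 < volume Ω := hΩ.isOpen.measure_pos volume hΩ.isConnected.nonempty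
  have hvr : 0 < volume.real Ω := ENNReal.toReal_pos hv0.ne' hv
  obtain ⟨C, hC, harnack⟩ := hΩ.exists_harnack hv
  obtain ⟨b₀, B₀, K, hb⟩ := hP.exists_interactionBounds hM.le
  obtain ⟨L, hL, hLb⟩ := h.exists_logGrad_bound hΩ.isOpen hlog hST
  choose V₀ hV₀ hV₀b using fun i => (hu i).exists_bound hST
  obtain ⟨V, hV, hVV⟩ := exists_pos_forall_ge V₀
  have hsub := cyl_mono (Ω := Ω) hST.le
  have hpt : ∀ᵐ z ∂((volume : Measure (ℝ × Space3)).restrict (cyl Ω S)), ∀ i,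
      ‖gρ i z.1 z.2‖ ≤ (L + P.m i * P.ε⁻¹ * (n * (B₀ * M * (2 * V)))) * ρ i z.1 z.2 := by
    filter_upwards [hLb, ae_all_iff.2 hV₀b, ae_restrict_of_ae_restrict_of_subset hsub
      h.maxwell_stefan, ae_restrict_of_ae_restrict_of_subset hsub h.momentum,
      ae_restrict_of_ae_restrict_of_subset hsub (ae_all_iff.2 hρ),
      ae_restrict_of_ae_restrict_of_subset hsub hθ] with z h1 h2 h3 h4 h5 h6 i
    exact h3.norm_grad_le hP hb h5 ⟨hδ.trans_le h6.1, h6.2⟩ h4 (fun i => (h2 i).trans (hVV i)) h1 i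
  -- Conservation of mass: the balance tested with the constant `1`.
  have hmean : ∀ i, ∀ t ∈ Ico 0 T, ∫ x in Ω, ρ i t x = ∫ x in Ω, ρ i 0 x := by
    intro i t ht
    simpa using (h.mass i).2.2 t ht _ _ (isH1_const hv 1)
  -- Positivity is known only at almost every time; it is taken at one such time and carried back to
  -- `0` by conservation.
  have hpos : ∀ i, 0 < ∫ x in Ω, ρ i 0 x := by
    intro i
    have h1 := ae_ae_of_ae_cyl (p := fun t x => 0 < ρ i t x ∧ ρ i t x ≤ M) (hρ i)
    have hne : (volume.restrict (Ioo 0 T)) ≠ 0 := by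
      simp [hS0.trans hST]
    have : (ae (volume.restrict (Ioo 0 T))).NeBot := ae_neBot.2 hne
    obtain ⟨t, ht, htm⟩ := (h1.and (ae_restrict_mem measurableSet_Ioo)).exists
    have htI : t ∈ Ico 0 T := ⟨htm.1.le, htm.2⟩
    rw [← hmean i t htI, integral_pos_iff_support_of_nonneg_ae
      (by filter_upwards [ht] with x hx using hx.1.le)
      (((h.mass i).1 t htI).mono_exponent_of_measure_support_ne_top (s := univ) (by simp)
        (by simpa using hv) (by norm_num) |> memLp_one_iff_integrable.1)]
    have : (volume.restrict Ω) (Function.support (ρ i t)) = (volume.restrict Ω) univ := by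
      refine measure_congr ?_
      filter_upwards [ht] with x hx
      exact propext ⟨fun _ => trivial, fun _ => hx.1.ne'⟩
    rw [this]
    simpa using hv0
  obtain ⟨c, hc, hcle⟩ := exists_pos_forall_le (f := fun i =>
    Real.exp (-(2 * C * (L + P.m i * P.ε⁻¹ * (n * (B₀ * M * (2 * V))))))
      * ((∫ y in Ω, ρ i 0 y) / volume.real Ω)) fun i =>
    mul_pos (Real.exp_pos _) (div_pos (hpos i) hvr)
  refine ⟨c, hc, fun i => ae_cyl_of_ae_ae_le ((h.ρ_reg i).1 S hST).1 ?_⟩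
  have hreg := ((h.ρ_reg i).memL2H1 hST).isH1
  have h1 := ae_ae_of_ae_cyl (p := fun t x => 0 < ρ i t x ∧ ρ i t x ≤ M)
    (ae_restrict_of_ae_restrict_of_subset hsub (hρ i))
  have h2 := ae_ae_of_ae_cyl (p := fun t x =>
    ‖gρ i t x‖ ≤ (L + P.m i * P.ε⁻¹ * (n * (B₀ * M * (2 * V)))) * ρ i t x)
    (hpt.mono fun z hz => hz i)
  filter_upwards [hreg, h1, h2, ae_restrict_mem measurableSet_Ioo] with t t1 t2 t3 t4
  have hm := hP.m_pos i
  have hε := hP.ε_pos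
  have hB := hb.upper_pos
  have := harnack (ρ i t) (gρ i t) _ M (by positivity) t1 t2 t3
  rw [hmean i t ⟨t4.1.le, t4.2.trans hST⟩] at this
  filter_upwards [this] with x hx
  exact (hcle i).trans hx

end LowerBound

/-! ### Scalar relative entropies -/

section ScalarEntropies

/-- Relative entropy density of two mass densities. -/
noncomputable def massEntropy (r q : ℝ) : ℝ := r * Real.log r - r * Real.log q - r + q

/-- Relative entropy of two temperatures, per unit heat capacity. -/
noncomputable def heatEntropy (w s : ℝ) : ℝ := w / s - 1 - Real.log w + Real.log s

lemma log_sub_log_le {x y : ℝ} (hx : 0 < x) (hy : 0 < y) : Real.log x - Real.log y ≤ x / y - 1 := by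
  rw [← Real.log_div hx.ne' hy.ne']
  exact Real.log_le_sub_one_of_pos (div_pos hx hy)

/-- The inequality `log t ≤ t - 1` applied to square roots. Compared with its direct use it leaves a
full square, and so gives the quadratic lower bounds of both entropies. -/
lemma log_sub_log_le_sqrt {x y : ℝ} (hx : 0 < x) (hy : 0 < y) :
    Real.log x - Real.log y ≤ 2 * (Real.sqrt x / Real.sqrt y - 1) := by
  have h := log_sub_log_le (Real.sqrt_pos.2 hx) (Real.sqrt_pos.2 hy)
  rw [Real.log_sqrt hx.le, Real.log_sqrt hy.le] at h
  linarith

lemma massEntropy_le {r q : ℝ} (hr : 0 < r) (hq : 0 < q) : massEntropy r q ≤ (r - q) ^ 2 / q := by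
  have h := mul_le_mul_of_nonneg_left (log_sub_log_le hr hq) hr.le
  have e : (r - q) ^ 2 / q = r * (r / q - 1) - r + q := by field_simp; ring
  unfold massEntropy
  linarith

/-- The entropy dominates `(√r - √q)²`, and `(√r + √q)² ≤ 4M` converts this into the squared
difference. -/
lemma massEntropy_ge {r q M : ℝ} (hr : 0 < r) (hq : 0 < q) (hrM : r ≤ M) (hqM : q ≤ M) :
    (r - q) ^ 2 / (4 * M) ≤ massEntropy r q := by
  have h := mul_le_mul_of_nonneg_left (log_sub_log_le_sqrt hq hr) hr.le
  set a := Real.sqrt r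
  set b := Real.sqrt q
  have ha : 0 < a := Real.sqrt_pos.2 hr
  have hb : 0 < b := Real.sqrt_pos.2 hq
  have ear : a ^ 2 = r := Real.sq_sqrt hr.le
  have ebq : b ^ 2 = q := Real.sq_sqrt hq.le
  have e : r * (2 * (b / a - 1)) = 2 * a * b - 2 * r := by
    rw [← ear]; field_simp
  have h1 : (a - b) ^ 2 ≤ massEntropy r q := by
    unfold massEntropy
    nlinarith
  refine le_trans ?_ h1
  rw [div_le_iff₀ (by linarith), ← ear, ← ebq]
  have h2 : (a + b) ^ 2 ≤ 4 * M := by nlinarith [sq_nonneg (a - b)]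
  have h3 : (a ^ 2 - b ^ 2) ^ 2 = (a - b) ^ 2 * (a + b) ^ 2 := by ring
  rw [h3]
  gcongr

lemma massEntropy_nonneg {r q : ℝ} (hr : 0 < r) (hq : 0 < q) : 0 ≤ massEntropy r q :=
  le_trans (by positivity) (massEntropy_ge hr hq (le_max_left r q) (le_max_right r q))

/-- The linear coefficients are the partial derivatives of the entropy at the earlier time. The
factor `η⁻¹` in the remainder is harmless because the time step tends to zero before `η`. -/
lemma massEntropy_taylor {r₀ r₁ q₀ q₁ η c M : ℝ} (hη : 0 < η) (hc : 0 < c) (hr₀ : η ≤ r₀)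
    (hr₁ : η ≤ r₁) (hM : r₁ ≤ M) (hq₀ : c ≤ q₀) (hq₁ : c ≤ q₁) :
    massEntropy r₁ q₁ - massEntropy r₀ q₀
      ≤ (r₁ - r₀) * (Real.log r₀ - Real.log q₀) + (q₁ - q₀) * (1 - r₀ * q₀⁻¹)
        + (η⁻¹ + c⁻¹ + M * (c ^ 2)⁻¹) * ((r₁ - r₀) ^ 2 + (q₁ - q₀) ^ 2) := by
  have p0 : 0 < r₀ := hη.trans_le hr₀
  have p1 : 0 < r₁ := hη.trans_le hr₁
  have k0 : 0 < q₀ := hc.trans_le hq₀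
  have h1 := mul_le_mul_of_nonneg_left (log_sub_log_le p1 p0) p1.le
  have e1 : r₁ * (r₁ / r₀ - 1) = (r₁ - r₀) + r₀⁻¹ * (r₁ - r₀) ^ 2 := by field_simp; ring
  have h1' : r₀⁻¹ * (r₁ - r₀) ^ 2 ≤ η⁻¹ * (r₁ - r₀) ^ 2 := by gcongr
  have h2 := mul_le_mul_of_nonneg_left (neg_le_of_abs_le (abs_log_taylor hc hq₀ hq₁)) p1.le
  have h2' : r₁ * ((c ^ 2)⁻¹ * (q₁ - q₀) ^ 2) ≤ M * ((c ^ 2)⁻¹ * (q₁ - q₀) ^ 2) := by gcongr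
  have h3 : -(q₀⁻¹ * ((r₁ - r₀) * (q₁ - q₀))) ≤ c⁻¹ * ((r₁ - r₀) ^ 2 + (q₁ - q₀) ^ 2) := by
    have i1 : q₀⁻¹ ≤ c⁻¹ := by gcongr
    have i0 : 0 ≤ q₀⁻¹ := by positivity
    have i2 : -((r₁ - r₀) * (q₁ - q₀)) ≤ (r₁ - r₀) ^ 2 + (q₁ - q₀) ^ 2 := by
      nlinarith [sq_nonneg ((r₁ - r₀) + (q₁ - q₀)), sq_nonneg (r₁ - r₀), sq_nonneg (q₁ - q₀)]
    calc _ = q₀⁻¹ * (-((r₁ - r₀) * (q₁ - q₀))) := by ring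
      _ ≤ q₀⁻¹ * ((r₁ - r₀) ^ 2 + (q₁ - q₀) ^ 2) := by gcongr
      _ ≤ _ := by gcongr
  have h4 : 0 ≤ η⁻¹ * (q₁ - q₀) ^ 2 := by positivity
  have h5 : 0 ≤ M * (c ^ 2)⁻¹ * (r₁ - r₀) ^ 2 := by
    have : 0 ≤ M := p1.le.trans hM
    positivity
  unfold massEntropy
  linarith

lemma heatEntropy_le {w s : ℝ} (hw : 0 < w) (hs : 0 < s) :
    heatEntropy w s ≤ (w - s) ^ 2 / (w * s) := by
  have h := log_sub_log_le hs hw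
  have e : (w - s) ^ 2 / (w * s) = w / s - 1 + (s / w - 1) := by field_simp; ring
  unfold heatEntropy
  linarith

lemma heatEntropy_ge {w s M : ℝ} (hw : 0 < w) (hs : 0 < s) (hwM : w ≤ M) (hsM : s ≤ M) :
    (w - s) ^ 2 / (4 * M ^ 2) ≤ heatEntropy w s := by
  have h := log_sub_log_le_sqrt hw hs
  set a := Real.sqrt w
  set b := Real.sqrt s
  have ha : 0 < a := Real.sqrt_pos.2 hw
  have hb : 0 < b := Real.sqrt_pos.2 hs
  have eaw : a ^ 2 = w := Real.sq_sqrt hw.le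
  have ebs : b ^ 2 = s := Real.sq_sqrt hs.le
  have h1 : (a - b) ^ 2 / s ≤ heatEntropy w s := by
    have e : (a - b) ^ 2 / s = w / s - 1 - 2 * (a / b - 1) := by
      rw [← eaw, ← ebs]; field_simp; ring
    unfold heatEntropy
    linarith
  refine le_trans ?_ h1
  have hM : 0 < M := hw.trans_le hwM
  rw [div_le_div_iff₀ (by positivity) hs]
  have h2 : (a + b) ^ 2 ≤ 4 * M := by nlinarith [sq_nonneg (a - b)]
  have h3 : (w - s) ^ 2 = (a - b) ^ 2 * (a + b) ^ 2 := by rw [← eaw, ← ebs]; ring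
  rw [h3]
  calc (a - b) ^ 2 * (a + b) ^ 2 * s ≤ (a - b) ^ 2 * (4 * M) * M := by gcongr
    _ = _ := by ring

lemma heatEntropy_nonneg {w s : ℝ} (hw : 0 < w) (hs : 0 < s) : 0 ≤ heatEntropy w s :=
  le_trans (by positivity) (heatEntropy_ge hw hs (le_max_left w s) (le_max_right w s))

/-- Again the linear coefficients are partial derivatives. The inverse square appears as `s₀⁻¹ *
s₀⁻¹`, the form in which it is later recognized as a product of bounded `H¹` functions. -/
lemma heatEntropy_taylor {w₀ w₁ s₀ s₁ η δ M : ℝ} (hη : 0 < η) (hδ : 0 < δ) (hw₀ : η ≤ w₀)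
    (hw₁ : η ≤ w₁) (hM : w₁ ≤ M) (hs₀ : δ ≤ s₀) (hs₁ : δ ≤ s₁) :
    heatEntropy w₁ s₁ - heatEntropy w₀ s₀
      ≤ (w₁ - w₀) * (s₀⁻¹ - w₀⁻¹) + (s₁ - s₀) * (s₀⁻¹ - w₀ * (s₀⁻¹ * s₀⁻¹))
        + ((η ^ 2)⁻¹ + (δ ^ 2)⁻¹ + M * (δ ^ 3)⁻¹) * ((w₁ - w₀) ^ 2 + (s₁ - s₀) ^ 2) := by
  have p1 : 0 < w₁ := hη.trans_le hw₁
  have k0 : 0 < s₀ := hδ.trans_le hs₀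
  have k1 : 0 < s₁ := hδ.trans_le hs₁
  have h1 := neg_le_of_abs_le (abs_log_taylor hη hw₀ hw₁)
  have h2 := log_sub_log_le k1 k0
  have e2 : s₁ / s₀ - 1 = (s₁ - s₀) * s₀⁻¹ := by field_simp
  have e3 : w₁ / s₁ - w₀ / s₀ = (w₁ - w₀) * s₀⁻¹ - (s₁ - s₀) * (w₀ * (s₀⁻¹ * s₀⁻¹))
      + w₁ * ((s₀ ^ 2 * s₁)⁻¹ * (s₁ - s₀) ^ 2)
      - (s₀ ^ 2)⁻¹ * ((w₁ - w₀) * (s₁ - s₀)) := by field_simp; ring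
  have h4 : w₁ * ((s₀ ^ 2 * s₁)⁻¹ * (s₁ - s₀) ^ 2) ≤ M * ((δ ^ 3)⁻¹ * (s₁ - s₀) ^ 2) := by
    have : δ ^ 3 ≤ s₀ ^ 2 * s₁ := by
      calc δ ^ 3 = δ ^ 2 * δ := by ring
        _ ≤ _ := by gcongr
    have hM0 : 0 ≤ M := p1.le.trans hM
    gcongr
  have h5 : -((s₀ ^ 2)⁻¹ * ((w₁ - w₀) * (s₁ - s₀)))
      ≤ (δ ^ 2)⁻¹ * ((w₁ - w₀) ^ 2 + (s₁ - s₀) ^ 2) := by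
    have i1 : (s₀ ^ 2)⁻¹ ≤ (δ ^ 2)⁻¹ := by gcongr
    have i0 : 0 ≤ (s₀ ^ 2)⁻¹ := by positivity
    have i2 : -((w₁ - w₀) * (s₁ - s₀)) ≤ (w₁ - w₀) ^ 2 + (s₁ - s₀) ^ 2 := by
      nlinarith [sq_nonneg ((w₁ - w₀) + (s₁ - s₀)), sq_nonneg (w₁ - w₀), sq_nonneg (s₁ - s₀)]
    calc _ = (s₀ ^ 2)⁻¹ * (-((w₁ - w₀) * (s₁ - s₀))) := by ring
      _ ≤ (s₀ ^ 2)⁻¹ * ((w₁ - w₀) ^ 2 + (s₁ - s₀) ^ 2) := by gcongr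
      _ ≤ _ := by gcongr
  have h6 : 0 ≤ (η ^ 2)⁻¹ * (s₁ - s₀) ^ 2 := by positivity
  have h7 : 0 ≤ M * (δ ^ 3)⁻¹ * (w₁ - w₀) ^ 2 := by
    have : 0 ≤ M := p1.le.trans hM
    positivity
  unfold heatEntropy
  linarith

end ScalarEntropies

/-! ### Nonlinear functions of `L²(0,S;H¹(Ω))` -/

section Composition

variable {Ω : Set Space3} {S : ℝ} {q q' : ℝ → Space3 → ℝ} {Q Q' : ℝ → Space3 → Space3}

lemma isFiniteMeasure_restrict_cyl (hv : volume Ω ≠ ⊤) :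
    IsFiniteMeasure ((volume : Measure (ℝ × Space3)).restrict (cyl Ω S)) := by
  rw [restrict_cyl]
  have : IsFiniteMeasure ((volume : Measure ℝ).restrict (Ioo 0 S)) := ⟨by simp⟩
  have : IsFiniteMeasure (volume.restrict Ω) := ⟨by simpa using hv.lt_top⟩
  infer_instance

lemma MemL2H1.affine (hv : volume Ω ≠ ⊤) (hq : MemL2H1 Ω S q Q) (a b : ℝ) :
    MemL2H1 Ω S (fun t x => a + b * q t x) (fun t x => b • Q t x) := by
  have := isFiniteMeasure_restrict_cyl (S := S) hv
  refine ⟨(memLp_const a).add (hq.memLp.const_mul b), hq.memLp_grad.const_smul b, ?_⟩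
  filter_upwards [hq.isH1] with t ht
  simpa using (isH1_const hv a).add (ht.const_mul b)

lemma MemL2H1.comp (hΩ : IsOpen Ω) (hv : volume Ω ≠ ⊤) (hq : MemL2H1 Ω S q Q) {A : Set ℝ}
    (hA : ∀ᵐ z ∂((volume : Measure (ℝ × Space3)).restrict (cyl Ω S)), q z.1 z.2 ∈ A)
    {Φ Φ' : ℝ → ℝ} {B C : ℝ}
    (hΦ : ∀ a ∈ A, ∀ b ∈ A, |Φ b - Φ a - Φ' a * (b - a)| ≤ C * (b - a) ^ 2)
    (hB' : ∀ a ∈ A, |Φ' a| ≤ B) (hB : ∀ a ∈ A, |Φ a| ≤ B)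
    (hm : Measurable Φ) (hm' : Measurable Φ') :
    MemL2H1 Ω S (fun t x => Φ (q t x)) (fun t x => Φ' (q t x) • Q t x) := by
  have := isFiniteMeasure_restrict_cyl (S := S) hv
  have hqm := hq.memLp.1.aemeasurable
  refine ⟨?_, ?_, ?_⟩
  · refine MemLp.of_bound (hm.comp_aemeasurable hqm).aestronglyMeasurable B ?_
    filter_upwards [hA] with z hz using hB _ hz
  · refine MemLp.of_le_mul (c := B) hq.memLp_grad
      ((hm'.comp_aemeasurable hqm).aestronglyMeasurable.smul hq.memLp_grad.1) ?_
    filter_upwards [hA] with z hz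
    rw [norm_smul]
    gcongr
    exact hB' _ hz
  · filter_upwards [hq.isH1, ae_ae_of_ae_cyl (p := fun t x => q t x ∈ A) hA] with t h1 h2
    exact h1.comp hΩ hv h2 hΦ hB' hB hm hm'

lemma MemL2H1.mul (hΩ : IsOpen Ω) (hv : volume Ω ≠ ⊤) (hq : MemL2H1 Ω S q Q)
    (hq' : MemL2H1 Ω S q' Q') {B : ℝ}
    (hB : ∀ᵐ z ∂((volume : Measure (ℝ × Space3)).restrict (cyl Ω S)), |q z.1 z.2| ≤ B)
    (hB' : ∀ᵐ z ∂((volume : Measure (ℝ × Space3)).restrict (cyl Ω S)), |q' z.1 z.2| ≤ B) :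
    MemL2H1 Ω S (fun t x => q t x * q' t x) (fun t x => q t x • Q' t x + q' t x • Q t x) := by
  refine ⟨?_, MemLp.add ?_ ?_, ?_⟩
  · refine MemLp.of_le_mul (c := B) hq'.memLp (hq.memLp.1.mul hq'.memLp.1) ?_
    filter_upwards [hB] with z hz
    rw [norm_mul]
    gcongr
    exact hz
  · refine MemLp.of_le_mul (c := B) hq'.memLp_grad (hq.memLp.1.smul hq'.memLp_grad.1) ?_
    filter_upwards [hB] with z hz
    rw [norm_smul]
    gcongr
    exact hz
  · refine MemLp.of_le_mul (c := B) hq.memLp_grad (hq'.memLp.1.smul hq.memLp_grad.1) ?_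
    filter_upwards [hB'] with z hz
    rw [norm_smul]
    gcongr
    exact hz
  · filter_upwards [hq.isH1, hq'.isH1, ae_ae_of_ae_cyl (p := fun t x => |q t x| ≤ B) hB,
      ae_ae_of_ae_cyl (p := fun t x => |q' t x| ≤ B) hB'] with t h1 h2 h3 h4
    exact h1.mul hΩ hv h2 h3 h4

lemma MemL2H1.log (hΩ : IsOpen Ω) (hv : volume Ω ≠ ⊤) (hq : MemL2H1 Ω S q Q) {l M : ℝ}
    (hl : 0 < l) (hA : ∀ᵐ z ∂((volume : Measure (ℝ × Space3)).restrict (cyl Ω S)),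
      l ≤ q z.1 z.2 ∧ q z.1 z.2 ≤ M) :
    MemL2H1 Ω S (fun t x => Real.log (q t x)) (fun t x => (q t x)⁻¹ • Q t x) := by
  refine hq.comp hΩ hv (A := Icc l M) (Φ := Real.log) (Φ' := fun x => x⁻¹)
    (B := l⁻¹ + |Real.log l| + |Real.log M|) (C := (l ^ 2)⁻¹) hA ?_ ?_ ?_
    Real.measurable_log measurable_inv
  · intro a ha b hb
    exact abs_log_taylor hl ha.1 hb.1
  · intro a ha
    have h0 : 0 < a := hl.trans_le ha.1
    rw [abs_of_pos (by positivity)]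
    have : a⁻¹ ≤ l⁻¹ := by gcongr; exact ha.1
    linarith [abs_nonneg (Real.log l), abs_nonneg (Real.log M)]
  · intro a ha
    have h0 : 0 < a := hl.trans_le ha.1
    have h1 := Real.log_le_log hl ha.1
    have h2 := Real.log_le_log h0 ha.2
    have h3 : 0 < l⁻¹ := by positivity
    rw [abs_le]
    constructor <;> linarith [neg_abs_le (Real.log l), le_abs_self (Real.log M),
      abs_nonneg (Real.log l), abs_nonneg (Real.log M)]

lemma MemL2H1.inv (hΩ : IsOpen Ω) (hv : volume Ω ≠ ⊤) (hq : MemL2H1 Ω S q Q) {l : ℝ}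
    (hl : 0 < l) (hA : ∀ᵐ z ∂((volume : Measure (ℝ × Space3)).restrict (cyl Ω S)),
      l ≤ q z.1 z.2) :
    MemL2H1 Ω S (fun t x => (q t x)⁻¹) (fun t x => (-(q t x ^ 2)⁻¹) • Q t x) := by
  refine hq.comp hΩ hv (A := Ici l) (Φ := fun x => x⁻¹) (Φ' := fun x => -(x ^ 2)⁻¹)
    (B := l⁻¹ + (l ^ 2)⁻¹) (C := (l ^ 3)⁻¹) hA ?_ ?_ ?_ measurable_inv (by fun_prop)
  · intro a ha b hb
    have ha0 : 0 < a := hl.trans_le ha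
    have hb0 : 0 < b := hl.trans_le hb
    have e : b⁻¹ - a⁻¹ - -(a ^ 2)⁻¹ * (b - a) = (a ^ 2 * b)⁻¹ * (b - a) ^ 2 := by
      field_simp; ring
    rw [e, abs_of_nonneg (by positivity)]
    have : l ^ 3 ≤ a ^ 2 * b := by
      calc l ^ 3 = l ^ 2 * l := by ring
        _ ≤ _ := by gcongr; exacts [ha, hb]
    gcongr
  · intro a ha
    have h0 : 0 < a := hl.trans_le ha
    rw [abs_neg, abs_of_pos (by positivity)]
    have : (a ^ 2)⁻¹ ≤ (l ^ 2)⁻¹ := by gcongr; exact ha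
    have h3 : 0 < l⁻¹ := by positivity
    linarith
  · intro a ha
    have h0 : 0 < a := hl.trans_le ha
    rw [abs_of_pos (by positivity)]
    have : a⁻¹ ≤ l⁻¹ := by gcongr; exact ha
    have h3 : 0 < (l ^ 2)⁻¹ := by positivity
    linarith

end Composition

/-! ### The friction form -/

section Friction

variable {n : ℕ} {β : Fin n → Fin n → ℝ} {r : Fin n → ℝ} {v : Fin n → Space3}

lemma sum_smul_sub_erase (v : Fin n → Space3) (i : Fin n) (f : Fin n → ℝ) :
    ∑ j ∈ Finset.univ.erase i, f j • (v i - v j) = ∑ j, f j • (v i - v j) := by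
  rw [Finset.sum_erase]
  simp

/-- Symmetrization: exchanging the indices and averaging produces the squares. -/
lemma sum_sum_inner_sub_eq (hβ : ∀ i j, i ≠ j → β i j = β j i) :
    ∑ i, ∑ j, β i j * inner ℝ (v i) (v i - v j) = ∑ i, ∑ j, β i j * ‖v i - v j‖ ^ 2 / 2 := by
  have h1 : ∑ i, ∑ j, β i j * inner ℝ (v i) (v i - v j)
      = ∑ i, ∑ j, β i j * inner ℝ (v j) (v j - v i) := by
    rw [Finset.sum_comm]
    refine Finset.sum_congr rfl fun i _ => Finset.sum_congr rfl fun j _ => ?_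
    by_cases hij : i = j
    · simp [hij]
    · rw [hβ i j hij]
  have h2 : ∑ i, ∑ j, β i j * ‖v i - v j‖ ^ 2
      = ∑ i, ∑ j, β i j * inner ℝ (v i) (v i - v j)
        + ∑ i, ∑ j, β i j * inner ℝ (v j) (v j - v i) := by
    simp only [← Finset.sum_add_distrib]
    refine Finset.sum_congr rfl fun i _ => Finset.sum_congr rfl fun j _ => ?_
    rw [← mul_add, ← real_inner_self_eq_norm_sq, inner_sub_left, inner_sub_right, inner_sub_right,
      inner_sub_right, real_inner_comm (v i) (v j)]
    ring
  simp only [← Finset.sum_div]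
  rw [h2, ← h1]
  ring

/-- A weighted Lagrange identity. It shows that friction controls the velocities only up to their
weighted mean, which is subtracted. -/
lemma sum_sum_mul_sq_eq (r : Fin n → ℝ) (v : Fin n → Space3) :
    ∑ i, ∑ j, r i * r j * ‖v i - v j‖ ^ 2 / 2
      = (∑ i, r i) * (∑ i, r i * ‖v i‖ ^ 2) - ‖∑ i, r i • v i‖ ^ 2 := by
  rw [← sum_sum_inner_sub_eq (β := fun i j => r i * r j) fun i j _ => mul_comm _ _,
    ← real_inner_self_eq_norm_sq, sum_inner]
  simp only [inner_sum, inner_sub_right, real_inner_smul_left, real_inner_smul_right, mul_sub,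
    Finset.sum_sub_distrib, real_inner_self_eq_norm_sq]
  congr 1
  · rw [Finset.sum_mul_sum, Finset.sum_comm]
    refine Finset.sum_congr rfl fun i _ => Finset.sum_congr rfl fun j _ => ?_
    ring
  · refine Finset.sum_congr rfl fun i _ => Finset.sum_congr rfl fun j _ => ?_
    ring

/-- Coercivity of the friction form. -/
lemma friction_ge {b₀ : ℝ} (hb₀ : 0 ≤ b₀) (hβ : ∀ i j, i ≠ j → β i j = β j i)
    (hβr : ∀ i j, i ≠ j → b₀ * (r i * r j) ≤ β i j) (hr : ∀ i, 0 ≤ r i) :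
    b₀ * ((∑ i, r i * ‖v i‖) ^ 2 - ‖∑ i, r i • v i‖ ^ 2)
      ≤ ∑ i, ∑ j, β i j * inner ℝ (v i) (v i - v j) := by
  rw [sum_sum_inner_sub_eq hβ]
  -- Cauchy-Schwarz with the factors `√rᵢ` and `√rᵢ ‖vᵢ‖`.
  have h1 : (∑ i, r i * ‖v i‖) ^ 2 ≤ (∑ i, r i) * (∑ i, r i * ‖v i‖ ^ 2) := by
    refine Finset.sum_sq_le_sum_mul_sum_of_sq_le_mul _ (fun i _ => hr i)
      (fun i _ => mul_nonneg (hr i) (sq_nonneg _)) fun i _ => le_of_eq ?_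
    ring
  calc _ ≤ b₀ * ((∑ i, r i) * (∑ i, r i * ‖v i‖ ^ 2) - ‖∑ i, r i • v i‖ ^ 2) := by gcongr
    _ = b₀ * ∑ i, ∑ j, r i * r j * ‖v i - v j‖ ^ 2 / 2 := by rw [sum_sum_mul_sq_eq]
    _ = ∑ i, ∑ j, b₀ * (r i * r j) * ‖v i - v j‖ ^ 2 / 2 := by
      simp only [Finset.mul_sum]
      refine Finset.sum_congr rfl fun i _ => Finset.sum_congr rfl fun j _ => ?_
      ring
    _ ≤ _ := by
      refine Finset.sum_le_sum fun i _ => Finset.sum_le_sum fun j _ => ?_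
      by_cases hij : i = j
      · simp [hij]
      · have := hβr i j hij
        gcongr

end Friction

/-! ### The entropy production of two states -/

section StatePair

variable {n : ℕ}

/-- Values, gradients and velocities of two solutions at a point of the space-time cylinder; the
second one is bounded, with densities at least `c` and temperature at least `δ`. -/
structure Model.StatePair (P : Model n) (M c δ V L : ℝ) (r q : Fin n → ℝ) (s p : ℝ)
    (gr gq : Fin n → Space3) (gs gp : Space3) (u w : Fin n → Space3) : Prop where
  r_mem : ∀ i, 0 < r i ∧ r i ≤ M
  q_mem : ∀ i, c ≤ q i ∧ q i ≤ M
  s_mem : 0 < s ∧ s ≤ M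
  p_mem : δ ≤ p ∧ p ≤ M
  momentum_r : P.pressureGrad r s gr gs = 0
  momentum_q : P.pressureGrad q p gq gp = 0
  maxwell_stefan_r : P.MaxwellStefan r s gr gs u
  maxwell_stefan_q : P.MaxwellStefan q p gq gp w
  velocity_le : ∀ i, ‖w i‖ ≤ V
  logGrad_le : ‖p⁻¹ • gp‖ ≤ L

/-- The integrand of the relative entropy inequality, with densities and temperature of the first
solution shifted by `η`. -/
noncomputable def Model.entropyProduction (P : Model n) (η : ℝ) (r q : Fin n → ℝ) (s p : ℝ)
    (gr gq : Fin n → Space3) (gs gp : Space3) (u w : Fin n → Space3) : ℝ :=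
  ∑ i, (inner ℝ (r i • u i) ((P.m i)⁻¹ • ((r i + η)⁻¹ • gr i - (q i)⁻¹ • gq i))
      + inner ℝ (q i • w i) ((P.m i)⁻¹ • (((r i + η) * (q i ^ 2)⁻¹) • gq i - (q i)⁻¹ • gr i)))
    + (inner ℝ (P.energyFlux r s gs u) (((s + η) ^ 2)⁻¹ • gs - (p ^ 2)⁻¹ • gp)
      + inner ℝ (P.energyFlux q p gp w)
        ((2 * (s + η) * (p ^ 3)⁻¹) • gp - (p ^ 2)⁻¹ • gp - (p ^ 2)⁻¹ • gs))

variable {P : Model n} {M c δ V L : ℝ} {r q : Fin n → ℝ} {s p : ℝ} {gr gq : Fin n → Space3}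
  {gs gp : Space3} {u w : Fin n → Space3}

open Filter Topology in
lemma Model.StatePair.tendsto_entropyProduction
    (h : P.StatePair M c δ V L r q s p gr gq gs gp u w) :
    Tendsto (fun η => P.entropyProduction η r q s p gr gq gs gp u w) (𝓝 0)
      (𝓝 (P.entropyProduction 0 r q s p gr gq gs gp u w)) := by
  unfold Model.entropyProduction
  have hs : (s + 0) ^ 2 ≠ 0 := by simpa using h.s_mem.1.ne'
  have hr : ∀ i, r i + 0 ≠ 0 := fun i => by simpa using (h.r_mem i).1.ne'
  apply ContinuousAt.tendsto
  fun_prop (disch := first | exact hs | exact hr _)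

/-- Division by `ρᵢ` gives an equation for `∇log ρᵢ`, the quantity that enters the entropy
production. -/
lemma Model.MaxwellStefan.inv_smul_grad_eq {v : Fin n → Space3} (hP : P.IsAdmissible)
    (hr : ∀ i, 0 < r i)
    (hs : 0 < s) (hp : P.pressureGrad r s gr gs = 0) (h : P.MaxwellStefan r s gr gs v) (i : Fin n) :
    (P.m i)⁻¹ • (r i)⁻¹ • gr i = -((P.m i)⁻¹ • s⁻¹ • gs)
      - P.ε⁻¹ • ∑ j, (P.b i j (r i) (r j) s * r j) • (v i - v j) := by
  have e := h.grad_eq hP hr hs hp i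
  have hri := (hr i).ne'
  rw [sum_smul_sub_erase] at e
  have e2 : ∑ j, (P.b i j (r i) (r j) s * r i * r j) • (v i - v j)
      = r i • ∑ j, (P.b i j (r i) (r j) s * r j) • (v i - v j) := by
    rw [Finset.smul_sum]
    refine Finset.sum_congr rfl fun j _ => ?_
    rw [smul_smul]
    congr 1
    ring
  rw [smul_comm, e, e2]
  match_scalars <;> field_simp

/-- The entropy production in terms of the differences of the velocities and of the logarithmic
temperature gradients. -/
lemma Model.StatePair.entropyProduction_zero_eq (hP : P.IsAdmissible) (hc : 0 < c) (hδ : 0 < δ)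
    (h : P.StatePair M c δ V L r q s p gr gq gs gp u w) {X Z y : Space3} {v : Fin n → Space3}
    (hX : X = s⁻¹ • gs) (hZ : Z = p⁻¹ • gp) (hy : y = X - Z) (hv : v = fun i => u i - w i) :
    P.entropyProduction 0 r q s p gr gq gs gp u w
      = - P.ε⁻¹ * (∑ i, ∑ j, (P.b i j (r i) (r j) s * r i * r j) * inner ℝ (v i) (v i - v j))
        - P.ε⁻¹ * (∑ i, inner ℝ (r i • v i) (∑ j, (P.b i j (r i) (r j) s * r j
            - P.b i j (q i) (q j) p * q j) • (w i - w j)))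
        - P.κ r s * ‖y‖ ^ 2
        + ((P.κ q p - P.κ r s) * (s / p) - 2 * P.κ r s * (1 - s / p)) * inner ℝ y Z
        + (P.κ q p - P.κ r s) * (1 - s / p) * ‖Z‖ ^ 2
        + inner ℝ (∑ i, (P.m i)⁻¹ • ((r i - q i) • w i)
            + (1 - s / p) • ∑ i, (P.m i)⁻¹ • q i • w i) y
        + (1 - s / p) * inner ℝ (∑ i, (P.m i)⁻¹ • (r i • v i + (r i - q i) • w i)) Z := by
  have hs := h.s_mem.1
  have hp : 0 < p := hδ.trans_le h.p_mem.1
  have hq : ∀ i, 0 < q i := fun i => hc.trans_le (h.q_mem i).1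
  have hs' := hs.ne'
  have hp' := hp.ne'
  have egs : gs = s • X := by rw [hX, smul_inv_smul₀ hs']
  have egp : gp = p • Z := by rw [hZ, smul_inv_smul₀ hp']
  -- the densities
  have hd : ∀ i, inner ℝ (r i • u i) ((P.m i)⁻¹ • ((r i + 0)⁻¹ • gr i - (q i)⁻¹ • gq i))
      + inner ℝ (q i • w i) ((P.m i)⁻¹ • (((r i + 0) * (q i ^ 2)⁻¹) • gq i - (q i)⁻¹ • gr i))
      = - inner ℝ ((P.m i)⁻¹ • r i • v i) y
        - P.ε⁻¹ * (∑ j, (P.b i j (r i) (r j) s * r i * r j) * inner ℝ (v i) (v i - v j))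
        - P.ε⁻¹ * inner ℝ (r i • v i) (∑ j, (P.b i j (r i) (r j) s * r j
            - P.b i j (q i) (q j) p * q j) • (w i - w j)) := by
    intro i
    have e1 := h.maxwell_stefan_r.inv_smul_grad_eq hP (fun i => (h.r_mem i).1) hs h.momentum_r i
    have e2 := h.maxwell_stefan_q.inv_smul_grad_eq hP hq hp h.momentum_q i
    have hri := (h.r_mem i).1.ne'
    have hqi := (hq i).ne'
    have hm := (hP.m_pos i).ne'
    -- Difference of the two Maxwell-Stefan systems. The friction splits into the first solution's
    -- coefficients acting on `v = u - w`, and a coefficient difference acting on the bounded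
    -- velocities `w`.
    have e3 : (P.m i)⁻¹ • (r i)⁻¹ • gr i - (P.m i)⁻¹ • (q i)⁻¹ • gq i
        = -((P.m i)⁻¹ • y) - P.ε⁻¹ • (∑ j, (P.b i j (r i) (r j) s * r j) • (v i - v j)
          + ∑ j, (P.b i j (r i) (r j) s * r j - P.b i j (q i) (q j) p * q j) • (w i - w j)) := by
      rw [e1, e2, ← Finset.sum_add_distrib, hy, ← hX, ← hZ]
      have : ∀ j, (P.b i j (r i) (r j) s * r j) • (v i - v j)
          + (P.b i j (r i) (r j) s * r j - P.b i j (q i) (q j) p * q j) • (w i - w j)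
          = (P.b i j (r i) (r j) s * r j) • (u i - u j)
            - (P.b i j (q i) (q j) p * q j) • (w i - w j) := by
        intro j
        rw [hv]
        module
      rw [Finset.sum_congr rfl fun j _ => this j, Finset.sum_sub_distrib]
      module
    -- The second term equals `-rᵢ⟨wᵢ, ·⟩` applied to the same difference of logarithmic gradients,
    -- so only the relative velocity remains.
    have e4 : inner ℝ (r i • u i) ((P.m i)⁻¹ • ((r i + 0)⁻¹ • gr i - (q i)⁻¹ • gq i))
      + inner ℝ (q i • w i) ((P.m i)⁻¹ • (((r i + 0) * (q i ^ 2)⁻¹) • gq i - (q i)⁻¹ • gr i))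
      = inner ℝ (r i • v i) ((P.m i)⁻¹ • (r i)⁻¹ • gr i - (P.m i)⁻¹ • (q i)⁻¹ • gq i) := by
      rw [hv]
      simp only [add_zero, inner_sub_right, inner_sub_left, real_inner_smul_left,
        real_inner_smul_right, smul_sub]
      field_simp
      ring
    rw [e4, e3, inner_sub_right, inner_neg_right, real_inner_smul_right, real_inner_smul_right,
      inner_add_right, inner_sum]
    have e5 : ∑ j, inner ℝ (r i • v i) ((P.b i j (r i) (r j) s * r j) • (v i - v j))
        = ∑ j, (P.b i j (r i) (r j) s * r i * r j) * inner ℝ (v i) (v i - v j) := by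
      refine Finset.sum_congr rfl fun j _ => ?_
      rw [real_inner_smul_left, real_inner_smul_right]
      ring
    rw [e5, real_inner_smul_left (r i • v i) y]
    ring
  unfold Model.entropyProduction
  rw [Finset.sum_congr rfl fun i _ => hd i, Finset.sum_sub_distrib, Finset.sum_sub_distrib,
    Finset.sum_neg_distrib, ← sum_inner, ← Finset.mul_sum, ← Finset.mul_sum,
    P.energyFlux_eq hP h.maxwell_stefan_r.2, P.energyFlux_eq hP h.maxwell_stefan_q.2]
  have eQ : ∑ i, (P.m i)⁻¹ • r i • u i
      = ∑ i, (P.m i)⁻¹ • r i • v i + ∑ i, (P.m i)⁻¹ • ((r i - q i) • w i)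
        + ∑ i, (P.m i)⁻¹ • q i • w i := by
    rw [← Finset.sum_add_distrib, ← Finset.sum_add_distrib]
    refine Finset.sum_congr rfl fun i _ => ?_
    rw [hv]
    module
  simp only [smul_add ((P.m _)⁻¹), Finset.sum_add_distrib]
  rw [eQ, egs, egp]
  set A := ∑ i, (P.m i)⁻¹ • r i • v i
  set B := ∑ i, (P.m i)⁻¹ • ((r i - q i) • w i)
  set D := ∑ i, (P.m i)⁻¹ • q i • w i
  set F := ∑ i, ∑ j, (P.b i j (r i) (r j) s * r i * r j) * inner ℝ (v i) (v i - v j)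
  set E := ∑ i, inner ℝ (r i • v i) (∑ j, (P.b i j (r i) (r j) s * r j
            - P.b i j (q i) (q j) p * q j) • (w i - w j))
  have eX : X = y + Z := by rw [hy]; abel
  have n1 : ((s + 0) ^ 2)⁻¹ * s = s⁻¹ := by field_simp; simp
  have n2 : (p ^ 2)⁻¹ * p = p⁻¹ := by field_simp
  -- In these variables the pressure part of the energy flux contributes `⟨A, y⟩`, which cancels the
  -- cross term `-⟨A, y⟩` of the densities. Every other term containing `A` carries the small factor
  -- `1 - s/p`.
  have g1 : ((s + 0) ^ 2)⁻¹ • s • X - (p ^ 2)⁻¹ • p • Z = s⁻¹ • (y + (1 - s / p) • Z) := by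
    rw [smul_smul, smul_smul, n1, n2, eX, smul_add, smul_add, smul_smul]
    have : s⁻¹ * (1 - s / p) = s⁻¹ - p⁻¹ := by field_simp
    rw [this]
    module
  have g2 : (2 * (s + 0) * (p ^ 3)⁻¹) • p • Z - (p ^ 2)⁻¹ • p • Z - (p ^ 2)⁻¹ • s • X
      = p⁻¹ • (-(1 - s / p) • Z - (s / p) • y) := by
    rw [smul_smul, smul_smul, smul_smul, n2, eX]
    have a1 : 2 * (s + 0) * (p ^ 3)⁻¹ * p = 2 * (p⁻¹ * (s / p)) := by field_simp; simp
    have a2 : (p ^ 2)⁻¹ * s = p⁻¹ * (s / p) := by field_simp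
    rw [a1, a2]
    module
  rw [g1, g2, eX]
  simp only [← real_inner_self_eq_norm_sq, inner_add_left, inner_add_right, inner_sub_right,
    inner_neg_left, inner_neg_right, neg_smul, real_inner_smul_left, real_inner_smul_right,
    smul_add]
  rw [real_inner_comm y Z]
  field_simp
  ring

end StatePair

/-! ### Estimates of the entropy production -/

section EntropyProduction

variable {n : ℕ} {P : Model n} {M c δ V L : ℝ}

lemma sq_sum_abs_add_le (f : Fin n → ℝ) (a : ℝ) :
    (∑ i, |f i| + |a|) ^ 2 ≤ (2 * n + 2) * (∑ i, f i ^ 2 + a ^ 2) := by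
  have h1 := sq_sum_le_card_mul_sum_sq (s := Finset.univ) (f := fun i => |f i|)
  simp only [sq_abs, Finset.card_univ, Fintype.card_fin] at h1
  have h2 : 0 ≤ ∑ i, f i ^ 2 := Finset.sum_nonneg fun i _ => sq_nonneg _
  have h3 : (0 : ℝ) ≤ n := Nat.cast_nonneg n
  nlinarith [sq_nonneg (∑ i, |f i| - |a|), sq_abs a, sq_nonneg a, mul_nonneg h3 (sq_nonneg a)]

/-- Completion of squares: the dissipation by friction (`W`) and by heat conduction (`Y`) absorbs
the mixed terms and leaves a multiple of the squared distance `D²`. -/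
lemma quadratic_le {a k A₁ A₂ A₃ W D Y : ℝ} (ha : 0 < a) (hk : 0 < k) :
    -(a * W ^ 2) - k * Y ^ 2 + A₁ * (W * D) + A₂ * (Y * D) + A₃ * D ^ 2
      ≤ (A₁ ^ 2 / (4 * a) + A₂ ^ 2 / (4 * k) + A₃) * D ^ 2 := by
  have h1 : A₁ * (W * D) ≤ a * W ^ 2 + A₁ ^ 2 / (4 * a) * D ^ 2 := by
    have : a * W ^ 2 + A₁ ^ 2 / (4 * a) * D ^ 2 - A₁ * (W * D)
        = (2 * a * W - A₁ * D) ^ 2 / (4 * a) := by field_simp; ring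
    have h2 : 0 ≤ (2 * a * W - A₁ * D) ^ 2 / (4 * a) := by positivity
    linarith
  have h2 : A₂ * (Y * D) ≤ k * Y ^ 2 + A₂ ^ 2 / (4 * k) * D ^ 2 := by
    have : k * Y ^ 2 + A₂ ^ 2 / (4 * k) * D ^ 2 - A₂ * (Y * D)
        = (2 * k * Y - A₂ * D) ^ 2 / (4 * k) := by field_simp; ring
    have h2 : 0 ≤ (2 * k * Y - A₂ * D) ^ 2 / (4 * k) := by positivity
    linarith
  linarith

lemma norm_sum_smul_le {f : Fin n → ℝ} {w : Fin n → Space3} (hw : ∀ i, ‖w i‖ ≤ V) :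
    ‖∑ i, f i • w i‖ ≤ V * ∑ i, |f i| := by
  refine (norm_sum_le _ _).trans ?_
  rw [Finset.mul_sum]
  refine Finset.sum_le_sum fun i _ => ?_
  rw [norm_smul, mul_comm, Real.norm_eq_abs]
  gcongr
  exact hw i

lemma norm_sum_inv_smul_le {m : Fin n → ℝ} (hm : ∀ i, 0 < m i) {μ : ℝ} (hμ : ∀ i, (m i)⁻¹ ≤ μ)
    (x : Fin n → Space3) : ‖∑ i, (m i)⁻¹ • x i‖ ≤ μ * ∑ i, ‖x i‖ := by
  refine (norm_sum_le _ _).trans ?_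
  rw [Finset.mul_sum]
  refine Finset.sum_le_sum fun i _ => ?_
  have := hm i
  rw [norm_smul, Real.norm_of_nonneg (by positivity)]
  gcongr
  exact hμ i

set_option maxHeartbeats 2000000 in
/-- The entropy production is controlled by the distance of the two states. -/
theorem Model.IsAdmissible.exists_entropyProduction_zero_le (hP : P.IsAdmissible) (hc : 0 < c)
    (hδ : 0 < δ) (hM : 0 < M) (hV : 0 ≤ V) (hL : 0 ≤ L) :
    ∃ C > 0, ∀ (r q : Fin n → ℝ) (s p : ℝ) (gr gq : Fin n → Space3) (gs gp : Space3)
      (u w : Fin n → Space3), P.StatePair M c δ V L r q s p gr gq gs gp u w →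
      P.entropyProduction 0 r q s p gr gq gs gp u w
        ≤ C * (∑ i, (r i - q i) ^ 2 + (s - p) ^ 2) := by
  obtain ⟨b₀, B₀, K, hb⟩ := hP.exists_interactionBounds hM.le
  obtain ⟨Kκ, hKκ, hκ⟩ := hP.exists_conductivity_lipschitz M
  obtain ⟨ck, Ck, hck, hCk, hgrow⟩ := hP.κ_growth
  obtain ⟨μ, hμ, hμm⟩ := exists_pos_forall_ge fun i => (P.m i)⁻¹
  have hε := hP.ε_pos
  have hb0 := hb.pos
  have hB0 := hb.upper_pos
  have hK := hb.lip_pos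
  set A₁ := P.ε⁻¹ * (n * (2 * K * M + B₀) * (2 * V)) + δ⁻¹ * μ * L with hA₁
  set A₂ := (Kκ * (M * δ⁻¹) + 2 * (Ck * (1 + M ^ 2)) * δ⁻¹) * L
    + (μ * V + δ⁻¹ * (μ * (n * (M * V)))) with hA₂
  set A₃ := P.ε⁻¹ * b₀ * V ^ 2 + Kκ * δ⁻¹ * L ^ 2 + δ⁻¹ * (μ * V) * L with hA₃
  have hAC : 0 < (A₁ ^ 2 / (4 * (P.ε⁻¹ * b₀)) + A₂ ^ 2 / (4 * ck) + A₃ + 1) * (2 * n + 2) := by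
    positivity
  refine ⟨_, hAC, fun r q s p gr gq gs gp u w h => ?_⟩
  have hs := h.s_mem.1
  have hp : 0 < p := hδ.trans_le h.p_mem.1
  have hq : ∀ i, 0 < q i := fun i => hc.trans_le (h.q_mem i).1
  have hr : ∀ i, 0 < r i := fun i => (h.r_mem i).1
  have hrI : ∀ i, r i ∈ Icc 0 M := fun i => ⟨(hr i).le, (h.r_mem i).2⟩
  have hqI : ∀ i, q i ∈ Icc 0 M := fun i => ⟨(hq i).le, (h.q_mem i).2⟩
  have hsI : s ∈ Icc 0 M := ⟨hs.le, h.s_mem.2⟩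
  have hpI : p ∈ Icc 0 M := ⟨hp.le, h.p_mem.2⟩
  set Z := p⁻¹ • gp with hZ
  set y := s⁻¹ • gs - Z with hy
  set v : Fin n → Space3 := fun i => u i - w i with hv
  rw [h.entropyProduction_zero_eq hP hc hδ rfl hZ hy hv]
  set D := ∑ i, |r i - q i| + |s - p| with hD
  set W := ∑ i, r i * ‖v i‖ with hW
  have hW0 : 0 ≤ W := Finset.sum_nonneg fun i _ => mul_nonneg (hr i).le (norm_nonneg _)
  have hD0 : 0 ≤ D := by positivity
  have hsumD : ∑ i, |r i - q i| ≤ D := by rw [hD]; linarith [abs_nonneg (s - p)]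
  have hspD : |s - p| ≤ D := by
    rw [hD]
    linarith [Finset.sum_nonneg fun i (_ : i ∈ Finset.univ) => abs_nonneg (r i - q i)]
  have hrqD : ∀ i, |r i - q i| ≤ D := fun i =>
    (Finset.single_le_sum (f := fun i => |r i - q i|) (fun j _ => abs_nonneg _)
      (Finset.mem_univ i)).trans hsumD
  have hτ : |1 - s / p| ≤ δ⁻¹ * D := by
    have : 1 - s / p = p⁻¹ * (p - s) := by field_simp
    rw [this, abs_mul, abs_of_pos (by positivity), abs_sub_comm]
    gcongr
    exact h.p_mem.1
  have hτM : s / p ≤ M * δ⁻¹ := by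
    rw [div_eq_mul_inv]
    gcongr
    exacts [h.s_mem.2, h.p_mem.1]
  have hZL : ‖Z‖ ≤ L := h.logGrad_le
  have hκd : |P.κ q p - P.κ r s| ≤ Kκ * D := by
    rw [abs_sub_comm]
    exact hκ r q s p hrI hqI ⟨hs, h.s_mem.2⟩ ⟨hp, h.p_mem.2⟩
  have hκl := (hgrow r s (fun i => (hr i).le) hs).1
  have hκu := (hgrow r s (fun i => (hr i).le) hs).2
  have hκ0 : ck ≤ P.κ r s := le_trans (by nlinarith [sq_nonneg s]) hκl
  have hκM : P.κ r s ≤ Ck * (1 + M ^ 2) := hκu.trans (by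
    have := h.s_mem.2
    gcongr)
  -- friction
  have t1 : - P.ε⁻¹ * (∑ i, ∑ j, (P.b i j (r i) (r j) s * r i * r j) * inner ℝ (v i) (v i - v j))
      ≤ -(P.ε⁻¹ * b₀ * W ^ 2) + P.ε⁻¹ * b₀ * V ^ 2 * D ^ 2 := by
    have h1 := friction_ge (v := v) (r := r)
      (β := fun i j => P.b i j (r i) (r j) s * r i * r j) hb0.le
      (fun i j hij => by simp only [hP.b_symm i j hij (r i) (r j) s]; ring)
      (fun i j hij => by
        have := hb.lower i j hij (r i) (hrI i) (r j) (hrI j) s hsI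
        have h2 := mul_le_mul_of_nonneg_right this (mul_nonneg (hr i).le (hr j).le)
        simpa [mul_assoc] using h2) fun i => (hr i).le
    -- Both barycentric velocities vanish, so the mean that friction does not control is of the
    -- order of the distance.
    have h2 : ∑ i, r i • v i = -∑ i, (r i - q i) • w i := by
      have h3 : ∑ i, r i • v i = ∑ i, r i • u i - ∑ i, q i • w i - ∑ i, (r i - q i) • w i := by
        rw [← Finset.sum_sub_distrib, ← Finset.sum_sub_distrib]
        refine Finset.sum_congr rfl fun i _ => ?_
        rw [hv]
        module
      rw [h3, h.maxwell_stefan_r.2, h.maxwell_stefan_q.2]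
      simp
    have h3 : ‖∑ i, r i • v i‖ ≤ V * D := by
      rw [h2, norm_neg]
      exact (norm_sum_smul_le h.velocity_le).trans (by gcongr)
    have h4 : ‖∑ i, r i • v i‖ ^ 2 ≤ (V * D) ^ 2 := by gcongr
    have h5 := mul_le_mul_of_nonneg_left (le_trans (mul_le_mul_of_nonneg_left
      (sub_le_sub_left h4 (W ^ 2)) hb0.le) h1) (inv_nonneg.2 hε.le)
    linarith
  have t2 : -(P.ε⁻¹ * ∑ i, inner ℝ (r i • v i) (∑ j, (P.b i j (r i) (r j) s * r j
            - P.b i j (q i) (q j) p * q j) • (w i - w j)))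
      ≤ P.ε⁻¹ * (n * (2 * K * M + B₀) * (2 * V)) * (W * D) := by
    have h1 : ∀ i, ‖∑ j, (P.b i j (r i) (r j) s * r j
        - P.b i j (q i) (q j) p * q j) • (w i - w j)‖ ≤ n * (2 * K * M + B₀) * (2 * V) * D := by
      intro i
      calc _ ≤ ∑ j, ‖(P.b i j (r i) (r j) s * r j
              - P.b i j (q i) (q j) p * q j) • (w i - w j)‖ := norm_sum_le _ _
        _ ≤ ∑ j : Fin n, (2 * K * M + B₀) * D * (2 * V) := by
          refine Finset.sum_le_sum fun j _ => ?_
          by_cases hij : i = j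
          · rw [hij, sub_self, smul_zero, norm_zero]
            positivity
          have h2 : ‖w i - w j‖ ≤ 2 * V :=
            (norm_sub_le _ _).trans (by linarith [h.velocity_le i, h.velocity_le j])
          have h3 := hb.lip i j hij (r i) (hrI i) (r j) (hrI j) s hsI (q i) (hqI i) (q j) (hqI j)
            p hpI
          have h3' : |P.b i j (r i) (r j) s - P.b i j (q i) (q j) p| ≤ K * (2 * D) := by
            refine h3.trans ?_
            gcongr
            have : |r j - q j| + |s - p| ≤ D := by
              rw [hD]
              gcongr
              exact Finset.single_le_sum (f := fun i => |r i - q i|) (fun j _ => abs_nonneg _)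
                (Finset.mem_univ j)
            linarith [hrqD i]
          have h4 := hb.upper i j hij (q i) (hqI i) (q j) (hqI j) p hpI
          have h4' := (hP.b_pos i j hij (q i) (q j) p (hq i).le (hq j).le hp.le).le
          have h5 : |P.b i j (r i) (r j) s * r j - P.b i j (q i) (q j) p * q j|
              ≤ (2 * K * M + B₀) * D := by
            have e : P.b i j (r i) (r j) s * r j - P.b i j (q i) (q j) p * q j
                = (P.b i j (r i) (r j) s - P.b i j (q i) (q j) p) * r j
                  + P.b i j (q i) (q j) p * (r j - q j) := by ring
            rw [e]
            refine (abs_add_le _ _).trans ?_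
            rw [abs_mul, abs_mul, abs_of_pos (hr j), abs_of_nonneg h4']
            calc _ ≤ K * (2 * D) * M + B₀ * D := by
                  have := hrqD j
                  have := (h.r_mem j).2
                  have := (hr j).le
                  gcongr
              _ = _ := by ring
          rw [norm_smul, Real.norm_eq_abs]
          gcongr
        _ = _ := by simp; ring
    have h2 : -∑ i, inner ℝ (r i • v i) (∑ j, (P.b i j (r i) (r j) s * r j
            - P.b i j (q i) (q j) p * q j) • (w i - w j))
        ≤ ∑ i, r i * ‖v i‖ * (n * (2 * K * M + B₀) * (2 * V) * D) := by
      rw [← Finset.sum_neg_distrib]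
      refine Finset.sum_le_sum fun i _ => ?_
      refine (neg_le_abs _).trans ((abs_real_inner_le_norm _ _).trans ?_)
      rw [norm_smul, Real.norm_of_nonneg (hr i).le]
      have := (hr i).le
      gcongr
      exact h1 i
    rw [← Finset.sum_mul] at h2
    have h3 := mul_le_mul_of_nonneg_left h2 (inv_nonneg.2 hε.le)
    linarith
  have t3 : ck * ‖y‖ ^ 2 ≤ P.κ r s * ‖y‖ ^ 2 := by gcongr
  have t4 : ((P.κ q p - P.κ r s) * (s / p) - 2 * P.κ r s * (1 - s / p)) * inner ℝ y Z
      ≤ (Kκ * (M * δ⁻¹) + 2 * (Ck * (1 + M ^ 2)) * δ⁻¹) * L * (‖y‖ * D) := by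
    have h1 : |(P.κ q p - P.κ r s) * (s / p) - 2 * P.κ r s * (1 - s / p)|
        ≤ (Kκ * (M * δ⁻¹) + 2 * (Ck * (1 + M ^ 2)) * δ⁻¹) * D := by
      refine (abs_sub _ _).trans ?_
      have hk0 : 0 ≤ P.κ r s := hck.le.trans hκ0
      rw [abs_mul, abs_mul, abs_of_pos (div_pos hs hp),
        abs_of_nonneg (show 0 ≤ 2 * P.κ r s by positivity)]
      calc _ ≤ Kκ * D * (M * δ⁻¹) + 2 * (Ck * (1 + M ^ 2)) * (δ⁻¹ * D) := by gcongr
        _ = _ := by ring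
    have h2 : |inner ℝ y Z| ≤ ‖y‖ * L := (abs_real_inner_le_norm _ _).trans (by gcongr)
    refine (le_abs_self _).trans ?_
    rw [abs_mul]
    refine (mul_le_mul h1 h2 (abs_nonneg _) (by positivity)).trans_eq ?_
    ring
  have t5 : (P.κ q p - P.κ r s) * (1 - s / p) * ‖Z‖ ^ 2 ≤ Kκ * δ⁻¹ * L ^ 2 * D ^ 2 := by
    refine (le_abs_self _).trans ?_
    rw [abs_mul, abs_mul, abs_of_nonneg (sq_nonneg ‖Z‖)]
    calc _ ≤ Kκ * D * (δ⁻¹ * D) * L ^ 2 := by gcongr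
      _ = _ := by ring
  have t6 : inner ℝ (∑ i, (P.m i)⁻¹ • ((r i - q i) • w i)
            + (1 - s / p) • ∑ i, (P.m i)⁻¹ • q i • w i) y
      ≤ (μ * V + δ⁻¹ * (μ * (n * (M * V)))) * (‖y‖ * D) := by
    have h1 : ‖∑ i, (P.m i)⁻¹ • ((r i - q i) • w i)‖ ≤ μ * (V * D) := by
      refine (norm_sum_inv_smul_le hP.m_pos hμm _).trans ?_
      gcongr
      calc _ ≤ ∑ i, V * |r i - q i| := by
            refine Finset.sum_le_sum fun i _ => ?_
            rw [norm_smul, Real.norm_eq_abs, mul_comm]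
            gcongr
            exact h.velocity_le i
        _ ≤ _ := by rw [← Finset.mul_sum]; gcongr
    have h2 : ‖∑ i, (P.m i)⁻¹ • q i • w i‖ ≤ μ * (n * (M * V)) := by
      refine (norm_sum_inv_smul_le hP.m_pos hμm _).trans ?_
      gcongr
      calc _ ≤ ∑ i : Fin n, M * V := by
            refine Finset.sum_le_sum fun i _ => ?_
            rw [norm_smul, Real.norm_of_nonneg (hq i).le]
            gcongr
            exacts [(h.q_mem i).2, h.velocity_le i]
        _ = _ := by simp
    refine (real_inner_le_norm _ _).trans ?_
    calc _ ≤ (μ * (V * D) + δ⁻¹ * D * (μ * (n * (M * V)))) * ‖y‖ := by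
          gcongr
          refine (norm_add_le _ _).trans (add_le_add h1 ?_)
          rw [norm_smul, Real.norm_eq_abs]
          gcongr
      _ = _ := by ring
  have t7 : (1 - s / p) * inner ℝ (∑ i, (P.m i)⁻¹ • (r i • v i + (r i - q i) • w i)) Z
      ≤ δ⁻¹ * μ * L * (W * D) + δ⁻¹ * (μ * V) * L * D ^ 2 := by
    have h1 : ‖∑ i, (P.m i)⁻¹ • (r i • v i + (r i - q i) • w i)‖ ≤ μ * (W + V * D) := by
      refine (norm_sum_inv_smul_le hP.m_pos hμm _).trans ?_
      gcongr
      calc _ ≤ ∑ i, (r i * ‖v i‖ + V * |r i - q i|) := by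
            refine Finset.sum_le_sum fun i _ => (norm_add_le _ _).trans ?_
            rw [norm_smul, norm_smul, Real.norm_of_nonneg (hr i).le, Real.norm_eq_abs,
              mul_comm |r i - q i|]
            gcongr
            exact h.velocity_le i
        _ ≤ _ := by
            rw [Finset.sum_add_distrib, ← Finset.mul_sum]
            gcongr
    refine (le_abs_self _).trans ?_
    rw [abs_mul]
    calc _ ≤ δ⁻¹ * D * (μ * (W + V * D) * L) := by
          gcongr
          refine (abs_real_inner_le_norm _ _).trans ?_
          gcongr
      _ = _ := by ring
  have hfin := quadratic_le (a := P.ε⁻¹ * b₀) (k := ck) (A₁ := A₁) (A₂ := A₂) (A₃ := A₃) (W := W)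
    (D := D) (Y := ‖y‖) (by positivity) hck
  have hDΔ : D ^ 2 ≤ (2 * n + 2) * (∑ i, (r i - q i) ^ 2 + (s - p) ^ 2) :=
    sq_sum_abs_add_le (fun i => r i - q i) (s - p)
  calc _ ≤ (A₁ ^ 2 / (4 * (P.ε⁻¹ * b₀)) + A₂ ^ 2 / (4 * ck) + A₃) * D ^ 2 := by
        refine le_trans ?_ hfin
        rw [hA₁, hA₂, hA₃]
        linarith
    _ ≤ (A₁ ^ 2 / (4 * (P.ε⁻¹ * b₀)) + A₂ ^ 2 / (4 * ck) + A₃ + 1) * D ^ 2 :=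
        mul_le_mul_of_nonneg_right (by linarith) (sq_nonneg D)
    _ ≤ _ := by
        rw [mul_assoc _ (2 * (n : ℝ) + 2)]
        gcongr

/-- Sum of the squares of all fluxes and gradients. -/
noncomputable def Model.fluxSq (P : Model n) (r q : Fin n → ℝ) (s p : ℝ)
    (gr gq : Fin n → Space3) (gs gp : Space3) (u w : Fin n → Space3) : ℝ :=
  ∑ i, (‖r i • u i‖ ^ 2 + ‖gr i‖ ^ 2 + ‖q i • w i‖ ^ 2 + ‖gq i‖ ^ 2)
    + (‖P.energyFlux r s gs u‖ ^ 2 + ‖P.energyFlux q p gp w‖ ^ 2 + ‖gs‖ ^ 2 + ‖gp‖ ^ 2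
      + ‖s⁻¹ • gs‖ ^ 2)

set_option maxHeartbeats 2000000 in
/-- The regularized entropy production is bounded above independently of the regularization. -/
theorem Model.IsAdmissible.exists_entropyProduction_le (hP : P.IsAdmissible) (hc : 0 < c)
    (hδ : 0 < δ) (hM : 0 < M) :
    ∃ C > 0, ∀ (r q : Fin n → ℝ) (s p : ℝ) (gr gq : Fin n → Space3) (gs gp : Space3)
      (u w : Fin n → Space3), P.StatePair M c δ V L r q s p gr gq gs gp u w →
      ∀ η ∈ Ioc (0 : ℝ) 1, P.entropyProduction η r q s p gr gq gs gp u w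
        ≤ C * P.fluxSq r q s p gr gq gs gp u w := by
  obtain ⟨b₀, B₀, K, hb⟩ := hP.exists_interactionBounds hM.le
  obtain ⟨μ, hμ, hμm⟩ := exists_pos_forall_ge fun i => (P.m i)⁻¹
  obtain ⟨ck, Ck, hck, hCk, hgrow⟩ := hP.κ_growth
  have hε := hP.ε_pos
  have hB0 := hb.upper_pos
  set C₁ := (μ + P.ε⁻¹ * (n * B₀)) + μ * c⁻¹ + μ * ((M + 1) * (c ^ 2)⁻¹ + c⁻¹) with hC₁
  set C₂ := μ * n + (δ ^ 2)⁻¹ + (2 * (M + 1) * (δ ^ 3)⁻¹ + (δ ^ 2)⁻¹ + (δ ^ 2)⁻¹) with hC₂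
  refine ⟨n * C₁ + C₂, by positivity, fun r q s p gr gq gs gp u w h η hη => ?_⟩
  have hη0 := hη.1
  have hs := h.s_mem.1
  have hp : 0 < p := hδ.trans_le h.p_mem.1
  have hq : ∀ i, 0 < q i := fun i => hc.trans_le (h.q_mem i).1
  have hr : ∀ i, 0 < r i := fun i => (h.r_mem i).1
  have hrI : ∀ i, r i ∈ Icc 0 M := fun i => ⟨(hr i).le, (h.r_mem i).2⟩
  have hsI : s ∈ Icc 0 M := ⟨hs.le, h.s_mem.2⟩
  set N := P.fluxSq r q s p gr gq gs gp u w with hN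
  have hterm : ∀ i, ‖r i • u i‖ ^ 2 + ‖gr i‖ ^ 2 + ‖q i • w i‖ ^ 2 + ‖gq i‖ ^ 2 ≤
      ∑ i, (‖r i • u i‖ ^ 2 + ‖gr i‖ ^ 2 + ‖q i • w i‖ ^ 2 + ‖gq i‖ ^ 2) := fun i =>
    Finset.single_le_sum (f := fun i => ‖r i • u i‖ ^ 2 + ‖gr i‖ ^ 2 + ‖q i • w i‖ ^ 2
      + ‖gq i‖ ^ 2) (fun j _ => by positivity) (Finset.mem_univ i)
  have hsum0 : 0 ≤ ∑ i, (‖r i • u i‖ ^ 2 + ‖gr i‖ ^ 2 + ‖q i • w i‖ ^ 2 + ‖gq i‖ ^ 2) :=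
    Finset.sum_nonneg fun i _ => by positivity
  -- Each flux and gradient has norm at most `R`, so every product of two of them is at most `N`.
  set R := Real.sqrt N with hR
  have hR0 : 0 ≤ R := Real.sqrt_nonneg _
  have hN0 : 0 ≤ N := by rw [hN]; unfold Model.fluxSq; positivity
  have hRN : R * R = N := Real.mul_self_sqrt hN0
  have b1 : ∀ i, ‖r i • u i‖ ≤ R := fun i => Real.le_sqrt_of_sq_le (by
    rw [hN]; unfold Model.fluxSq
    linarith [hterm i, sq_nonneg ‖gr i‖, sq_nonneg ‖q i • w i‖, sq_nonneg ‖gq i‖,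
      sq_nonneg ‖P.energyFlux r s gs u‖, sq_nonneg ‖P.energyFlux q p gp w‖, sq_nonneg ‖gs‖,
      sq_nonneg ‖gp‖, sq_nonneg ‖s⁻¹ • gs‖])
  have b2 : ∀ i, ‖gr i‖ ≤ R := fun i => Real.le_sqrt_of_sq_le (by
    rw [hN]; unfold Model.fluxSq
    linarith [hterm i, sq_nonneg ‖r i • u i‖, sq_nonneg ‖q i • w i‖, sq_nonneg ‖gq i‖,
      sq_nonneg ‖P.energyFlux r s gs u‖, sq_nonneg ‖P.energyFlux q p gp w‖, sq_nonneg ‖gs‖,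
      sq_nonneg ‖gp‖, sq_nonneg ‖s⁻¹ • gs‖])
  have b3 : ∀ i, ‖q i • w i‖ ≤ R := fun i => Real.le_sqrt_of_sq_le (by
    rw [hN]; unfold Model.fluxSq
    linarith [hterm i, sq_nonneg ‖gr i‖, sq_nonneg ‖r i • u i‖, sq_nonneg ‖gq i‖,
      sq_nonneg ‖P.energyFlux r s gs u‖, sq_nonneg ‖P.energyFlux q p gp w‖, sq_nonneg ‖gs‖,
      sq_nonneg ‖gp‖, sq_nonneg ‖s⁻¹ • gs‖])
  have b4 : ∀ i, ‖gq i‖ ≤ R := fun i => Real.le_sqrt_of_sq_le (by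
    rw [hN]; unfold Model.fluxSq
    linarith [hterm i, sq_nonneg ‖gr i‖, sq_nonneg ‖q i • w i‖, sq_nonneg ‖r i • u i‖,
      sq_nonneg ‖P.energyFlux r s gs u‖, sq_nonneg ‖P.energyFlux q p gp w‖, sq_nonneg ‖gs‖,
      sq_nonneg ‖gp‖, sq_nonneg ‖s⁻¹ • gs‖])
  have hlast : ∀ x, x ^ 2 ≤ ‖P.energyFlux r s gs u‖ ^ 2 + ‖P.energyFlux q p gp w‖ ^ 2
      + ‖gs‖ ^ 2 + ‖gp‖ ^ 2 + ‖s⁻¹ • gs‖ ^ 2 → x ≤ R := fun x hx =>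
    Real.le_sqrt_of_sq_le (by rw [hN]; unfold Model.fluxSq; linarith)
  have b5 : ‖P.energyFlux r s gs u‖ ≤ R := hlast _ (by
    linarith [sq_nonneg ‖P.energyFlux q p gp w‖, sq_nonneg ‖gs‖, sq_nonneg ‖gp‖,
      sq_nonneg ‖s⁻¹ • gs‖])
  have b6 : ‖P.energyFlux q p gp w‖ ≤ R := hlast _ (by
    linarith [sq_nonneg ‖P.energyFlux r s gs u‖, sq_nonneg ‖gs‖, sq_nonneg ‖gp‖,
      sq_nonneg ‖s⁻¹ • gs‖])
  have b7 : ‖gs‖ ≤ R := hlast _ (by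
    linarith [sq_nonneg ‖P.energyFlux q p gp w‖, sq_nonneg ‖P.energyFlux r s gs u‖,
      sq_nonneg ‖gp‖, sq_nonneg ‖s⁻¹ • gs‖])
  have b8 : ‖gp‖ ≤ R := hlast _ (by
    linarith [sq_nonneg ‖P.energyFlux q p gp w‖, sq_nonneg ‖gs‖,
      sq_nonneg ‖P.energyFlux r s gs u‖, sq_nonneg ‖s⁻¹ • gs‖])
  have b9 : ‖s⁻¹ • gs‖ ≤ R := hlast _ (by
    linarith [sq_nonneg ‖P.energyFlux q p gp w‖, sq_nonneg ‖gs‖, sq_nonneg ‖gp‖,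
      sq_nonneg ‖P.energyFlux r s gs u‖])
  have hin : ∀ {x y : Space3} {A B : ℝ}, ‖x‖ ≤ A → ‖y‖ ≤ B → |inner ℝ x y| ≤ A * B :=
    fun {x y A B} hx hy => (abs_real_inner_le_norm _ _).trans
      (mul_le_mul hx hy (norm_nonneg _) ((norm_nonneg _).trans hx))
  -- the densities
  have d1 : ∀ i, inner ℝ (r i • u i) ((P.m i)⁻¹ • ((r i + η)⁻¹ • gr i - (q i)⁻¹ • gq i))
      ≤ ((μ + P.ε⁻¹ * (n * B₀)) + μ * c⁻¹) * N := by
    intro i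
    have hm := hP.m_pos i
    have hri := hr i
    have e1 := h.maxwell_stefan_r.inv_smul_grad_eq hP hr hs h.momentum_r i
    have e2 : inner ℝ (r i • u i) ((P.m i)⁻¹ • ((r i + η)⁻¹ • gr i - (q i)⁻¹ • gq i))
        = (r i / (r i + η)) * inner ℝ (r i • u i) ((P.m i)⁻¹ • (r i)⁻¹ • gr i)
          - (P.m i)⁻¹ * (q i)⁻¹ * inner ℝ (r i • u i) (gq i) := by
      simp only [inner_sub_right, real_inner_smul_right]
      field_simp
    -- The term singular in `rᵢ`. By the Maxwell-Stefan relation its only part not controlled by the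
    -- fluxes is `-bᵢⱼ rᵢ rⱼ ‖uᵢ‖²`, which has the favourable sign; the velocities `uᵢ` themselves
    -- need not be bounded.
    have f1 : inner ℝ (r i • u i) ((P.m i)⁻¹ • (r i)⁻¹ • gr i) ≤ (μ + P.ε⁻¹ * (n * B₀)) * N := by
      rw [e1, inner_sub_right, inner_neg_right, real_inner_smul_right _ _ (P.m i)⁻¹,
        real_inner_smul_right _ _ P.ε⁻¹, inner_sum]
      have g1 : -((P.m i)⁻¹ * inner ℝ (r i • u i) (s⁻¹ • gs)) ≤ μ * N := by
        have := neg_le_of_abs_le (hin (b1 i) b9)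
        rw [hRN] at this
        have hmi : 0 < (P.m i)⁻¹ := by positivity
        have h2 := mul_le_mul_of_nonneg_right (hμm i) hN0
        nlinarith
      have g2 : -(n * B₀ * N) ≤ ∑ j, inner ℝ (r i • u i)
          ((P.b i j (r i) (r j) s * r j) • (u i - u j)) := by
        have : -(n * B₀ * N) = ∑ j : Fin n, -(B₀ * N) := by simp; ring
        rw [this]
        refine Finset.sum_le_sum fun j _ => ?_
        by_cases hij : i = j
        · rw [hij, sub_self, smul_zero, inner_zero_right]
          have : 0 ≤ B₀ * N := by positivity
          linarith
        have hbp := hP.b_pos i j hij (r i) (r j) s (hr i).le (hr j).le hs.le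
        have hbu := hb.upper i j hij (r i) (hrI i) (r j) (hrI j) s hsI
        have e3 : inner ℝ (r i • u i) ((P.b i j (r i) (r j) s * r j) • (u i - u j))
            = P.b i j (r i) (r j) s * (r i * r j * ‖u i‖ ^ 2
              - inner ℝ (r i • u i) (r j • u j)) := by
          rw [← real_inner_self_eq_norm_sq]
          simp only [inner_sub_right, real_inner_smul_left, real_inner_smul_right]
          ring
        rw [e3]
        have h2 := (abs_le.1 (hin (b1 i) (b1 j))).2
        rw [hRN] at h2
        have h3 : 0 ≤ P.b i j (r i) (r j) s * (r i * r j * ‖u i‖ ^ 2) := by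
          have := hr j
          positivity
        have h4 : P.b i j (r i) (r j) s * inner ℝ (r i • u i) (r j • u j) ≤ B₀ * N :=
          (mul_le_mul_of_nonneg_left h2 hbp.le).trans (by gcongr)
        linarith
      have g3 := mul_le_mul_of_nonneg_left g2 (inv_nonneg.2 hε.le)
      linarith
    have f2 : -((P.m i)⁻¹ * (q i)⁻¹ * inner ℝ (r i • u i) (gq i)) ≤ μ * c⁻¹ * N := by
      have h1 := neg_le_of_abs_le (hin (b1 i) (b4 i))
      rw [hRN] at h1
      have h2 : (P.m i)⁻¹ * (q i)⁻¹ ≤ μ * c⁻¹ := by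
        have := hq i
        gcongr
        exacts [hμm i, (h.q_mem i).1]
      have h3 : 0 ≤ (P.m i)⁻¹ * (q i)⁻¹ := by
        have := hq i
        positivity
      have h4 := mul_le_mul_of_nonneg_right h2 hN0
      nlinarith
    -- The regularization only multiplies the singular term by a factor in `[0,1]`, which preserves
    -- a nonnegative upper bound.
    have f3 : (r i / (r i + η)) * inner ℝ (r i • u i) ((P.m i)⁻¹ • (r i)⁻¹ • gr i)
        ≤ (μ + P.ε⁻¹ * (n * B₀)) * N := by
      have l0 : 0 ≤ r i / (r i + η) := by positivity
      have l1 : r i / (r i + η) ≤ 1 := by rw [div_le_one (by positivity)]; linarith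
      have l2 : 0 ≤ (μ + P.ε⁻¹ * (n * B₀)) * N := by positivity
      exact (mul_le_mul_of_nonneg_left f1 l0).trans (mul_le_of_le_one_left l2 l1)
    rw [e2]
    linarith
  have d2 : ∀ i, inner ℝ (q i • w i) ((P.m i)⁻¹ • (((r i + η) * (q i ^ 2)⁻¹) • gq i
      - (q i)⁻¹ • gr i)) ≤ μ * ((M + 1) * (c ^ 2)⁻¹ + c⁻¹) * N := by
    intro i
    have hm := hP.m_pos i
    have hri := hr i
    have hqi := hq i
    have h1 : ‖(P.m i)⁻¹ • (((r i + η) * (q i ^ 2)⁻¹) • gq i - (q i)⁻¹ • gr i)‖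
        ≤ μ * (((M + 1) * (c ^ 2)⁻¹ * R) + c⁻¹ * R) := by
      rw [norm_smul, Real.norm_of_nonneg (by positivity)]
      gcongr
      · exact hμm i
      · refine (norm_sub_le _ _).trans ?_
        rw [norm_smul, norm_smul, Real.norm_of_nonneg (by positivity),
          Real.norm_of_nonneg (by positivity)]
        gcongr
        exacts [(h.r_mem i).2, hη.2, (h.q_mem i).1, b4 i, (h.q_mem i).1, b2 i]
    refine ((le_abs_self _).trans (hin (b3 i) h1)).trans_eq ?_
    rw [← hRN]
    ring
  -- the temperature
  have d3 : inner ℝ (P.energyFlux r s gs u) (((s + η) ^ 2)⁻¹ • gs - (p ^ 2)⁻¹ • gp)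
      ≤ (μ * n + (δ ^ 2)⁻¹) * N := by
    rw [inner_sub_right, real_inner_smul_right, real_inner_smul_right]
    -- Heat conduction has a sign here. The partial pressures leave a product of `rᵢuᵢ` with `∇log
    -- θ`, which is why `fluxSq` contains `‖s⁻¹ • gs‖ ^ 2`.
    have h1 : ((s + η) ^ 2)⁻¹ * inner ℝ (P.energyFlux r s gs u) gs ≤ μ * n * N := by
      rw [P.energyFlux_eq hP h.maxwell_stefan_r.2, inner_add_left, inner_neg_left,
        real_inner_smul_left, real_inner_smul_left, real_inner_self_eq_norm_sq]
      have hκ : 0 ≤ P.κ r s := le_trans (by positivity) (hgrow r s (fun i => (hr i).le) hs).1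
      have hQ : ‖∑ i, (P.m i)⁻¹ • r i • u i‖ ≤ μ * (n * R) := by
        refine (norm_sum_inv_smul_le hP.m_pos hμm _).trans ?_
        gcongr
        calc _ ≤ ∑ i : Fin n, R := Finset.sum_le_sum fun i _ => b1 i
          _ = _ := by simp
      have h2 := (le_abs_self _).trans (hin hQ b9)
      rw [real_inner_smul_right] at h2
      have e : ((s + η) ^ 2)⁻¹ * (-(P.κ r s * ‖gs‖ ^ 2)
          + s * inner ℝ (∑ i, (P.m i)⁻¹ • r i • u i) gs)
          = -(((s + η) ^ 2)⁻¹ * (P.κ r s * ‖gs‖ ^ 2)) + (s / (s + η)) ^ 2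
            * (s⁻¹ * inner ℝ (∑ i, (P.m i)⁻¹ • r i • u i) gs) := by
        field_simp
      rw [e]
      have l1 : (s / (s + η)) ^ 2 ≤ 1 := by
        refine pow_le_one₀ (by positivity) ?_
        rw [div_le_one (by positivity)]
        linarith
      have l2 : (s / (s + η)) ^ 2 * (s⁻¹ * inner ℝ (∑ i, (P.m i)⁻¹ • r i • u i) gs)
          ≤ μ * (n * R) * R :=
        (mul_le_mul_of_nonneg_left h2 (by positivity)).trans
          (mul_le_of_le_one_left (by positivity) l1)
      have l3 : 0 ≤ ((s + η) ^ 2)⁻¹ * (P.κ r s * ‖gs‖ ^ 2) := by positivity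
      have l4 : μ * (n * R) * R = μ * n * N := by rw [← hRN]; ring
      linarith
    have h2 : -((p ^ 2)⁻¹ * inner ℝ (P.energyFlux r s gs u) gp) ≤ (δ ^ 2)⁻¹ * N := by
      have h3 := neg_le_of_abs_le (hin b5 b8)
      rw [hRN] at h3
      have h4 : (p ^ 2)⁻¹ ≤ (δ ^ 2)⁻¹ := by gcongr; exact h.p_mem.1
      have h5 : 0 ≤ (p ^ 2)⁻¹ := by positivity
      have h6 := mul_le_mul_of_nonneg_right h4 hN0
      nlinarith
    linarith
  have d4 : inner ℝ (P.energyFlux q p gp w)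
        ((2 * (s + η) * (p ^ 3)⁻¹) • gp - (p ^ 2)⁻¹ • gp - (p ^ 2)⁻¹ • gs)
      ≤ (2 * (M + 1) * (δ ^ 3)⁻¹ + (δ ^ 2)⁻¹ + (δ ^ 2)⁻¹) * N := by
    have h1 : ‖(2 * (s + η) * (p ^ 3)⁻¹) • gp - (p ^ 2)⁻¹ • gp - (p ^ 2)⁻¹ • gs‖
        ≤ 2 * (M + 1) * (δ ^ 3)⁻¹ * R + (δ ^ 2)⁻¹ * R + (δ ^ 2)⁻¹ * R := by
      refine (norm_sub_le _ _).trans (add_le_add ((norm_sub_le _ _).trans (add_le_add ?_ ?_)) ?_)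
      all_goals
        rw [norm_smul, Real.norm_of_nonneg (by positivity)]
        gcongr
      exacts [h.s_mem.2, hη.2, h.p_mem.1, h.p_mem.1, h.p_mem.1]
    refine ((le_abs_self _).trans (hin b6 h1)).trans_eq ?_
    rw [← hRN]
    ring
  unfold Model.entropyProduction
  have hdsum := Finset.sum_le_sum fun i (_ : i ∈ Finset.univ) => add_le_add (d1 i) (d2 i)
  simp only [Finset.sum_const, Finset.card_univ, Fintype.card_fin, nsmul_eq_mul] at hdsum
  rw [hC₁, hC₂]
  linarith

end EntropyProduction

/-! ### Affine changes of variable -/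

section Auxiliary

variable {Ω : Set Space3} {S : ℝ} {q q' : ℝ → Space3 → ℝ} {Q Q' : ℝ → Space3 → Space3}

lemma MemL2H1.add_const (hv : volume Ω ≠ ⊤) (hq : MemL2H1 Ω S q Q) (a : ℝ) :
    MemL2H1 Ω S (fun t x => q t x + a) Q := by
  simpa [add_comm] using hq.affine hv a 1

lemma MemL2H1.const_sub (hv : volume Ω ≠ ⊤) (hq : MemL2H1 Ω S q Q) (a : ℝ) :
    MemL2H1 Ω S (fun t x => a - q t x) (fun t x => -Q t x) := by
  simpa [sub_eq_add_neg] using hq.affine hv a (-1)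

lemma MemL2H1.aemeasurable (hq : MemL2H1 Ω S q Q) :
    AEMeasurable (fun z : ℝ × Space3 => q z.1 z.2) (volume.restrict (cyl Ω S)) :=
  hq.memLp.1.aemeasurable

end Auxiliary

/-! ### Relative entropy inequalities for two solutions -/

section SolutionPair

variable {n : ℕ}

/-- Two solutions with the same initial data and the bounds needed for their comparison; `R` is
their common total density, which does not depend on time. -/
structure Model.SolutionPair (P : Model n) (Ω : Set Space3) (T S M c δ V L : ℝ) (R : Space3 → ℝ)
    (ρ ρ' : Fin n → ℝ → Space3 → ℝ) (θ θ' : ℝ → Space3 → ℝ)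
    (gρ gρ' : Fin n → ℝ → Space3 → Space3) (gθ gθ' : ℝ → Space3 → Space3)
    (u u' : Fin n → ℝ → Space3 → Space3) : Prop where
  isOpen : IsOpen Ω
  volume_ne_top : volume Ω ≠ ⊤
  time_lt : S < T
  state : ∀ᵐ z ∂((volume : Measure (ℝ × Space3)).restrict (cyl Ω S)),
    P.StatePair M c δ V L (fun i => ρ i z.1 z.2) (fun i => ρ' i z.1 z.2) (θ z.1 z.2) (θ' z.1 z.2)
      (fun i => gρ i z.1 z.2) (fun i => gρ' i z.1 z.2) (gθ z.1 z.2) (gθ' z.1 z.2)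
      (fun i => u i z.1 z.2) (fun i => u' i z.1 z.2)
  ρ_reg : ∀ i, MemL2H1 Ω S (ρ i) (gρ i)
  ρ'_reg : ∀ i, MemL2H1 Ω S (ρ' i) (gρ' i)
  θ_reg : MemL2H1 Ω S θ gθ
  θ'_reg : MemL2H1 Ω S θ' gθ'
  logGrad_memLp : MemLp (fun z : ℝ × Space3 => (θ z.1 z.2)⁻¹ • gθ z.1 z.2) 2
    (volume.restrict (cyl Ω S))
  mass : ∀ i, WeakBalance Ω T (ρ i) (fun t x => ρ i t x • u i t x)
  mass' : ∀ i, WeakBalance Ω T (ρ' i) (fun t x => ρ' i t x • u' i t x)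
  energy : WeakBalance Ω T (fun t x => P.energy (fun i => ρ i t x) (θ t x))
    (fun t x => P.energyFlux (fun i => ρ i t x) (θ t x) (gθ t x) (fun i => u i t x))
  energy' : WeakBalance Ω T (fun t x => P.energy (fun i => ρ' i t x) (θ' t x))
    (fun t x => P.energyFlux (fun i => ρ' i t x) (θ' t x) (gθ' t x) (fun i => u' i t x))
  initial_ρ : ∀ i, ∀ᵐ x ∂(volume.restrict Ω), ρ i 0 x = ρ' i 0 x
  initial_θ : ∀ᵐ x ∂(volume.restrict Ω), θ 0 x = θ' 0 x
  total : ∀ᵐ z ∂((volume : Measure (ℝ × Space3)).restrict (cyl Ω S)), ∑ i, ρ i z.1 z.2 = R z.2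
  total' : ∀ᵐ z ∂((volume : Measure (ℝ × Space3)).restrict (cyl Ω S)), ∑ i, ρ' i z.1 z.2 = R z.2
  total_ge : ∀ᵐ z ∂((volume : Measure (ℝ × Space3)).restrict (cyl Ω S)), c ≤ R z.2

variable {P : Model n} {Ω : Set Space3} {T S M c δ V L : ℝ} {R : Space3 → ℝ}
  {ρ ρ' : Fin n → ℝ → Space3 → ℝ} {θ θ' : ℝ → Space3 → ℝ}
  {gρ gρ' : Fin n → ℝ → Space3 → Space3} {gθ gθ' : ℝ → Space3 → Space3}
  {u u' : Fin n → ℝ → Space3 → Space3}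

lemma sq_add_sub_le (r q η : ℝ) : (r + η - q) ^ 2 ≤ 2 * (r - q) ^ 2 + 2 * η ^ 2 := by
  nlinarith [sq_nonneg (r - q - η)]

lemma Model.SolutionPair.integrable_massEntropy
    (h : P.SolutionPair Ω T S M c δ V L R ρ ρ' θ θ' gρ gρ' gθ gθ' u u') (hc : 0 < c)
    {η : ℝ} (hη : η ∈ Ioc (0 : ℝ) 1) (i : Fin n) :
    Integrable (fun z : ℝ × Space3 => massEntropy (ρ i z.1 z.2 + η) (ρ' i z.1 z.2))
      (volume.restrict (cyl Ω S)) := by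
  have := isFiniteMeasure_restrict_cyl (S := S) h.volume_ne_top
  have hm : Measurable fun x : ℝ × ℝ => massEntropy x.1 x.2 := by
    unfold massEntropy
    fun_prop
  refine Integrable.of_bound (hm.comp_aemeasurable (((h.ρ_reg i).aemeasurable.add_const
    η).prodMk (h.ρ'_reg i).aemeasurable)).aestronglyMeasurable (c⁻¹ * (2 * M + 1) ^ 2) ?_
  filter_upwards [h.state] with z hz
  have h1 := hz.r_mem i
  have h2 := hz.q_mem i
  have h3 : 0 < ρ' i z.1 z.2 := hc.trans_le h2.1
  have h4 : 0 < ρ i z.1 z.2 + η := by linarith [hη.1]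
  rw [Real.norm_of_nonneg (massEntropy_nonneg h4 h3)]
  refine (massEntropy_le h4 h3).trans ?_
  rw [div_eq_inv_mul]
  gcongr ?_ * ?_
  · gcongr
    exact h2.1
  · refine sq_le_sq' ?_ ?_ <;> linarith [hη.1, hη.2]

/-- Relative entropy inequality for one mass density. -/
lemma Model.SolutionPair.massEntropy_inequality
    (h : P.SolutionPair Ω T S M c δ V L R ρ ρ' θ θ' gρ gρ' gθ gθ' u u') (hc : 0 < c)
    {η : ℝ} (hη : η ∈ Ioc (0 : ℝ) 1) {τ : ℝ} (hτ : 0 < τ) (hτS : τ < S) (k : ℕ) (i : Fin n) :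
    Integrable (fun z : ℝ × Space3 =>
        (inner ℝ (ρ i z.1 z.2 • u i z.1 z.2) ((ρ i z.1 z.2 + η)⁻¹ • gρ i z.1 z.2
            - (ρ' i z.1 z.2)⁻¹ • gρ' i z.1 z.2)
          + inner ℝ (ρ' i z.1 z.2 • u' i z.1 z.2)
            (((ρ i z.1 z.2 + η) * (ρ' i z.1 z.2 ^ 2)⁻¹) • gρ' i z.1 z.2
              - (ρ' i z.1 z.2)⁻¹ • gρ i z.1 z.2)))
        (volume.restrict (cyl Ω S)) ∧
    ∫ z in cyl Ω τ, ((k + 1) * (τ - z.1) ^ k) * massEntropy (ρ i z.1 z.2 + η) (ρ' i z.1 z.2)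
      ≤ τ ^ (k + 1) * (2 * η ^ 2 * c⁻¹ * volume.real Ω) + ∫ z in cyl Ω τ, (τ - z.1) ^ (k + 1) *
        (inner ℝ (ρ i z.1 z.2 • u i z.1 z.2) ((ρ i z.1 z.2 + η)⁻¹ • gρ i z.1 z.2
            - (ρ' i z.1 z.2)⁻¹ • gρ' i z.1 z.2)
          + inner ℝ (ρ' i z.1 z.2 • u' i z.1 z.2)
            (((ρ i z.1 z.2 + η) * (ρ' i z.1 z.2 ^ 2)⁻¹) • gρ' i z.1 z.2
              - (ρ' i z.1 z.2)⁻¹ • gρ i z.1 z.2)) := by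
  have hv := h.volume_ne_top
  have hr1 : ∀ᵐ z ∂((volume : Measure (ℝ × Space3)).restrict (cyl Ω S)),
      η ≤ ρ i z.1 z.2 + η ∧ ρ i z.1 z.2 + η ≤ M + 1 := by
    filter_upwards [h.state] with z hz
    exact ⟨by linarith [(hz.r_mem i).1], by linarith [(hz.r_mem i).2, hη.2]⟩
  have hq1 : ∀ᵐ z ∂((volume : Measure (ℝ × Space3)).restrict (cyl Ω S)),
      c ≤ ρ' i z.1 z.2 ∧ ρ' i z.1 z.2 ≤ M := by
    filter_upwards [h.state] with z hz using hz.q_mem i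
  have hrη := (h.ρ_reg i).add_const hv η
  have hψ := (hrη.log h.isOpen hv hη.1 hr1).sub ((h.ρ'_reg i).log h.isOpen hv hc hq1)
  have hinv := (h.ρ'_reg i).inv h.isOpen hv hc (hq1.mono fun z hz => hz.1)
  have hψ' : MemL2H1 Ω S (fun t x => 1 - (ρ i t x + η) * (ρ' i t x)⁻¹)
      (fun t x => ((ρ i t x + η) * (ρ' i t x ^ 2)⁻¹) • gρ' i t x - (ρ' i t x)⁻¹ • gρ i t x) := by
    have h1 := (hrη.mul h.isOpen hv hinv (B := max (M + 1) c⁻¹)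
      (by
        filter_upwards [hr1] with z hz
        rw [abs_of_nonneg (hη.1.le.trans hz.1)]
        exact le_max_of_le_left hz.2)
      (by
        filter_upwards [hq1] with z hz
        have : 0 < ρ' i z.1 z.2 := hc.trans_le hz.1
        rw [abs_of_pos (by positivity)]
        refine le_max_of_le_right ?_
        gcongr
        exact hz.1)).const_sub hv 1
    convert h1 using 3 with t x
    module
  refine ⟨(integrable_inner_of_memLp ((h.mass i).2.1 S h.time_lt) hψ.memLp_grad).add
    (integrable_inner_of_memLp ((h.mass' i).2.1 S h.time_lt) hψ'.memLp_grad), ?_⟩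
  -- The constants `L` and `κ₀` come from `massEntropy_le` with `ρ' ≥ c` and `(r + η - q)² ≤ 2(r -
  -- q)² + 2η²`; `C` is that of `massEntropy_taylor`, the shifted density being at most `M + 1`.
  refine entropy_inequality (a := ρ i) (a' := ρ' i) (q := ρ i) (q' := ρ' i)
    (Y := fun t x => massEntropy (ρ i t x + η) (ρ' i t x)) (L := 2 * c⁻¹)
    (κ₀ := 2 * η ^ 2 * c⁻¹) (C := η⁻¹ + c⁻¹ + (M + 1) * (c ^ 2)⁻¹) h.isOpen.measurableSet hv hτ hτS
    h.time_lt k (h.mass i) (h.mass' i) (h.ρ_reg i).memLp (h.ρ'_reg i).memLp (h.ρ_reg i)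
    (h.ρ'_reg i) hψ hψ' (h.integrable_massEntropy hc hη i) ?_ (h.initial_ρ i) (by positivity) ?_ ?_
  · filter_upwards [hr1, hq1] with z h1 h2
    exact massEntropy_nonneg (hη.1.trans_le h1.1) (hc.trans_le h2.1)
  · filter_upwards [hr1, hq1] with z h1 h2
    have h3 : 0 < ρ' i z.1 z.2 := hc.trans_le h2.1
    refine (massEntropy_le (hη.1.trans_le h1.1) h3).trans ?_
    rw [div_eq_inv_mul]
    calc _ ≤ c⁻¹ * (2 * (ρ i z.1 z.2 - ρ' i z.1 z.2) ^ 2 + 2 * η ^ 2) := by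
          gcongr ?_ * ?_
          · gcongr
            exact h2.1
          · exact sq_add_sub_le _ _ _
      _ = _ := by ring
  · intro s hs hsS
    have hΩ := h.isOpen.measurableSet
    filter_upwards [ae_shift (p := fun t x => η ≤ ρ i t x + η ∧ ρ i t x + η ≤ M + 1) hΩ hs hsS hr1,
      ae_shift (p := fun t x => c ≤ ρ' i t x ∧ ρ' i t x ≤ M) hΩ hs hsS hq1,
      ae_restrict_of_ae_restrict_of_subset (cyl_mono hτS.le) hr1,
      ae_restrict_of_ae_restrict_of_subset (cyl_mono hτS.le) hq1] with z h1 h2 h3 h4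
    refine (massEntropy_taylor hη.1 hc h3.1 h1.1 h1.2 h4.1 h2.1).trans_eq ?_
    ring

lemma Model.SolutionPair.total_le
    (h : P.SolutionPair Ω T S M c δ V L R ρ ρ' θ θ' gρ gρ' gθ gθ' u u') :
    ∀ᵐ z ∂((volume : Measure (ℝ × Space3)).restrict (cyl Ω S)), R z.2 ≤ n * M := by
  filter_upwards [h.state, h.total] with z h1 h2
  rw [← h2]
  calc _ ≤ ∑ i : Fin n, M := Finset.sum_le_sum fun i _ => (h1.r_mem i).2
    _ = _ := by simp

lemma Model.SolutionPair.aemeasurable_total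
    (h : P.SolutionPair Ω T S M c δ V L R ρ ρ' θ θ' gρ gρ' gθ gθ' u u') :
    AEMeasurable (fun z : ℝ × Space3 => R z.2) (volume.restrict (cyl Ω S)) :=
  (Finset.aemeasurable_fun_sum Finset.univ fun i _ => (h.ρ_reg i).aemeasurable).congr h.total

lemma Model.SolutionPair.integrable_heatEntropy
    (h : P.SolutionPair Ω T S M c δ V L R ρ ρ' θ θ' gρ gρ' gθ gθ' u u') (hP : P.IsAdmissible)
    (hc : 0 < c) (hδ : 0 < δ) {η : ℝ} (hη : η ∈ Ioc (0 : ℝ) 1) :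
    Integrable (fun z : ℝ × Space3 => P.cw * R z.2 * heatEntropy (θ z.1 z.2 + η) (θ' z.1 z.2))
      (volume.restrict (cyl Ω S)) := by
  have := isFiniteMeasure_restrict_cyl (S := S) h.volume_ne_top
  have hm : Measurable fun x : ℝ × ℝ => heatEntropy x.1 x.2 := by
    unfold heatEntropy
    fun_prop
  have hcw := hP.cw_pos
  refine Integrable.of_bound ((h.aemeasurable_total.const_mul P.cw).mul (hm.comp_aemeasurable
    ((h.θ_reg.aemeasurable.add_const η).prodMk h.θ'_reg.aemeasurable))).aestronglyMeasurable
    (P.cw * (n * M) * ((η * δ)⁻¹ * (2 * M + 1) ^ 2)) ?_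
  filter_upwards [h.state, h.total_le, h.total_ge] with z hz hR hR'
  have h1 := hz.s_mem
  have h2 := hz.p_mem
  have h3 : 0 < θ' z.1 z.2 := hδ.trans_le h2.1
  have h4 : 0 < θ z.1 z.2 + η := by linarith [hη.1]
  have h5 : 0 < R z.2 := hc.trans_le hR'
  have h6 := heatEntropy_nonneg h4 h3
  have hη0 := hη.1
  rw [Real.norm_of_nonneg (by positivity)]
  have h7 : heatEntropy (θ z.1 z.2 + η) (θ' z.1 z.2) ≤ (η * δ)⁻¹ * (2 * M + 1) ^ 2 := by
    refine (heatEntropy_le h4 h3).trans ?_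
    rw [div_eq_inv_mul]
    gcongr ?_ * ?_
    · gcongr
      · linarith
      · exact h2.1
    · refine sq_le_sq' ?_ ?_ <;> linarith [hη.1, hη.2]
  have hM : 0 < M := h1.1.trans_le h1.2
  gcongr

/-- Relative entropy inequality for the temperature. -/
lemma Model.SolutionPair.heatEntropy_inequality
    (h : P.SolutionPair Ω T S M c δ V L R ρ ρ' θ θ' gρ gρ' gθ gθ' u u') (hP : P.IsAdmissible)
    (hc : 0 < c) (hδ : 0 < δ) {η : ℝ} (hη : η ∈ Ioc (0 : ℝ) 1) {τ : ℝ} (hτ : 0 < τ)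
    (hτS : τ < S) (k : ℕ) :
    Integrable (fun z : ℝ × Space3 =>
        (inner ℝ (P.energyFlux (fun i => ρ i z.1 z.2) (θ z.1 z.2) (gθ z.1 z.2)
            (fun i => u i z.1 z.2))
            (((θ z.1 z.2 + η) ^ 2)⁻¹ • gθ z.1 z.2 - (θ' z.1 z.2 ^ 2)⁻¹ • gθ' z.1 z.2)
          + inner ℝ (P.energyFlux (fun i => ρ' i z.1 z.2) (θ' z.1 z.2) (gθ' z.1 z.2)
            (fun i => u' i z.1 z.2))
            ((2 * (θ z.1 z.2 + η) * (θ' z.1 z.2 ^ 3)⁻¹) • gθ' z.1 z.2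
              - (θ' z.1 z.2 ^ 2)⁻¹ • gθ' z.1 z.2 - (θ' z.1 z.2 ^ 2)⁻¹ • gθ z.1 z.2)))
        (volume.restrict (cyl Ω S)) ∧
    ∫ z in cyl Ω τ, ((k + 1) * (τ - z.1) ^ k)
        * (P.cw * R z.2 * heatEntropy (θ z.1 z.2 + η) (θ' z.1 z.2))
      ≤ τ ^ (k + 1) * (P.cw * (n * M) * (2 * η * δ⁻¹) * volume.real Ω)
        + ∫ z in cyl Ω τ, (τ - z.1) ^ (k + 1) *
        (inner ℝ (P.energyFlux (fun i => ρ i z.1 z.2) (θ z.1 z.2) (gθ z.1 z.2)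
            (fun i => u i z.1 z.2))
            (((θ z.1 z.2 + η) ^ 2)⁻¹ • gθ z.1 z.2 - (θ' z.1 z.2 ^ 2)⁻¹ • gθ' z.1 z.2)
          + inner ℝ (P.energyFlux (fun i => ρ' i z.1 z.2) (θ' z.1 z.2) (gθ' z.1 z.2)
            (fun i => u' i z.1 z.2))
            ((2 * (θ z.1 z.2 + η) * (θ' z.1 z.2 ^ 3)⁻¹) • gθ' z.1 z.2
              - (θ' z.1 z.2 ^ 2)⁻¹ • gθ' z.1 z.2 - (θ' z.1 z.2 ^ 2)⁻¹ • gθ z.1 z.2)) := by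
  have hv := h.volume_ne_top
  have := isFiniteMeasure_restrict_cyl (S := S) hv
  have hcw := hP.cw_pos
  have hw1 : ∀ᵐ z ∂((volume : Measure (ℝ × Space3)).restrict (cyl Ω S)),
      η ≤ θ z.1 z.2 + η ∧ θ z.1 z.2 + η ≤ M + 1 := by
    filter_upwards [h.state] with z hz
    exact ⟨by linarith [hz.s_mem.1], by linarith [hz.s_mem.2, hη.2]⟩
  have hs1 : ∀ᵐ z ∂((volume : Measure (ℝ × Space3)).restrict (cyl Ω S)),
      δ ≤ θ' z.1 z.2 ∧ θ' z.1 z.2 ≤ M := by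
    filter_upwards [h.state] with z hz using hz.p_mem
  -- Because `R` is independent of time, increments of the energy are `c_w R` times increments of
  -- the temperature, and the product with the latter is `c_w R` times a square.
  have hE : ∀ᵐ z ∂((volume : Measure (ℝ × Space3)).restrict (cyl Ω S)),
      P.energy (fun i => ρ i z.1 z.2) (θ z.1 z.2) = P.cw * R z.2 * θ z.1 z.2 := by
    filter_upwards [h.total] with z hz
    rw [P.energy_eq, hz]
  have hE' : ∀ᵐ z ∂((volume : Measure (ℝ × Space3)).restrict (cyl Ω S)),
      P.energy (fun i => ρ' i z.1 z.2) (θ' z.1 z.2) = P.cw * R z.2 * θ' z.1 z.2 := by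
    filter_upwards [h.total'] with z hz
    rw [P.energy_eq, hz]
  have hmE : MemLp (fun z : ℝ × Space3 => P.energy (fun i => ρ i z.1 z.2) (θ z.1 z.2)) 2
      (volume.restrict (cyl Ω S)) := by
    refine MemLp.ae_eq (hE.mono fun z hz => hz.symm) (MemLp.of_le_mul (c := P.cw * (n * M))
      h.θ_reg.memLp ((h.aemeasurable_total.const_mul P.cw).mul
        h.θ_reg.aemeasurable).aestronglyMeasurable ?_)
    filter_upwards [h.total_le, h.total_ge] with z h1 h2
    have h3 := hc.trans_le h2
    rw [norm_mul, Real.norm_of_nonneg (by positivity)]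
    gcongr
  have hmE' : MemLp (fun z : ℝ × Space3 => P.energy (fun i => ρ' i z.1 z.2) (θ' z.1 z.2)) 2
      (volume.restrict (cyl Ω S)) := by
    refine MemLp.ae_eq (hE'.mono fun z hz => hz.symm) (MemLp.of_le_mul (c := P.cw * (n * M))
      h.θ'_reg.memLp ((h.aemeasurable_total.const_mul P.cw).mul
        h.θ'_reg.aemeasurable).aestronglyMeasurable ?_)
    filter_upwards [h.total_le, h.total_ge] with z h1 h2
    have h3 := hc.trans_le h2
    rw [norm_mul, Real.norm_of_nonneg (by positivity)]
    gcongr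
  have hwη := h.θ_reg.add_const hv η
  have hinv := h.θ'_reg.inv h.isOpen hv hδ (hs1.mono fun z hz => hz.1)
  have hinvB : ∀ᵐ z ∂((volume : Measure (ℝ × Space3)).restrict (cyl Ω S)),
      |(θ' z.1 z.2)⁻¹| ≤ δ⁻¹ := by
    filter_upwards [hs1] with z hz
    have : 0 < θ' z.1 z.2 := hδ.trans_le hz.1
    rw [abs_of_pos (by positivity)]
    gcongr
    exact hz.1
  have hψ : MemL2H1 Ω S (fun t x => (θ' t x)⁻¹ - (θ t x + η)⁻¹)
      (fun t x => ((θ t x + η) ^ 2)⁻¹ • gθ t x - (θ' t x ^ 2)⁻¹ • gθ' t x) := by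
    have h1 := hinv.sub (hwη.inv h.isOpen hv hη.1 (hw1.mono fun z hz => hz.1))
    convert h1 using 3 with t x
    module
  have hψ' : MemL2H1 Ω S (fun t x => (θ' t x)⁻¹ - (θ t x + η) * ((θ' t x)⁻¹ * (θ' t x)⁻¹))
      (fun t x => (2 * (θ t x + η) * (θ' t x ^ 3)⁻¹) • gθ' t x
              - (θ' t x ^ 2)⁻¹ • gθ' t x - (θ' t x ^ 2)⁻¹ • gθ t x) := by
    have h1 := hinv.sub (hwη.mul h.isOpen hv (hinv.mul h.isOpen hv hinv hinvB hinvB)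
      (B := max (M + 1) (δ⁻¹ * δ⁻¹))
      (by
        filter_upwards [hw1] with z hz
        rw [abs_of_nonneg (hη.1.le.trans hz.1)]
        exact le_max_of_le_left hz.2)
      (by
        filter_upwards [hinvB] with z hz
        rw [abs_mul]
        refine le_max_of_le_right ?_
        gcongr))
    convert h1 using 3 with t x
    match_scalars <;> ring
  refine ⟨(integrable_inner_of_memLp (h.energy.2.1 S h.time_lt) hψ.memLp_grad).add
    (integrable_inner_of_memLp (h.energy'.2.1 S h.time_lt) hψ'.memLp_grad), ?_⟩
  -- The balanced quantity is the energy while the `H¹` function is the temperature. In `κ₀` the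
  -- quotient `2η²/(ηδ)` leaves a single power of `η`, which still vanishes in the limit.
  refine entropy_inequality (a := fun t x => P.energy (fun i => ρ i t x) (θ t x))
    (a' := fun t x => P.energy (fun i => ρ' i t x) (θ' t x)) (q := θ) (q' := θ')
    (Y := fun t x => P.cw * R x * heatEntropy (θ t x + η) (θ' t x)) (L := 2 * (η * δ)⁻¹)
    (κ₀ := P.cw * (n * M) * (2 * η * δ⁻¹)) (C := (η ^ 2)⁻¹ + (δ ^ 2)⁻¹ + (M + 1) * (δ ^ 3)⁻¹)
    h.isOpen.measurableSet hv hτ hτS h.time_lt k h.energy h.energy' hmE hmE' h.θ_reg h.θ'_reg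
    hψ hψ' (h.integrable_heatEntropy hP hc hδ hη) ?_ ?_ ?_ ?_ ?_
  · filter_upwards [hw1, hs1, h.total_ge] with z h1 h2 h3
    have h4 := heatEntropy_nonneg (hη.1.trans_le h1.1) (hδ.trans_le h2.1)
    have h5 := hc.trans_le h3
    positivity
  · filter_upwards [ae_all_iff.2 h.initial_ρ, h.initial_θ] with x h1 h2
    rw [h2]
    congr 1
    funext i
    exact h1 i
  · have := hη.1
    positivity
  · filter_upwards [hw1, hs1, h.total_ge, h.total_le, hE, hE'] with z h1 h2 h3 h4 h5 h6
    have hη0 := hη.1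
    have k1 := hc.trans_le h3
    have k0 : 0 < θ z.1 z.2 + η := hη0.trans_le h1.1
    have k2 : 0 < θ' z.1 z.2 := hδ.trans_le h2.1
    have k3 : heatEntropy (θ z.1 z.2 + η) (θ' z.1 z.2)
        ≤ (η * δ)⁻¹ * (2 * (θ z.1 z.2 - θ' z.1 z.2) ^ 2 + 2 * η ^ 2) := by
      refine (heatEntropy_le (hη.1.trans_le h1.1) k2).trans ?_
      rw [div_eq_inv_mul]
      gcongr ?_ * ?_
      · gcongr
        exacts [h1.1, h2.1]
      · exact sq_add_sub_le _ _ _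
    rw [h5, h6]
    calc _ ≤ P.cw * R z.2 * ((η * δ)⁻¹ * (2 * (θ z.1 z.2 - θ' z.1 z.2) ^ 2 + 2 * η ^ 2)) := by
          gcongr
      _ = P.cw * R z.2 * (2 * η * δ⁻¹) + 2 * (η * δ)⁻¹ * ((P.cw * R z.2 * θ z.1 z.2
          - P.cw * R z.2 * θ' z.1 z.2) * (θ z.1 z.2 - θ' z.1 z.2)) := by
          field_simp
          ring
      _ ≤ _ := by gcongr
  · intro s hs hsS
    have hΩ := h.isOpen.measurableSet
    filter_upwards [ae_shift (p := fun t x => η ≤ θ t x + η ∧ θ t x + η ≤ M + 1) hΩ hs hsS hw1,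
      ae_shift (p := fun t x => δ ≤ θ' t x ∧ θ' t x ≤ M) hΩ hs hsS hs1,
      ae_restrict_of_ae_restrict_of_subset (cyl_mono hτS.le) hw1,
      ae_restrict_of_ae_restrict_of_subset (cyl_mono hτS.le) hs1,
      ae_shift (p := fun t x => P.energy (fun i => ρ i t x) (θ t x) = P.cw * R x * θ t x)
        hΩ hs hsS hE,
      ae_shift (p := fun t x => P.energy (fun i => ρ' i t x) (θ' t x) = P.cw * R x * θ' t x)
        hΩ hs hsS hE',
      ae_restrict_of_ae_restrict_of_subset (cyl_mono hτS.le) hE,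
      ae_restrict_of_ae_restrict_of_subset (cyl_mono hτS.le) hE',
      ae_restrict_of_ae_restrict_of_subset (cyl_mono hτS.le) h.total_ge]
      with z h1 h2 h3 h4 h5 h6 h7 h8 h9
    have k1 := hc.trans_le h9
    rw [h5, h6, h7, h8, ← mul_sub]
    refine (mul_le_mul_of_nonneg_left (heatEntropy_taylor hη.1 hδ h3.1 h1.1 h1.2 h4.1 h2.1)
      (by positivity)).trans_eq ?_
    ring

end SolutionPair

/-! ### Stability estimate and uniqueness almost everywhere -/

section Comparison

open Filter Topology

variable {n : ℕ} {P : Model n} {Ω : Set Space3} {T S M c δ V L : ℝ} {R : Space3 → ℝ}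
  {ρ ρ' : Fin n → ℝ → Space3 → ℝ} {θ θ' : ℝ → Space3 → ℝ}
  {gρ gρ' : Fin n → ℝ → Space3 → Space3} {gθ gθ' : ℝ → Space3 → Space3}
  {u u' : Fin n → ℝ → Space3 → Space3}

/-- Squared distance of two solutions. -/
def distSq (ρ ρ' : Fin n → ℝ → Space3 → ℝ) (θ θ' : ℝ → Space3 → ℝ) (t : ℝ) (x : Space3) : ℝ :=
  ∑ i, (ρ i t x - ρ' i t x) ^ 2 + (θ t x - θ' t x) ^ 2

lemma distSq_nonneg (t : ℝ) (x : Space3) : 0 ≤ distSq ρ ρ' θ θ' t x := by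
  unfold distSq
  have := Finset.sum_nonneg fun i (_ : i ∈ Finset.univ) => sq_nonneg (ρ i t x - ρ' i t x)
  positivity

/-- The entropy production of a pair of solutions. -/
noncomputable def Model.production (P : Model n) (η : ℝ) (ρ ρ' : Fin n → ℝ → Space3 → ℝ)
    (θ θ' : ℝ → Space3 → ℝ) (gρ gρ' : Fin n → ℝ → Space3 → Space3) (gθ gθ' : ℝ → Space3 → Space3)
    (u u' : Fin n → ℝ → Space3 → Space3) (t : ℝ) (x : Space3) : ℝ :=
  P.entropyProduction η (fun i => ρ i t x) (fun i => ρ' i t x) (θ t x) (θ' t x)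
    (fun i => gρ i t x) (fun i => gρ' i t x) (gθ t x) (gθ' t x) (fun i => u i t x)
    (fun i => u' i t x)

/-- The total relative entropy of a pair of solutions. -/
noncomputable def Model.relEntropy (P : Model n) (η : ℝ) (R : Space3 → ℝ)
    (ρ ρ' : Fin n → ℝ → Space3 → ℝ) (θ θ' : ℝ → Space3 → ℝ) (t : ℝ) (x : Space3) : ℝ :=
  ∑ i, (P.m i)⁻¹ * massEntropy (ρ i t x + η) (ρ' i t x)
    + P.cw * R x * heatEntropy (θ t x + η) (θ' t x)

lemma abs_sub_pow_le {τ : ℝ} (m : ℕ) : ∀ t ∈ Ioo 0 τ, |(τ - t) ^ m| ≤ τ ^ m := by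
  intro t ht
  rw [abs_pow, abs_of_pos (by linarith [ht.2])]
  exact pow_le_pow_left₀ (by linarith [ht.2]) (by linarith [ht.1]) m

lemma integrable_weight_mul (hΩ : MeasurableSet Ω) {F : ℝ → Space3 → ℝ} {τ : ℝ} (hτS : τ ≤ S)
    (m : ℕ) (hF : Integrable (fun z : ℝ × Space3 => F z.1 z.2) (volume.restrict (cyl Ω S))) :
    Integrable (fun z : ℝ × Space3 => (τ - z.1) ^ m * F z.1 z.2) (volume.restrict (cyl Ω τ)) :=
  integrable_bounded_mul (χ := fun t => (τ - t) ^ m) hΩ (by fun_prop) (abs_sub_pow_le m)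
    (hF.mono_measure (restrict_cyl_mono hτS))

/-- Relative entropy inequality for a pair of solutions. -/
lemma Model.SolutionPair.relEntropy_inequality
    (h : P.SolutionPair Ω T S M c δ V L R ρ ρ' θ θ' gρ gρ' gθ gθ' u u') (hP : P.IsAdmissible)
    (hc : 0 < c) (hδ : 0 < δ) {η : ℝ} (hη : η ∈ Ioc (0 : ℝ) 1) {τ : ℝ} (hτ : 0 < τ)
    (hτS : τ < S) (k : ℕ) :
    Integrable (fun z : ℝ × Space3 => P.relEntropy η R ρ ρ' θ θ' z.1 z.2)
        (volume.restrict (cyl Ω S)) ∧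
    Integrable (fun z : ℝ × Space3 => P.production η ρ ρ' θ θ' gρ gρ' gθ gθ' u u' z.1 z.2)
        (volume.restrict (cyl Ω S)) ∧
    ∫ z in cyl Ω τ, ((k + 1) * (τ - z.1) ^ k) * P.relEntropy η R ρ ρ' θ θ' z.1 z.2
      ≤ τ ^ (k + 1) * ((∑ i, (P.m i)⁻¹ * (2 * η ^ 2 * c⁻¹) + P.cw * (n * M) * (2 * η * δ⁻¹))
          * volume.real Ω)
        + ∫ z in cyl Ω τ, (τ - z.1) ^ (k + 1)
          * P.production η ρ ρ' θ θ' gρ gρ' gθ gθ' u u' z.1 z.2 := by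
  have hΩ := h.isOpen.measurableSet
  have hmi := fun i => h.massEntropy_inequality hc hη hτ hτS k i
  obtain ⟨hB, hheat⟩ := h.heatEntropy_inequality hP hc hδ hη hτ hτS k
  have hYi := fun i => h.integrable_massEntropy hc hη i
  have hYh := h.integrable_heatEntropy hP hc hδ hη
  set A : Fin n → ℝ → Space3 → ℝ := fun i t x =>
    inner ℝ (ρ i t x • u i t x) ((ρ i t x + η)⁻¹ • gρ i t x - (ρ' i t x)⁻¹ • gρ' i t x)
      + inner ℝ (ρ' i t x • u' i t x) (((ρ i t x + η) * (ρ' i t x ^ 2)⁻¹) • gρ' i t x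
        - (ρ' i t x)⁻¹ • gρ i t x) with hA
  set B : ℝ → Space3 → ℝ := fun t x =>
    inner ℝ (P.energyFlux (fun i => ρ i t x) (θ t x) (gθ t x) (fun i => u i t x))
        (((θ t x + η) ^ 2)⁻¹ • gθ t x - (θ' t x ^ 2)⁻¹ • gθ' t x)
      + inner ℝ (P.energyFlux (fun i => ρ' i t x) (θ' t x) (gθ' t x) (fun i => u' i t x))
        ((2 * (θ t x + η) * (θ' t x ^ 3)⁻¹) • gθ' t x - (θ' t x ^ 2)⁻¹ • gθ' t x
          - (θ' t x ^ 2)⁻¹ • gθ t x) with hBdef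
  have eprod : ∀ t x, P.production η ρ ρ' θ θ' gρ gρ' gθ gθ' u u' t x
      = ∑ i, (P.m i)⁻¹ * A i t x + B t x := by
    intro t x
    simp only [Model.production, Model.entropyProduction, hA, hBdef,
      real_inner_smul_right _ _ (P.m _)⁻¹, mul_add]
  have iA : ∀ i, Integrable (fun z : ℝ × Space3 => A i z.1 z.2) (volume.restrict (cyl Ω S)) :=
    fun i => (hmi i).1
  have iB : Integrable (fun z : ℝ × Space3 => B z.1 z.2) (volume.restrict (cyl Ω S)) := hB
  have hprod : Integrable (fun z : ℝ × Space3 =>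
      P.production η ρ ρ' θ θ' gρ gρ' gθ gθ' u u' z.1 z.2) (volume.restrict (cyl Ω S)) := by
    simp only [eprod]
    exact (integrable_finsetSum _ fun i _ => (iA i).const_mul _).add iB
  have hrel : Integrable (fun z : ℝ × Space3 => P.relEntropy η R ρ ρ' θ θ' z.1 z.2)
      (volume.restrict (cyl Ω S)) := by
    unfold Model.relEntropy
    exact (integrable_finsetSum _ fun i _ => (hYi i).const_mul _).add hYh
  refine ⟨hrel, hprod, ?_⟩
  have w1 := fun i => integrable_weight_mul
    (F := fun t x => massEntropy (ρ i t x + η) (ρ' i t x)) hΩ hτS.le k (hYi i)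
  have w2 := integrable_weight_mul
    (F := fun t x => P.cw * R x * heatEntropy (θ t x + η) (θ' t x)) hΩ hτS.le k hYh
  have w3 := fun i => integrable_weight_mul (F := A i) hΩ hτS.le (k + 1) (iA i)
  have w4 := integrable_weight_mul (F := B) hΩ hτS.le (k + 1) iB
  have el : ∫ z in cyl Ω τ, ((k + 1) * (τ - z.1) ^ k) * P.relEntropy η R ρ ρ' θ θ' z.1 z.2
      = ∑ i, (P.m i)⁻¹ * (∫ z in cyl Ω τ, ((k + 1) * (τ - z.1) ^ k)
          * massEntropy (ρ i z.1 z.2 + η) (ρ' i z.1 z.2))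
        + ∫ z in cyl Ω τ, ((k + 1) * (τ - z.1) ^ k)
          * (P.cw * R z.2 * heatEntropy (θ z.1 z.2 + η) (θ' z.1 z.2)) := by
    simp only [← integral_const_mul]
    rw [← integral_finsetSum, ← integral_add]
    · refine integral_congr_ae (Eventually.of_forall fun z => ?_)
      simp only [Model.relEntropy, mul_add, Finset.mul_sum]
      congr 1
      refine Finset.sum_congr rfl fun i _ => ?_
      ring
    · refine integrable_finsetSum _ fun i _ => ?_
      simpa [mul_assoc] using ((w1 i).const_mul ((k : ℝ) + 1)).const_mul (P.m i)⁻¹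
    · simpa [mul_assoc] using w2.const_mul ((k : ℝ) + 1)
    · intro i _
      simpa [mul_assoc] using ((w1 i).const_mul ((k : ℝ) + 1)).const_mul (P.m i)⁻¹
  have er : ∫ z in cyl Ω τ, (τ - z.1) ^ (k + 1)
        * P.production η ρ ρ' θ θ' gρ gρ' gθ gθ' u u' z.1 z.2
      = ∑ i, (P.m i)⁻¹ * (∫ z in cyl Ω τ, (τ - z.1) ^ (k + 1) * A i z.1 z.2)
        + ∫ z in cyl Ω τ, (τ - z.1) ^ (k + 1) * B z.1 z.2 := by
    simp only [← integral_const_mul]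
    rw [← integral_finsetSum, ← integral_add]
    · refine integral_congr_ae (Eventually.of_forall fun z => ?_)
      simp only [eprod, mul_add, Finset.mul_sum]
      congr 1
      refine Finset.sum_congr rfl fun i _ => ?_
      ring
    · exact integrable_finsetSum _ fun i _ => (w3 i).const_mul (P.m i)⁻¹
    · exact w4
    · intro i _
      exact (w3 i).const_mul (P.m i)⁻¹
  rw [el, er]
  have hmi' : ∀ i, ∫ z in cyl Ω τ, ((k + 1) * (τ - z.1) ^ k)
      * massEntropy (ρ i z.1 z.2 + η) (ρ' i z.1 z.2) ≤ τ ^ (k + 1) * (2 * η ^ 2 * c⁻¹ *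
        volume.real Ω) + ∫ z in cyl Ω τ, (τ - z.1) ^ (k + 1) * A i z.1 z.2 := fun i => (hmi i).2
  have hheat' : ∫ z in cyl Ω τ, ((k + 1) * (τ - z.1) ^ k)
      * (P.cw * R z.2 * heatEntropy (θ z.1 z.2 + η) (θ' z.1 z.2))
      ≤ τ ^ (k + 1) * (P.cw * (n * M) * (2 * η * δ⁻¹) * volume.real Ω)
        + ∫ z in cyl Ω τ, (τ - z.1) ^ (k + 1) * B z.1 z.2 := hheat
  have hsum := Finset.sum_le_sum fun i (_ : i ∈ Finset.univ) =>
    mul_le_mul_of_nonneg_left (hmi' i) (inv_nonneg.2 (hP.m_pos i).le)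
  refine (add_le_add hsum hheat').trans_eq ?_
  have e1 : ∑ i, (P.m i)⁻¹ * (τ ^ (k + 1) * (2 * η ^ 2 * c⁻¹ * volume.real Ω))
      = (∑ i, (P.m i)⁻¹ * (2 * η ^ 2 * c⁻¹)) * (τ ^ (k + 1) * volume.real Ω) := by
    rw [Finset.sum_mul]
    refine Finset.sum_congr rfl fun i _ => ?_
    ring
  simp only [mul_add (P.m _)⁻¹, Finset.sum_add_distrib]
  rw [e1]
  ring

/-- The relative entropy controls the distance of the solutions. -/
lemma Model.SolutionPair.exists_relEntropy_ge (hP : P.IsAdmissible) (hc : 0 < c) (hδ : 0 < δ)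
    (hM : 0 < M) :
    ∃ α > 0, ∃ β > 0, ∀ (R : Space3 → ℝ) (ρ ρ' : Fin n → ℝ → Space3 → ℝ) (θ θ' : ℝ → Space3 → ℝ)
      (t : ℝ) (x : Space3) (η : ℝ), η ∈ Ioc (0 : ℝ) 1 → c ≤ R x → R x ≤ n * M →
      (∀ i, 0 < ρ i t x ∧ ρ i t x ≤ M) → (∀ i, c ≤ ρ' i t x ∧ ρ' i t x ≤ M) →
      0 < θ t x ∧ θ t x ≤ M → δ ≤ θ' t x ∧ θ' t x ≤ M →
      α * distSq ρ ρ' θ θ' t x - β * η ^ 2 ≤ P.relEntropy η R ρ ρ' θ θ' t x := by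
  obtain ⟨ν, hν, hνm⟩ := exists_pos_forall_le fun i => inv_pos.2 (hP.m_pos i)
  obtain ⟨μ, hμ, hμm⟩ := exists_pos_forall_ge fun i => (P.m i)⁻¹
  have hcw := hP.cw_pos
  refine ⟨min (ν / (8 * (M + 1))) (P.cw * c / (8 * (M + 1) ^ 2)), by positivity,
    n * μ / (4 * (M + 1)) + P.cw * (n * M) / (4 * (M + 1) ^ 2) + 1, by positivity, ?_⟩
  intro R ρ ρ' θ θ' t x η hη hR hR' hr hq hs hp
  set α := min (ν / (8 * (M + 1))) (P.cw * c / (8 * (M + 1) ^ 2)) with hα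
  have hη0 := hη.1
  -- Removing the shift halves the quadratic term, which turns the constants `4` of the entropy
  -- bounds into the `8` in `α`.
  have hsq : ∀ r q : ℝ, (r - q) ^ 2 / 2 - η ^ 2 ≤ (r + η - q) ^ 2 := fun r q => by
    nlinarith [sq_nonneg (r - q + 2 * η)]
  have h1 : ∀ i, α * (ρ i t x - ρ' i t x) ^ 2 - μ / (4 * (M + 1)) * η ^ 2
      ≤ (P.m i)⁻¹ * massEntropy (ρ i t x + η) (ρ' i t x) := by
    intro i
    have hm := hP.m_pos i
    have k1 := massEntropy_ge (M := M + 1) (show 0 < ρ i t x + η by linarith [(hr i).1])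
      (hc.trans_le (hq i).1) (by linarith [(hr i).2, hη.2]) (by linarith [(hq i).2])
    have k2 : ((ρ i t x - ρ' i t x) ^ 2 / 2 - η ^ 2) / (4 * (M + 1))
        ≤ massEntropy (ρ i t x + η) (ρ' i t x) := le_trans (by gcongr; exact hsq _ _) k1
    have k3 := mul_le_mul_of_nonneg_left k2 (inv_nonneg.2 hm.le)
    refine le_trans ?_ k3
    have k4 : α * (ρ i t x - ρ' i t x) ^ 2
        ≤ (P.m i)⁻¹ / (8 * (M + 1)) * (ρ i t x - ρ' i t x) ^ 2 := by
      gcongr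
      refine (min_le_left _ _).trans ?_
      gcongr
      exact hνm i
    have k5 : (P.m i)⁻¹ / (4 * (M + 1)) * η ^ 2 ≤ μ / (4 * (M + 1)) * η ^ 2 := by
      gcongr
      exact hμm i
    have k6 : (P.m i)⁻¹ * (((ρ i t x - ρ' i t x) ^ 2 / 2 - η ^ 2) / (4 * (M + 1)))
        = (P.m i)⁻¹ / (8 * (M + 1)) * (ρ i t x - ρ' i t x) ^ 2
          - (P.m i)⁻¹ / (4 * (M + 1)) * η ^ 2 := by field_simp; ring
    linarith
  have h2 : α * (θ t x - θ' t x) ^ 2 - P.cw * (n * M) / (4 * (M + 1) ^ 2) * η ^ 2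
      ≤ P.cw * R x * heatEntropy (θ t x + η) (θ' t x) := by
    have hR0 := hc.trans_le hR
    have k1 := heatEntropy_ge (M := M + 1) (show 0 < θ t x + η by linarith [hs.1])
      (hδ.trans_le hp.1) (by linarith [hs.2, hη.2]) (by linarith [hp.2])
    have k2 : ((θ t x - θ' t x) ^ 2 / 2 - η ^ 2) / (4 * (M + 1) ^ 2)
        ≤ heatEntropy (θ t x + η) (θ' t x) := le_trans (by gcongr; exact hsq _ _) k1
    have k3 := mul_le_mul_of_nonneg_left k2 (by positivity : 0 ≤ P.cw * R x)
    refine le_trans ?_ k3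
    have k4 : α * (θ t x - θ' t x) ^ 2
        ≤ P.cw * R x / (8 * (M + 1) ^ 2) * (θ t x - θ' t x) ^ 2 := by
      gcongr
      refine (min_le_right _ _).trans ?_
      gcongr
    have k5 : P.cw * R x / (4 * (M + 1) ^ 2) * η ^ 2
        ≤ P.cw * (n * M) / (4 * (M + 1) ^ 2) * η ^ 2 := by gcongr
    have k6 : P.cw * R x * (((θ t x - θ' t x) ^ 2 / 2 - η ^ 2) / (4 * (M + 1) ^ 2))
        = P.cw * R x / (8 * (M + 1) ^ 2) * (θ t x - θ' t x) ^ 2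
          - P.cw * R x / (4 * (M + 1) ^ 2) * η ^ 2 := by field_simp; ring
    linarith
  have h3 := Finset.sum_le_sum fun i (_ : i ∈ Finset.univ) => h1 i
  rw [Finset.sum_sub_distrib, ← Finset.mul_sum] at h3
  simp only [Finset.sum_const, Finset.card_univ, Fintype.card_fin, nsmul_eq_mul] at h3
  unfold distSq Model.relEntropy
  have h4 : 0 ≤ η ^ 2 := sq_nonneg _
  have h5 : n * (μ / (4 * (M + 1)) * η ^ 2) = n * μ / (4 * (M + 1)) * η ^ 2 := by ring
  linarith

lemma Model.SolutionPair.integrable_distSq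
    (h : P.SolutionPair Ω T S M c δ V L R ρ ρ' θ θ' gρ gρ' gθ gθ' u u') :
    Integrable (fun z : ℝ × Space3 => distSq ρ ρ' θ θ' z.1 z.2) (volume.restrict (cyl Ω S)) := by
  unfold distSq
  exact (integrable_finsetSum _ fun i _ => ((h.ρ_reg i).memLp.sub
    (h.ρ'_reg i).memLp).integrable_sq).add (h.θ_reg.memLp.sub h.θ'_reg.memLp).integrable_sq

lemma Model.SolutionPair.integrable_fluxSq
    (h : P.SolutionPair Ω T S M c δ V L R ρ ρ' θ θ' gρ gρ' gθ gθ' u u') :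
    Integrable (fun z : ℝ × Space3 => P.fluxSq (fun i => ρ i z.1 z.2) (fun i => ρ' i z.1 z.2)
      (θ z.1 z.2) (θ' z.1 z.2) (fun i => gρ i z.1 z.2) (fun i => gρ' i z.1 z.2) (gθ z.1 z.2)
      (gθ' z.1 z.2) (fun i => u i z.1 z.2) (fun i => u' i z.1 z.2))
      (volume.restrict (cyl Ω S)) := by
  have key : ∀ {f : ℝ → Space3 → Space3},
      MemLp (fun z : ℝ × Space3 => f z.1 z.2) 2 (volume.restrict (cyl Ω S)) →
      Integrable (fun z : ℝ × Space3 => ‖f z.1 z.2‖ ^ 2) (volume.restrict (cyl Ω S)) := by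
    intro f hf
    simpa using hf.integrable_norm_pow (by norm_num)
  have kρ := fun i => key (f := fun t x => ρ i t x • u i t x) ((h.mass i).2.1 S h.time_lt)
  have kρ' := fun i => key (f := fun t x => ρ' i t x • u' i t x) ((h.mass' i).2.1 S h.time_lt)
  have kgρ := fun i => key (f := gρ i) (h.ρ_reg i).memLp_grad
  have kgρ' := fun i => key (f := gρ' i) (h.ρ'_reg i).memLp_grad
  have ke := key (f := fun t x => P.energyFlux (fun i => ρ i t x) (θ t x) (gθ t x)
    (fun i => u i t x)) (h.energy.2.1 S h.time_lt)
  have ke' := key (f := fun t x => P.energyFlux (fun i => ρ' i t x) (θ' t x) (gθ' t x)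
    (fun i => u' i t x)) (h.energy'.2.1 S h.time_lt)
  have kθ := key (f := gθ) h.θ_reg.memLp_grad
  have kθ' := key (f := gθ') h.θ'_reg.memLp_grad
  have kl := key (f := fun t x => (θ t x)⁻¹ • gθ t x) h.logGrad_memLp
  unfold Model.fluxSq
  refine Integrable.add (integrable_finsetSum _ fun i _ => ?_) ?_
  · exact (((kρ i).add (kgρ i)).add (kρ' i)).add (kgρ' i)
  · exact (((ke.add ke').add kθ).add kθ').add kl

/-- Stability estimate, integrated in time with a polynomial weight. -/
lemma Model.SolutionPair.exists_weighted_distSq_le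
    (h : P.SolutionPair Ω T S M c δ V L R ρ ρ' θ θ' gρ gρ' gθ gθ' u u') (hP : P.IsAdmissible)
    (hc : 0 < c) (hδ : 0 < δ) (hM : 0 < M) (hV : 0 ≤ V) (hL : 0 ≤ L) :
    ∃ α > 0, ∃ C > 0, ∀ τ, 0 < τ → τ < S → ∀ k : ℕ,
      (k + 1) * α * ∫ z in cyl Ω τ, (τ - z.1) ^ k * distSq ρ ρ' θ θ' z.1 z.2
        ≤ C * ∫ z in cyl Ω τ, (τ - z.1) ^ (k + 1) * distSq ρ ρ' θ θ' z.1 z.2 := by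
  obtain ⟨α, hα, β, hβ, hlow⟩ := Model.SolutionPair.exists_relEntropy_ge hP hc hδ hM
  obtain ⟨C, hC, hprod0⟩ := hP.exists_entropyProduction_zero_le hc hδ hM hV hL
  obtain ⟨C', hC', hprod⟩ := hP.exists_entropyProduction_le (L := L) (V := V) hc hδ hM
  refine ⟨α, hα, C, hC, fun τ hτ hτS k => ?_⟩
  have hΩ := h.isOpen.measurableSet
  have hfin := isFiniteMeasure_restrict_cyl (S := τ) h.volume_ne_top
  set Δ : ℝ → Space3 → ℝ := distSq ρ ρ' θ θ' with hΔ
  set F : ℝ → ℝ → Space3 → ℝ := fun η =>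
    P.production η ρ ρ' θ θ' gρ gρ' gθ gθ' u u' with hF
  have iΔ : Integrable (fun z : ℝ × Space3 => Δ z.1 z.2) (volume.restrict (cyl Ω S)) :=
    h.integrable_distSq
  have iN := h.integrable_fluxSq
  set N : ℝ → Space3 → ℝ := fun t x => P.fluxSq (fun i => ρ i t x) (fun i => ρ' i t x)
      (θ t x) (θ' t x) (fun i => gρ i t x) (fun i => gρ' i t x) (gθ t x)
      (gθ' t x) (fun i => u i t x) (fun i => u' i t x) with hN
  have hst := ae_restrict_of_ae_restrict_of_subset (cyl_mono hτS.le) h.state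
  have hpos : ∀ᵐ z ∂((volume : Measure (ℝ × Space3)).restrict (cyl Ω τ)), 0 ≤ τ - z.1 := by
    filter_upwards [ae_restrict_mem (measurableSet_cyl hΩ)] with z hz
    linarith [hz.1.2]
  have hFle : ∀ᵐ z ∂((volume : Measure (ℝ × Space3)).restrict (cyl Ω τ)), ∀ η ∈ Ioc (0 : ℝ) 1,
      F η z.1 z.2 ≤ C' * N z.1 z.2 := by
    filter_upwards [hst] with z hz η hη
    exact hprod _ _ _ _ _ _ _ _ _ _ hz η hη
  have hF0 : ∀ᵐ z ∂((volume : Measure (ℝ × Space3)).restrict (cyl Ω τ)),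
      F 0 z.1 z.2 ≤ C * Δ z.1 z.2 := by
    filter_upwards [hst] with z hz
    exact hprod0 _ _ _ _ _ _ _ _ _ _ hz
  have hFt : ∀ᵐ z ∂((volume : Measure (ℝ × Space3)).restrict (cyl Ω τ)),
      Tendsto (fun η => F η z.1 z.2) (𝓝[>] 0) (𝓝 (F 0 z.1 z.2)) := by
    filter_upwards [hst] with z hz
    exact hz.tendsto_entropyProduction.mono_left nhdsWithin_le_nhds
  -- Total error of the regularization: the initial entropy of the shifted state and the loss in the
  -- lower bound of the entropy.
  set e : ℝ → ℝ := fun η => τ ^ (k + 1) * ((∑ i, (P.m i)⁻¹ * (2 * η ^ 2 * c⁻¹)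
      + P.cw * (n * M) * (2 * η * δ⁻¹)) * volume.real Ω)
    + β * η ^ 2 * ∫ z in cyl Ω τ, ((k : ℝ) + 1) * (τ - z.1) ^ k with he
  have hone : Integrable (fun z : ℝ × Space3 => ((k : ℝ) + 1) * (τ - z.1) ^ k)
      (volume.restrict (cyl Ω τ)) := by
    have := integrable_bounded_mul (F := fun _ _ => (1 : ℝ)) (χ := fun t => (τ - t) ^ k) hΩ
      (by fun_prop) (abs_sub_pow_le k) (integrable_const (μ := volume.restrict (cyl Ω τ)) (1 : ℝ))
    simpa using this.const_mul ((k : ℝ) + 1)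
  -- The bound of `F η` that is uniform in `η` is one-sided. Its maximum with `C Δ` is nonnegative
  -- and dominated by `C' N + C Δ`, and at `η = 0` it equals `C Δ`; so dominated convergence gives
  -- the desired limit.
  have hineq : ∀ η ∈ Ioc (0 : ℝ) 1,
      (k + 1) * α * ∫ z in cyl Ω τ, (τ - z.1) ^ k * Δ z.1 z.2
        ≤ e η + ∫ z in cyl Ω τ, (τ - z.1) ^ (k + 1) * max (F η z.1 z.2) (C * Δ z.1 z.2) := by
    intro η hη
    obtain ⟨iE, iF, hrel⟩ := h.relEntropy_inequality hP hc hδ hη hτ hτS k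
    have w1 := integrable_weight_mul (F := Δ) hΩ hτS.le k iΔ
    have w2 := integrable_weight_mul (F := P.relEntropy η R ρ ρ' θ θ') hΩ hτS.le k iE
    have w3 := integrable_weight_mul (F := F η) hΩ hτS.le (k + 1) iF
    have w4 := integrable_weight_mul (F := fun t x => max (F η t x) (C * Δ t x)) hΩ hτS.le (k + 1)
      (iF.sup (iΔ.const_mul C))
    have w2' : Integrable (fun z : ℝ × Space3 => ((k + 1) * (τ - z.1) ^ k)
        * P.relEntropy η R ρ ρ' θ θ' z.1 z.2) (volume.restrict (cyl Ω τ)) := by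
      simpa [mul_assoc] using w2.const_mul ((k : ℝ) + 1)
    have s1 : (k + 1) * α * (∫ z in cyl Ω τ, (τ - z.1) ^ k * Δ z.1 z.2)
        - β * η ^ 2 * ∫ z in cyl Ω τ, ((k : ℝ) + 1) * (τ - z.1) ^ k
        ≤ ∫ z in cyl Ω τ, ((k + 1) * (τ - z.1) ^ k) * P.relEntropy η R ρ ρ' θ θ' z.1 z.2 := by
      rw [← integral_const_mul, ← integral_const_mul, ← integral_sub (w1.const_mul _)
        (hone.const_mul _)]
      refine integral_mono_ae ((w1.const_mul _).sub (hone.const_mul _)) w2' ?_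
      filter_upwards [hst, hpos, ae_restrict_of_ae_restrict_of_subset (cyl_mono hτS.le) h.total_ge,
        ae_restrict_of_ae_restrict_of_subset (cyl_mono hτS.le) h.total_le] with z h1 h2 h3 h4
      have h5 := hlow R ρ ρ' θ θ' z.1 z.2 η hη h3 h4 h1.r_mem h1.q_mem h1.s_mem h1.p_mem
      have h6 := mul_le_mul_of_nonneg_left h5 (show 0 ≤ ((k : ℝ) + 1) * (τ - z.1) ^ k by positivity)
      refine le_trans (le_of_eq ?_) h6
      ring
    have s2 : ∫ z in cyl Ω τ, (τ - z.1) ^ (k + 1) * F η z.1 z.2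
        ≤ ∫ z in cyl Ω τ, (τ - z.1) ^ (k + 1) * max (F η z.1 z.2) (C * Δ z.1 z.2) := by
      refine integral_mono_ae w3 w4 ?_
      filter_upwards [hpos] with z hz
      have : 0 ≤ (τ - z.1) ^ (k + 1) := by positivity
      exact mul_le_mul_of_nonneg_left (le_max_left _ _) this
    rw [he]
    linarith
  have hlim : Tendsto (fun η => e η + ∫ z in cyl Ω τ, (τ - z.1) ^ (k + 1)
      * max (F η z.1 z.2) (C * Δ z.1 z.2)) (𝓝[>] 0)
      (𝓝 (0 + ∫ z in cyl Ω τ, (τ - z.1) ^ (k + 1) * (C * Δ z.1 z.2))) := by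
    refine Tendsto.add ?_ ?_
    · have hcont : Continuous e := by rw [he]; fun_prop
      have h0 : e 0 = 0 := by simp [he]
      have := (hcont.tendsto 0).mono_left (nhdsWithin_le_nhds (s := Ioi 0))
      rwa [h0] at this
    · refine tendsto_integral_filter_of_dominated_convergence
        (fun z => (τ - z.1) ^ (k + 1) * (C' * N z.1 z.2 + C * Δ z.1 z.2)) ?_ ?_ ?_ ?_
      · filter_upwards [Ioc_mem_nhdsGT (zero_lt_one (α := ℝ))] with η hη
        obtain ⟨iE, iF, hrel⟩ := h.relEntropy_inequality hP hc hδ hη hτ hτS k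
        exact (integrable_weight_mul (F := fun t x => max (F η t x) (C * Δ t x)) hΩ hτS.le (k + 1)
          (iF.sup (iΔ.const_mul C))).1
      · filter_upwards [Ioc_mem_nhdsGT (zero_lt_one (α := ℝ))] with η hη
        filter_upwards [hFle, hpos] with z h1 h2
        have h3 : 0 ≤ C * Δ z.1 z.2 := mul_nonneg hC.le (distSq_nonneg _ _)
        have h4 : 0 ≤ max (F η z.1 z.2) (C * Δ z.1 z.2) := le_max_of_le_right h3
        have h5 : 0 ≤ C' * N z.1 z.2 := by
          have : 0 ≤ N z.1 z.2 := by
            rw [hN]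
            unfold Model.fluxSq
            have := Finset.sum_nonneg fun i (_ : i ∈ Finset.univ) =>
              (by positivity : 0 ≤ ‖ρ i z.1 z.2 • u i z.1 z.2‖ ^ 2 + ‖gρ i z.1 z.2‖ ^ 2
                + ‖ρ' i z.1 z.2 • u' i z.1 z.2‖ ^ 2 + ‖gρ' i z.1 z.2‖ ^ 2)
            positivity
          positivity
        rw [Real.norm_of_nonneg (by positivity)]
        gcongr
        exact max_le (by linarith [h1 η hη]) (by linarith)
      · exact integrable_weight_mul (F := fun t x => C' * N t x + C * Δ t x) hΩ hτS.le (k + 1)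
          ((iN.const_mul C').add (iΔ.const_mul C))
      · filter_upwards [hF0, hFt] with z h1 h2
        have := ((h2.max (tendsto_const_nhds (x := C * Δ z.1 z.2))).const_mul
          ((τ - z.1) ^ (k + 1)))
        rwa [max_eq_right h1] at this
  have hres := ge_of_tendsto hlim (by
    filter_upwards [Ioc_mem_nhdsGT (zero_lt_one (α := ℝ))] with η hη using hineq η hη)
  refine hres.trans_eq ?_
  rw [zero_add, ← integral_const_mul]
  refine integral_congr_ae (Eventually.of_forall fun z => ?_)
  ring

/-- Two solutions with the same initial data coincide almost everywhere. -/
theorem Model.SolutionPair.ae_eq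
    (h : P.SolutionPair Ω T S M c δ V L R ρ ρ' θ θ' gρ gρ' gθ gθ' u u') (hP : P.IsAdmissible)
    (hc : 0 < c) (hδ : 0 < δ) (hM : 0 < M) (hV : 0 ≤ V) (hL : 0 ≤ L) {τ : ℝ} (hτ : 0 < τ)
    (hτS : τ < S) :
    ∀ᵐ z ∂((volume : Measure (ℝ × Space3)).restrict (cyl Ω τ)),
      (∀ i, ρ i z.1 z.2 = ρ' i z.1 z.2) ∧ θ z.1 z.2 = θ' z.1 z.2 := by
  obtain ⟨α, hα, C, hC, hle⟩ := h.exists_weighted_distSq_le hP hc hδ hM hV hL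
  have hΩ := h.isOpen.measurableSet
  -- Since `(τ - t)^(k+1) ≤ τ (τ - t)^k`, the estimate reads `(k + 1) α I ≤ C τ I` for the weighted
  -- integral `I ≥ 0`; a large `k` forces `I = 0`. This takes the place of Gronwall's lemma.
  obtain ⟨k, hk⟩ := exists_nat_gt (C * τ / α)
  rw [div_lt_iff₀ hα] at hk
  have i1 := integrable_weight_mul (F := distSq ρ ρ' θ θ') hΩ hτS.le k h.integrable_distSq
  have i2 := integrable_weight_mul (F := distSq ρ ρ' θ θ') hΩ hτS.le (k + 1) h.integrable_distSq
  have hmem := ae_restrict_mem (μ := (volume : Measure (ℝ × Space3))) (measurableSet_cyl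
    (S := τ) hΩ)
  have h1 : ∫ z in cyl Ω τ, (τ - z.1) ^ (k + 1) * distSq ρ ρ' θ θ' z.1 z.2
      ≤ τ * ∫ z in cyl Ω τ, (τ - z.1) ^ k * distSq ρ ρ' θ θ' z.1 z.2 := by
    rw [← integral_const_mul]
    refine integral_mono_ae i2 (i1.const_mul τ) ?_
    filter_upwards [hmem] with z hz
    have h2 : 0 ≤ τ - z.1 := by linarith [hz.1.2]
    have h3 : τ - z.1 ≤ τ := by linarith [hz.1.1]
    have h4 : 0 ≤ (τ - z.1) ^ k * distSq ρ ρ' θ θ' z.1 z.2 :=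
      mul_nonneg (pow_nonneg h2 k) (distSq_nonneg _ _)
    calc _ = (τ - z.1) * ((τ - z.1) ^ k * distSq ρ ρ' θ θ' z.1 z.2) := by ring
      _ ≤ _ := by gcongr
  have hn : 0 ≤ᵐ[(volume : Measure (ℝ × Space3)).restrict (cyl Ω τ)] fun z =>
      (τ - z.1) ^ k * distSq ρ ρ' θ θ' z.1 z.2 := by
    filter_upwards [hmem] with z hz
    have h2 : 0 ≤ τ - z.1 := by linarith [hz.1.2]
    exact mul_nonneg (pow_nonneg h2 k) (distSq_nonneg _ _)
  have hI0 := integral_nonneg_of_ae hn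
  have h2 := (hle τ hτ hτS k).trans (mul_le_mul_of_nonneg_left h1 hC.le)
  have hI : ∫ z in cyl Ω τ, (τ - z.1) ^ k * distSq ρ ρ' θ θ' z.1 z.2 = 0 := by
    refine le_antisymm ?_ hI0
    by_contra! hcon
    have h3 : C * τ * (∫ z in cyl Ω τ, (τ - z.1) ^ k * distSq ρ ρ' θ θ' z.1 z.2)
        < (k + 1) * α * ∫ z in cyl Ω τ, (τ - z.1) ^ k * distSq ρ ρ' θ θ' z.1 z.2 := by
      refine mul_lt_mul_of_pos_right ?_ hcon
      linarith
    linarith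
  filter_upwards [(integral_eq_zero_iff_of_nonneg_ae hn i1).1 hI, hmem] with z h3 h4
  have h5 : (τ - z.1) ^ k ≠ 0 := pow_ne_zero _ (by linarith [h4.1.2])
  have h6 : distSq ρ ρ' θ θ' z.1 z.2 = 0 := (mul_eq_zero.1 h3).resolve_left h5
  unfold distSq at h6
  have h7 : 0 ≤ ∑ i, (ρ i z.1 z.2 - ρ' i z.1 z.2) ^ 2 :=
    Finset.sum_nonneg fun i _ => sq_nonneg _
  have h8 := (add_eq_zero_iff_of_nonneg h7 (sq_nonneg _)).1 h6
  refine ⟨fun i => ?_, sub_eq_zero.1 (pow_eq_zero_iff two_ne_zero |>.1 h8.2)⟩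
  have h9 := (Finset.sum_eq_zero_iff_of_nonneg fun i _ => sq_nonneg _).1 h8.1 i (Finset.mem_univ i)
  exact sub_eq_zero.1 (pow_eq_zero_iff two_ne_zero |>.1 h9)

end Comparison

/-! ### From almost every time to every time -/

section AllTimes

variable {Ω : Set Space3} {S T : ℝ} {a a' : ℝ → Space3 → ℝ} {J J' : ℝ → Space3 → Space3}

lemma ae_eq_of_integral_mul_eq (hΩ : IsOpen Ω) {f g : Space3 → ℝ}
    (hf : MemLp f 2 (volume.restrict Ω)) (hg : MemLp g 2 (volume.restrict Ω))
    (h : ∀ φ : Space3 → ℝ, ContDiff ℝ ∞ φ → HasCompactSupport φ →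
      ∫ x in Ω, f x * φ x = ∫ x in Ω, g x * φ x) :
    ∀ᵐ x ∂(volume.restrict Ω), f x = g x := by
  have key : ∀ᵐ x, x ∈ Ω → f x - g x = 0 := by
    refine hΩ.ae_eq_zero_of_integral_contDiff_smul_eq_zero
      (locallyIntegrableOn_of_memLp (hf.sub hg)) ?_
    intro φ hφ hc hs
    have hφ2 := (memLp_of_contDiff hφ hc).restrict Ω
    have i1 : Integrable (fun x => f x * φ x) (volume.restrict Ω) := hf.integrable_mul hφ2
    have i2 : Integrable (fun x => g x * φ x) (volume.restrict Ω) := hg.integrable_mul hφ2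
    have e : ∫ x, φ x • (f x - g x) = ∫ x in Ω, φ x • (f x - g x) := by
      rw [setIntegral_eq_integral_of_forall_compl_eq_zero]
      intro x hx
      rw [image_eq_zero_of_notMem_tsupport fun h => hx (hs h), zero_smul]
    rw [e]
    have e2 : ∫ x in Ω, φ x • (f x - g x) = ∫ x in Ω, (f x * φ x - g x * φ x) := by
      refine integral_congr_ae (Filter.Eventually.of_forall fun x => ?_)
      simp only [smul_eq_mul]
      ring
    rw [e2, integral_sub i1 i2, h φ hφ hc, sub_self]
  rw [ae_restrict_iff' hΩ.measurableSet]
  filter_upwards [key] with x hx hxΩ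
  exact sub_eq_zero.1 (hx hxΩ)

lemma memLp_comp_snd_cyl {V : Type*} [NormedAddCommGroup V] {f : Space3 → V}
    (hf : MemLp f 2 (volume.restrict Ω)) :
    MemLp (fun z : ℝ × Space3 => f z.2) 2 (volume.restrict (cyl Ω S)) := by
  rw [restrict_cyl]
  have : IsFiniteMeasure ((volume : Measure ℝ).restrict (Ioo 0 S)) := ⟨by simp⟩
  exact hf.comp_snd _

lemma WeakBalance.sum {ι : Type*} [Fintype ι] {f : ι → ℝ → Space3 → ℝ}
    {G : ι → ℝ → Space3 → Space3} (h : ∀ i, WeakBalance Ω T (f i) (G i)) :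
    WeakBalance Ω T (fun t x => ∑ i, f i t x) (fun t x => ∑ i, G i t x) := by
  refine ⟨fun t ht => memLp_finsetSum _ fun i _ => (h i).1 t ht,
    fun S hS => memLp_finsetSum _ fun i _ => (h i).2.1 S hS, fun t ht ψ Q hψ => ?_⟩
  have h0 : (0 : ℝ) ∈ Ico 0 T := ⟨le_rfl, ht.1.trans_lt ht.2⟩
  have i1 : ∀ {s}, s ∈ Ico 0 T → ∀ i, Integrable (fun x => f i s x * ψ x) (volume.restrict Ω) :=
    fun hs i => ((h i).1 _ hs).integrable_mul hψ.1
  have hQ : MemLp (fun z : ℝ × Space3 => Q z.2) 2 (volume.restrict (cyl Ω t)) :=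
    memLp_comp_snd_cyl hψ.2.1
  simp only [Finset.sum_mul, sum_inner]
  rw [integral_finsetSum _ fun i _ => i1 ht i, integral_finsetSum _ fun i _ => i1 h0 i,
    integral_finsetSum _ fun i _ => integrable_inner_of_memLp ((h i).2.1 t ht.2) hQ,
    ← Finset.sum_add_distrib]
  exact Finset.sum_congr rfl fun i _ => (h i).2.2 t ht ψ Q hψ

/-- A balanced quantity without flux is constant in time. -/
lemma WeakBalance.ae_eq_initial (hb : WeakBalance Ω T a J) (hΩ : IsOpen Ω)
    (hJ : ∀ᵐ z ∂((volume : Measure (ℝ × Space3)).restrict (cyl Ω T)), J z.1 z.2 = 0) {t : ℝ}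
    (ht : t ∈ Ico 0 T) : ∀ᵐ x ∂(volume.restrict Ω), a t x = a 0 x := by
  refine ae_eq_of_integral_mul_eq hΩ (hb.1 t ht) (hb.1 0 ⟨le_rfl, ht.1.trans_lt ht.2⟩)
    fun φ hφ hc => ?_
  rw [hb.2.2 t ht φ _ (isH1_of_contDiff hφ hc), add_eq_left]
  refine integral_eq_zero_of_ae ?_
  filter_upwards [ae_restrict_of_ae_restrict_of_subset (cyl_mono ht.2.le) hJ] with z hz
  rw [hz, inner_zero_left, Pi.zero_apply]

lemma continuousOn_setIntegral_cyl {F : ℝ × Space3 → ℝ}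
    (hF : Integrable F (volume.restrict (cyl Ω S))) :
    ContinuousOn (fun t => ∫ z in cyl Ω t, F z) (Icc 0 S) := by
  have hF' := hF
  rw [restrict_cyl] at hF'
  have h2 : IntegrableOn (fun t => ∫ x in Ω, F (t, x)) (Icc 0 S) := by
    rw [integrableOn_Icc_iff_integrableOn_Ioo]
    exact hF'.integral_prod_left
  refine (intervalIntegral.continuousOn_primitive (μ := volume) h2).congr fun t ht => ?_
  have h5 : Integrable F (volume.restrict (cyl Ω t)) := hF.mono_measure (restrict_cyl_mono ht.2)
  rw [restrict_cyl] at h5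
  simp only [restrict_cyl]
  rw [integral_prod _ h5, integral_Ioc_eq_integral_Ioo]

/-- Balanced quantities which are equal initially and almost everywhere are equal at all times. -/
lemma WeakBalance.ae_eq_of_ae_eq_cyl (hb : WeakBalance Ω T a J) (hb' : WeakBalance Ω T a' J')
    (hΩ : IsOpen Ω) (h0 : ∀ᵐ x ∂(volume.restrict Ω), a 0 x = a' 0 x)
    (h : ∀ τ, 0 < τ → τ < T → ∀ᵐ z ∂((volume : Measure (ℝ × Space3)).restrict (cyl Ω τ)),
      a z.1 z.2 = a' z.1 z.2) {t : ℝ} (ht : t ∈ Ico 0 T) :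
    ∀ᵐ x ∂(volume.restrict Ω), a t x = a' t x := by
  have hd := hb.sub hb'
  obtain ⟨S, htS, hST⟩ := exists_between ht.2
  have hS : 0 < S := ht.1.trans_lt htS
  have key : ∀ᵐ x ∂(volume.restrict Ω), a t x - a' t x = 0 := by
    refine ae_eq_of_integral_mul_eq hΩ (hd.1 t ht) (MemLp.zero' (p := 2)) fun φ hφ hc => ?_
    simp only [zero_mul, integral_zero]
    have hφ1 := isH1_of_contDiff (Ω := Ω) hφ hc
    have hi := integrable_inner_of_memLp (hd.2.1 S hST)
      (memLp_comp_snd_cyl (S := S) hφ1.2.1)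
    -- Tested with a fixed `φ`, the difference is the primitive of a flux and hence continuous in
    -- time; vanishing at almost every time, it vanishes at every time.
    have hcont := continuousOn_setIntegral_cyl hi
    have hbal : ∀ s ∈ Ico 0 T, ∫ x in Ω, (a s x - a' s x) * φ x
        = ∫ z in cyl Ω s, inner ℝ (J z.1 z.2 - J' z.1 z.2) (gradient φ z.2) := by
      intro s hs
      rw [hd.2.2 s hs φ _ hφ1, integral_eq_zero_of_ae, zero_add]
      filter_upwards [h0] with x hx
      rw [hx, sub_self, zero_mul, Pi.zero_apply]
    have hzero : (fun s => ∫ z in cyl Ω s, inner ℝ (J z.1 z.2 - J' z.1 z.2) (gradient φ z.2))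
        =ᵐ[volume.restrict (Icc 0 S)] fun _ => 0 := by
      rw [← restrict_Ioo_eq_restrict_Icc]
      filter_upwards [ae_ae_of_ae_cyl (p := fun t x => a t x = a' t x) (h S hS hST),
        ae_restrict_mem measurableSet_Ioo] with s h1 h2
      rw [← hbal s ⟨h2.1.le, h2.2.trans hST⟩]
      refine integral_eq_zero_of_ae ?_
      filter_upwards [h1] with x hx
      rw [hx, sub_self, zero_mul, Pi.zero_apply]
    rw [hbal t ht]
    exact Measure.eqOn_Icc_of_ae_eq volume hS.ne hzero hcont continuousOn_const ⟨ht.1, htS.le⟩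
  filter_upwards [key] with x hx using sub_eq_zero.1 hx

end AllTimes

/-! ### Assembling the pair of solutions -/

section Uniqueness

variable {n : ℕ} {P : Model n} {Ω : Set Space3} {T : ℝ} {ρ0 ρ0' : Fin n → Space3 → ℝ}
  {θ0 θ0' : Space3 → ℝ} {ρ ρ' : Fin n → ℝ → Space3 → ℝ} {θ θ' : ℝ → Space3 → ℝ}
  {u u' : Fin n → ℝ → Space3 → Space3} {gρ gρ' : Fin n → ℝ → Space3 → Space3}
  {gθ gθ' : ℝ → Space3 → Space3}

/-- The sum of the mass balances has flux `∑ ρᵢuᵢ = 0`. -/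
lemma IsWeakSolutionWith.total_density_eq (hΩ : IsOpen Ω)
    (h : IsWeakSolutionWith P Ω T ρ0 θ0 ρ θ u gρ gθ) {t : ℝ} (ht : t ∈ Ico 0 T) :
    ∀ᵐ x ∂(volume.restrict Ω), ∑ i, ρ i t x = ∑ i, ρ i 0 x :=
  (WeakBalance.sum h.mass).ae_eq_initial hΩ (h.maxwell_stefan.mono fun _ hz => hz.2) ht

lemma IsWeakSolutionWith.total_density_eq_cyl (hΩ : IsOpen Ω) {S : ℝ} (hST : S < T) (hT : 0 < T)
    (h : IsWeakSolutionWith P Ω T ρ0 θ0 ρ θ u gρ gθ) :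
    ∀ᵐ z ∂((volume : Measure (ℝ × Space3)).restrict (cyl Ω S)),
      ∑ i, ρ i z.1 z.2 = ∑ i, ρ i 0 z.2 := by
  have h1 : MemLp (fun z : ℝ × Space3 => ∑ i, ρ i z.1 z.2) 2 (volume.restrict (cyl Ω S)) :=
    memLp_finsetSum (f := fun i (z : ℝ × Space3) => ρ i z.1 z.2) _ fun i _ => (h.ρ_reg i).1 S hST
  have h2 := memLp_comp_snd_cyl (S := S) ((WeakBalance.sum h.mass).1 0 ⟨le_rfl, hT⟩)
  refine ae_eq_cyl_of_ae_ae_eq (f := fun t x => ∑ i, ρ i t x) (g := fun _ x => ∑ i, ρ i 0 x)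
    h1.1 h2.1 ?_
  filter_upwards [ae_restrict_mem measurableSet_Ioo] with t ht
  exact h.total_density_eq hΩ ⟨ht.1.le, ht.2.trans hST⟩

/-- A weak solution and a regular solution with the same initial data form a `SolutionPair`. -/
lemma IsWeakSolutionWith.exists_solutionPair (hn : 1 ≤ n) (hP : P.IsAdmissible)
    (hΩ : IsLipschitzDomain Ω) (h : IsWeakSolutionWith P Ω T ρ0 θ0 ρ θ u gρ gθ)
    (h' : IsWeakSolutionWith P Ω T ρ0' θ0' ρ' θ' u' gρ' gθ') {δ M : ℝ} (hδ : 0 < δ) (hM : 0 < M)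
    (hρ : ∀ i, ∀ᵐ z ∂(volume.restrict (cyl Ω T)), 0 < ρ i z.1 z.2 ∧ ρ i z.1 z.2 ≤ M)
    (hθ : ∀ᵐ z ∂(volume.restrict (cyl Ω T)), 0 < θ z.1 z.2 ∧ θ z.1 z.2 ≤ M)
    (hρ' : ∀ i, ∀ᵐ z ∂(volume.restrict (cyl Ω T)), 0 < ρ' i z.1 z.2 ∧ ρ' i z.1 z.2 ≤ M)
    (hθ' : ∀ᵐ z ∂(volume.restrict (cyl Ω T)), δ ≤ θ' z.1 z.2 ∧ θ' z.1 z.2 ≤ M)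
    (hu' : ∀ i, MemLpCyl ⊤ Ω T (u' i))
    (hlogθ' : ∃ G : ℝ → Space3 → Space3,
      HasSpaceGrad Ω T (fun t x => Real.log (θ' t x)) G ∧ MemLpCyl ⊤ Ω T G)
    (hρ0 : ∀ i, ∀ᵐ x ∂(volume.restrict Ω), ρ i 0 x = ρ' i 0 x)
    (hθ0 : ∀ᵐ x ∂(volume.restrict Ω), θ 0 x = θ' 0 x) {S : ℝ} (hS : 0 < S) (hST : S < T) :
    ∃ c > 0, ∃ V ≥ 0, ∃ L ≥ 0, P.SolutionPair Ω T S M c δ V L (fun x => ∑ i, ρ i 0 x) ρ ρ' θ θ'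
      gρ gρ' gθ gθ' u u' := by
  have hT := hS.trans hST
  obtain ⟨c, hc, hcl⟩ := h'.exists_density_lower_bound hP hΩ hS hST hδ hM hρ' hθ' hu' hlogθ'
  obtain ⟨L, hL, hLb⟩ := h'.exists_logGrad_bound hΩ.isOpen hlogθ' hST
  choose V₀ hV₀ hV₀b using fun i => (hu' i).exists_bound hST
  obtain ⟨V, hV, hVV⟩ := exists_pos_forall_ge V₀
  have hsub := cyl_mono (Ω := Ω) hST.le
  have htot := h.total_density_eq_cyl hΩ.isOpen hST hT
  have htot' : ∀ᵐ z ∂((volume : Measure (ℝ × Space3)).restrict (cyl Ω S)),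
      ∑ i, ρ' i z.1 z.2 = ∑ i, ρ i 0 z.2 := by
    have h0 : ∀ᵐ z ∂((volume : Measure (ℝ × Space3)).restrict (cyl Ω S)),
        ∀ i, ρ i 0 z.2 = ρ' i 0 z.2 := by
      rw [restrict_cyl]
      exact Measure.quasiMeasurePreserving_snd.ae (ae_all_iff.2 hρ0)
    filter_upwards [h'.total_density_eq_cyl hΩ.isOpen hST hT, h0] with z h1 h2
    rw [h1]
    exact Finset.sum_congr rfl fun i _ => (h2 i).symm
  refine ⟨c, hc, V, hV.le, L, hL, hΩ.isOpen, hΩ.isBounded.measure_lt_top.ne, hST, ?_,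
    fun i => (h.ρ_reg i).memL2H1 hST, fun i => (h'.ρ_reg i).memL2H1 hST, h.θ_reg.memL2H1 hST,
    h'.θ_reg.memL2H1 hST, h.log_θ_reg.2.1 S hST, h.mass, h'.mass, h.energy, h'.energy, hρ0, hθ0,
    htot, htot', ?_⟩
  · filter_upwards [hLb, ae_all_iff.2 hV₀b, ae_all_iff.2 hcl,
      ae_restrict_of_ae_restrict_of_subset hsub (ae_all_iff.2 hρ),
      ae_restrict_of_ae_restrict_of_subset hsub (ae_all_iff.2 hρ'),
      ae_restrict_of_ae_restrict_of_subset hsub hθ, ae_restrict_of_ae_restrict_of_subset hsub hθ',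
      ae_restrict_of_ae_restrict_of_subset hsub h.momentum,
      ae_restrict_of_ae_restrict_of_subset hsub h'.momentum,
      ae_restrict_of_ae_restrict_of_subset hsub h.maxwell_stefan,
      ae_restrict_of_ae_restrict_of_subset hsub h'.maxwell_stefan]
      with z k1 k2 k3 k4 k5 k6 k7 k8 k9 k10 k11
    exact ⟨k4, fun i => ⟨k3 i, (k5 i).2⟩, k6, k7, k8, k9, k10, k11,
      fun i => (k2 i).trans (hVV i), k1⟩
  · filter_upwards [htot', ae_all_iff.2 hcl] with z k1 k2
    rw [← k1]
    exact (k2 ⟨0, hn⟩).trans (Finset.single_le_sum (f := fun i => ρ' i z.1 z.2)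
      (fun j _ => hc.le.trans (k2 j)) (Finset.mem_univ _))

end Uniqueness

end MaxwellStefanFourier

open MaxwellStefanFourier in
theorem theorem5 {n : ℕ} (hn : 1 ≤ n) (P : Model n) (hP : P.IsAdmissible)
    (Ω : Set Space3) (hΩ : IsLipschitzDomain Ω) (T : ℝ) (hT : 0 < T)
    -- the weak solution, its diffusional velocities and its initial data
    (ρ : Fin n → ℝ → Space3 → ℝ) (θ : ℝ → Space3 → ℝ) (u : Fin n → ℝ → Space3 → Space3)
    (ρ0 : Fin n → Space3 → ℝ) (θ0 : Space3 → ℝ)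
    (hU : IsWeakSolution P Ω T ρ0 θ0 ρ θ u)
    -- the strong solution, its diffusional velocities and its initial data
    (ρ' : Fin n → ℝ → Space3 → ℝ) (θ' : ℝ → Space3 → ℝ) (u' : Fin n → ℝ → Space3 → Space3)
    (ρ0' : Fin n → Space3 → ℝ) (θ0' : Space3 → ℝ)
    (hU' : IsStrongSolution P Ω T ρ0' θ0' ρ' θ' u')
    (δ M : ℝ) (hδ : 0 < δ) (hM : 0 < M)
    -- bounds on the weak solution
    (hρ : ∀ i, ∀ᵐ z ∂(volume.restrict (cyl Ω T)), 0 < ρ i z.1 z.2 ∧ ρ i z.1 z.2 ≤ M)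
    (hθ : ∀ᵐ z ∂(volume.restrict (cyl Ω T)), 0 < θ z.1 z.2 ∧ θ z.1 z.2 ≤ M)
    -- bounds on the strong solution
    (hρ' : ∀ i, ∀ᵐ z ∂(volume.restrict (cyl Ω T)), 0 ≤ ρ' i z.1 z.2 ∧ ρ' i z.1 z.2 ≤ M)
    (hθ' : ∀ᵐ z ∂(volume.restrict (cyl Ω T)), δ ≤ θ' z.1 z.2 ∧ θ' z.1 z.2 ≤ M)
    (hlogρ' : ∀ i, LogMemH1Loc Ω T (ρ' i))
    (hu' : ∀ i, MemLpCyl ∞ Ω T (u' i))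
    (hlogθ' : ∃ G : ℝ → Space3 → Space3,
      HasSpaceGrad Ω T (fun t x => Real.log (θ' t x)) G ∧ MemLpCyl ∞ Ω T G)
    -- the initial data coincide
    (hρ0 : ∀ i, ∀ᵐ x ∂(volume.restrict Ω), ρ0 i x = ρ0' i x)
    (hθ0 : ∀ᵐ x ∂(volume.restrict Ω), θ0 x = θ0' x) :
    ∀ t ∈ Ico 0 T, ∀ᵐ x ∂(volume.restrict Ω),
      (∀ i, ρ i t x = ρ' i t x) ∧ θ t x = θ' t x := by
  obtain ⟨gρ, gθ, h⟩ := hU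
  obtain ⟨gρ', gθ', h', -⟩ := hU'
  have hΩo := hΩ.isOpen
  have hi : ∀ i, ∀ᵐ x ∂(volume.restrict Ω), ρ i 0 x = ρ' i 0 x := by
    intro i
    filter_upwards [h.initial_ρ i, h'.initial_ρ i, hρ0 i] with x h1 h2 h3
    rw [h1, h2, h3]
  have hi' : ∀ᵐ x ∂(volume.restrict Ω), θ 0 x = θ' 0 x := by
    filter_upwards [h.initial_θ, h'.initial_θ, hθ0] with x h1 h2 h3
    rw [h1, h2, h3]
  have hpos : ∀ i, ∀ᵐ z ∂(volume.restrict (cyl Ω T)), 0 < ρ' i z.1 z.2 ∧ ρ' i z.1 z.2 ≤ M := by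
    intro i
    filter_upwards [hρ' i, (hlogρ' i).1] with z h1 h2
    exact ⟨h2, h1.2⟩
  have hpair := fun {S : ℝ} (hS : 0 < S) (hST : S < T) => h.exists_solutionPair hn hP hΩ h' hδ hM
    hρ hθ hpos hθ' hu' hlogθ' hi hi' hS hST
  have hae : ∀ τ, 0 < τ → τ < T → ∀ᵐ z ∂((volume : Measure (ℝ × Space3)).restrict (cyl Ω τ)),
      (∀ i, ρ i z.1 z.2 = ρ' i z.1 z.2) ∧ θ z.1 z.2 = θ' z.1 z.2 := by
    intro τ hτ hτT
    obtain ⟨S, hτS, hST⟩ := exists_between hτT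
    obtain ⟨c, hc, V, hV, L, hL, hp⟩ := hpair (hτ.trans hτS) hST
    exact hp.ae_eq hP hc hδ hM hV hL hτ hτS
  -- The lower bound of the total density on a cylinder, read at a single time; it allows the
  -- temperature to be recovered from the energy.
  have hR : ∀ᵐ x ∂(volume.restrict Ω), 0 < ∑ i, ρ i 0 x := by
    obtain ⟨S, hS, hST⟩ := exists_between hT
    obtain ⟨c, hc, V, hV, L, hL, hp⟩ := hpair hS hST
    have hne : (volume.restrict (Ioo 0 S)) ≠ 0 := by simp [hS]
    have : (ae (volume.restrict (Ioo 0 S))).NeBot := ae_neBot.2 hne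
    obtain ⟨-, ht⟩ := (ae_ae_of_ae_cyl (p := fun _ x => c ≤ ∑ i, ρ i 0 x) hp.total_ge).exists
    exact ht.mono fun x hx => hc.trans_le hx
  intro t ht
  have hEi : ∀ᵐ x ∂(volume.restrict Ω),
      P.energy (fun i => ρ i 0 x) (θ 0 x) = P.energy (fun i => ρ' i 0 x) (θ' 0 x) := by
    filter_upwards [ae_all_iff.2 hi, hi'] with x h1 h2
    simp only [h1, h2]
  have hρt := fun i => (h.mass i).ae_eq_of_ae_eq_cyl (h'.mass i) hΩo (hi i)
    (fun τ hτ hτT => (hae τ hτ hτT).mono fun z hz => hz.1 i) ht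
  -- The temperature satisfies no balance law of its own. At a fixed time it is obtained from the
  -- equality of the energies `c_w R θ` by dividing by `c_w R > 0`.
  have hEt := h.energy.ae_eq_of_ae_eq_cyl h'.energy hΩo hEi
    (fun τ hτ hτT => (hae τ hτ hτT).mono fun z hz => by simp only [hz.1, hz.2]) ht
  filter_upwards [ae_all_iff.2 hρt, hEt, h.total_density_eq hΩo ht, hR] with x h1 h2 h3 h4
  refine ⟨h1, ?_⟩
  rw [P.energy_eq, P.energy_eq, ← Finset.sum_congr rfl fun i _ => h1 i, h3] at h2
  exact mul_left_cancel₀ (mul_pos hP.cw_pos h4).ne' h2
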